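/- **Conventions.** An event structure is a set of events with a partial order $\le$ (each event has finitely many causes) and a non-empty family of finite consistent sets containing all singletons, closed under subsets and under adding a cause of one of its elements. Its configurations are the consistent down-closed sets of events (they are finite); a map of event structures is a function on events that sends configurations to configurations and is injective on each of them. An isomorphism family is a set of bijections between configurations that contains identities, is closed under composition and inverse, and satisfies restriction (a member restricts, to any sub-configuration of its domain, to a member) and extension (a member extends, to any larger configuration containing its domain, to a member). A *thin concurrent game* (tcg) $A$ is an event structure with polarities $\pm$ and three isomorphism families $\cong_A$ (polarity-preserving), $\cong_A^+$, $\cong_A^-$, with $\cong_A^\pm\subseteq\cong_A$, such that a bijection in both $\cong_A^+$ and $\cong_A^-$ is an identity, and such that if $\theta\in{\cong_A^+}$ (resp. $\cong_A^-$) is extended to $\theta'\in{\cong_A}$ by positive (resp. negative) events only, then $\theta'\in{\cong_A^+}$ (resp. $\cong_A^-$). The dual $A^\perp$ reverses polarities and exchanges $\cong^+$ and $\cong^-$; $A\parallel B$ is the disjoint juxtaposition. We write $x\cong_A y$ (resp. $\cong^{\pm}_A$) if some bijection in the family has domain $x$ and codomain $y$; $\mathcal C^{\cong}(A)$ is the set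 of $\cong_A$-classes of configurations of $A$. A *strategy* $\sigma:A\to B$ is an event structure with polarities and an isomorphism family $\cong_S$, together with a map of event structures $\sigma:S\to A^\perp\parallel B$ that preserves polarities and symmetry and is: *courteous* (if $s$ is an immediate cause of $s'$ and $s$ is positive or $s'$ is negative, then $\sigma s$ is an immediate cause of $\sigma s'$); *receptive* (if $\sigma x$ extends by a negative event $a$, then there is a unique $s$ with $\sigma s=a$ such that $x\cup\{s\}$ is a configuration); *$\sim$-receptive* (if $\theta\in{\cong_S}$ and $\sigma\theta\cup\{(a,b)\}$ is a symmetry with $a,b$ negative and $(a,b)\notin\sigma\theta$, then there is a unique pair $(s,s')$ over $(a,b)$ with $\theta\cup\{(s,s')\}\in{\cong_S}$); and *thin* (if $\mathrm{id}_x\cup\{(s,s')\}\in{\cong_S}$ with $s\notin x$ and $s,s'$ positive, then $s=s'$). For a configuration $x$ of $S$ write $\sigma x=x_A\parallel x_B$. It is *$+$-covered* if all its maximal events are positive. For $\sigma:A\to B$ and $\tau:B\to C$, a bijection between configurations is *secured* if the relation on its graph generated by the two causal orders is acyclic. The composition $\tau\odot\sigma$ is obtained from the interaction $T\circledast S$,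 the pullback of $\sigma\parallel C$ and $A\parallel\tau$ over $A\parallel B\parallel C$ (its events are the secured bijections $x\simeq y$, with $(\sigma\parallel C)x=(A\parallel\tau)y$, that have a greatest element, ordered by inclusion; a finite set of them is consistent if some secured bijection of this kind contains all its members), by hiding the events labelled in $B$. The strategies $\sigma$ and $\tau$ *do not deadlock* if for all configurations $x^S$ of $S$, $x^T$ of $T$ and every symmetry $\theta_B:x^S_B\cong_B x^T_B$, the induced bijection $x^S\parallel x^T_C\simeq x^S_A\parallel x^T$ is secured. A configuration $x$ of $B$ is *canonical* if every $\theta:x\cong_B x$ factors uniquely as $\theta_+\circ\theta_-$ with $\theta_-:x\cong_B^-x$ and $\theta_+:x\cong_B^+x$; $B$ is *representable* if every class in $\mathcal C^{\cong}(B)$ contains a canonical configuration. For a choice of a representative $\underline{\mathsf x}\in\mathsf x$ of every symmetry class of each game, the collapse of $\sigma:A\to B$ is the matrix over $\overline{\mathbb N}=\mathbb N\cup\{+\infty\}$ $$(\mathrm{coll}\,\sigma)_{\mathsf x_A,\mathsf x_B}=\#\{x\text{ a }+\text{-covered configuration of }S\mid x_A\cong_A^-\underline{\mathsf x}_A,\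 x_B\cong_B^+\underline{\mathsf x}_B\}.$$ **Theorem.** Let $A,B,C$ be thin concurrent games and let $\sigma:A\to B$ and $\tau:B\to C$ be strategies that do not deadlock. Assume that $B$ is representable. Fix a choice of canonical representatives for the symmetry classes of $B$, and arbitrary choices of representatives for those of $A$ and of $C$. Then for all $\mathsf x_A\in\mathcal C^{\cong}(A)$ and $\mathsf x_C\in\mathcal C^{\cong}(C)$, $$(\mathrm{coll}(\tau\odot\sigma))_{\mathsf x_A,\mathsf x_C}=\sum_{\mathsf x_B\in\mathcal C^{\cong}(B)}(\mathrm{coll}\,\sigma)_{\mathsf x_A,\mathsf x_B}\cdot(\mathrm{coll}\,\tau)_{\mathsf x_B,\mathsf x_C}$$ in $\overline{\mathbb N}$ (with $0\cdot\infty=0$). -/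

import Mathlib

universe u v w u₁ u₂ u₃

namespace ThinGames

/-! ## Event structures and their maps -/

/-- Event structures: a set of events with a causal order `≤` and a non-empty family `Con` of
finite consistent sets of events. -/
structure EvStr where
  Ev : Type u
  [ord : PartialOrder Ev]
  Con : Set (Set Ev)
  finite_causes : ∀ e : Ev, (Set.Iic e).Finite
  con_finite : ∀ X ∈ Con, X.Finite
  con_empty : ∅ ∈ Con
  con_singleton : ∀ e : Ev, {e} ∈ Con
  con_subset : ∀ X ∈ Con, ∀ Y, Y ⊆ X → Y ∈ Con
  con_insert : ∀ X ∈ Con, ∀ e e' : Ev, e' ∈ X → e ≤ e' → insert e X ∈ Con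

attribute [instance] EvStr.ord

/-- (Finite) configurations: consistent down-closed sets of events. -/
def EvStr.IsConf (E : EvStr.{u}) (x : Set E.Ev) : Prop :=
  x ∈ E.Con ∧ ∀ e ∈ x, ∀ e', e' ≤ e → e' ∈ x

/-- The set of configurations. -/
def EvStr.Conf (E : EvStr.{u}) : Type u := {x : Set E.Ev // E.IsConf x}

/-- (Total) maps of event structures: they send configurations to configurations and are
injective on each configuration. -/
structure EvMap (E : EvStr.{u}) (F : EvStr.{v}) where
  toFun : E.Ev → F.Ev
  map_conf : ∀ x, E.IsConf x → F.IsConf (toFun '' x)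
  locally_inj : ∀ x, E.IsConf x → Set.InjOn toFun x

/-- Parallel composition `E ∥ F`. -/
@[reducible] def EvStr.par (E : EvStr.{u}) (F : EvStr.{v}) : EvStr.{max u v} where
  Ev := E.Ev ⊕ F.Ev
  Con := {X | Sum.inl ⁻¹' X ∈ E.Con ∧ Sum.inr ⁻¹' X ∈ F.Con}
  finite_causes := by
    rintro (e | e)
    · refine ((E.finite_causes e).image Sum.inl).subset ?_
      rintro (a | a) h
      · exact ⟨a, by simpa using h, rfl⟩
      · simp at h
    · refine ((F.finite_causes e).image Sum.inr).subset ?_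
      rintro (a | a) h
      · simp at h
      · exact ⟨a, by simpa using h, rfl⟩
  con_finite := by
    rintro X ⟨h1, h2⟩
    refine (((E.con_finite _ h1).image Sum.inl).union ((F.con_finite _ h2).image Sum.inr)).subset ?_
    rintro (a | a) h
    · exact Or.inl ⟨a, h, rfl⟩
    · exact Or.inr ⟨a, h, rfl⟩
  con_empty := ⟨E.con_empty, F.con_empty⟩
  con_singleton := by
    rintro (e | e)
    · exact ⟨E.con_subset _ (E.con_singleton e) _ (fun a h => by simpa using h),
        F.con_subset _ F.con_empty _ (fun a h => by simp at h)⟩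
    · exact ⟨E.con_subset _ E.con_empty _ (fun a h => by simp at h),
        F.con_subset _ (F.con_singleton e) _ (fun a h => by simpa using h)⟩
  con_subset := fun X hX Y hY =>
    ⟨E.con_subset _ hX.1 _ (Set.preimage_mono hY), F.con_subset _ hX.2 _ (Set.preimage_mono hY)⟩
  con_insert := by
    rintro X ⟨h1, h2⟩ (e | e) (e' | e') hX hle
    · exact ⟨E.con_subset _ (E.con_insert _ h1 e e' hX (by simpa using hle)) _
          (fun a h => by simpa using h),
        F.con_subset _ h2 _ (fun a h => by simpa using h)⟩
    · simp at hle
    · simp at hle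
    · exact ⟨E.con_subset _ h1 _ (fun a h => by simpa using h),
        F.con_subset _ (F.con_insert _ h2 e e' hX (by simpa using hle)) _
          (fun a h => by simpa using h)⟩

theorem EvStr.isConf_par {E : EvStr.{u}} {F : EvStr.{v}} {x : Set (E.Ev ⊕ F.Ev)} :
    (E.par F).IsConf x ↔ E.IsConf (Sum.inl ⁻¹' x) ∧ F.IsConf (Sum.inr ⁻¹' x) := by
  constructor
  · rintro ⟨⟨h1, h2⟩, h⟩
    exact ⟨⟨h1, fun e he e' hle => h _ he (Sum.inl e') (by simpa using hle)⟩,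
      ⟨h2, fun e he e' hle => h _ he (Sum.inr e') (by simpa using hle)⟩⟩
  · rintro ⟨⟨h1, h1'⟩, ⟨h2, h2'⟩⟩
    refine ⟨⟨h1, h2⟩, ?_⟩
    rintro (e | e) he (e' | e') hle
    · exact h1' e he e' (by simpa using hle)
    · simp at hle
    · simp at hle
    · exact h2' e he e' (by simpa using hle)

/-! ## Polarities and symmetries -/

/-- Polarities: `neg` for Opponent, `pos` for Player. -/
inductive Pol
  | neg
  | pos

/-- The opposite polarity. -/
def Pol.op : Pol → Pol
  | .neg => .pos
  | .pos => .neg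

/-- Event structures with polarities. -/
structure PolEvStr extends EvStr.{u} where
  pol : Ev → Pol

/-- The dual, with polarities reversed. -/
@[reducible] def PolEvStr.dual (E : PolEvStr.{u}) : PolEvStr.{u} where
  toEvStr := E.toEvStr
  pol := fun e => (E.pol e).op

/-- Parallel composition with polarities. -/
@[reducible] def PolEvStr.par (E : PolEvStr.{u}) (F : PolEvStr.{v}) : PolEvStr.{max u v} where
  toEvStr := E.toEvStr.par F.toEvStr
  pol := Sum.elim E.pol F.pol

/-- The identity bijection on `x`, as a graph. -/
def idRel {α : Type u} (x : Set α) : SetRel α α := {p | p.1 ∈ x ∧ p.1 = p.2}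

/-- Isomorphism families: sets of bijections between configurations (given by their graphs)
forming a groupoid and satisfying restriction and extension. The domain and codomain of
`θ` are `θ.dom` and `θ.cod`. -/
structure IsoFamily (E : EvStr.{u}) where
  sym : Set (SetRel E.Ev E.Ev)
  dom_conf : ∀ θ ∈ sym, E.IsConf θ.dom
  cod_conf : ∀ θ ∈ sym, E.IsConf θ.cod
  bij : ∀ θ ∈ sym, ∀ p ∈ θ, ∀ q ∈ θ, p.1 = q.1 ↔ p.2 = q.2
  id_mem : ∀ x, E.IsConf x → idRel x ∈ sym
  inv_mem : ∀ θ ∈ sym, θ.inv ∈ sym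
  comp_mem : ∀ θ ∈ sym, ∀ φ ∈ sym, θ.cod = φ.dom → θ.comp φ ∈ sym
  restrict : ∀ θ ∈ sym, ∀ x, E.IsConf x → x ⊆ θ.dom → {p ∈ θ | p.1 ∈ x} ∈ sym
  extend : ∀ θ ∈ sym, ∀ x, E.IsConf x → θ.dom ⊆ x → ∃ φ ∈ sym, θ ⊆ φ ∧ φ.dom = x

/-- `θ : x ≅ y` in the isomorphism family `F`. -/
def IsoFamily.Iso {E : EvStr.{u}} (F : IsoFamily E) (θ : SetRel E.Ev E.Ev) (x y : Set E.Ev) :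
    Prop :=
  θ ∈ F.sym ∧ θ.dom = x ∧ θ.cod = y

/-- `x ≅ y`: some bijection of the isomorphism family relates `x` and `y`. -/
def IsoFamily.Related {E : EvStr.{u}} (F : IsoFamily E) (x y : Set E.Ev) : Prop :=
  ∃ θ, F.Iso θ x y

/-- `θ ∥ φ`. -/
def parRel {α : Type u} {β : Type v} (θ : SetRel α α) (φ : SetRel β β) :
    SetRel (α ⊕ β) (α ⊕ β) :=
  {p | Sum.LiftRel (fun a a' => (a, a') ∈ θ) (fun b b' => (b, b') ∈ φ) p.1 p.2}

section parRel

variable {α : Type u} {β : Type v} (θ : SetRel α α) (φ : SetRel β β)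

@[simp] theorem inl_mem_parRel {a a' : α} :
    ((Sum.inl a, Sum.inl a') : (α ⊕ β) × (α ⊕ β)) ∈ parRel θ φ ↔ (a, a') ∈ θ := by
  simp [parRel]

@[simp] theorem inr_mem_parRel {b b' : β} :
    ((Sum.inr b, Sum.inr b') : (α ⊕ β) × (α ⊕ β)) ∈ parRel θ φ ↔ (b, b') ∈ φ := by
  simp [parRel]

@[simp] theorem inl_inr_mem_parRel {a : α} {b : β} :
    ((Sum.inl a, Sum.inr b) : (α ⊕ β) × (α ⊕ β)) ∉ parRel θ φ := by
  simp [parRel]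

@[simp] theorem inr_inl_mem_parRel {a : α} {b : β} :
    ((Sum.inr b, Sum.inl a) : (α ⊕ β) × (α ⊕ β)) ∉ parRel θ φ := by
  simp [parRel]

theorem inl_dom_parRel : Sum.inl ⁻¹' (parRel θ φ).dom = θ.dom := by
  ext a; simp

theorem inr_dom_parRel : Sum.inr ⁻¹' (parRel θ φ).dom = φ.dom := by
  ext a; simp

theorem inl_cod_parRel : Sum.inl ⁻¹' (parRel θ φ).cod = θ.cod := by
  ext a; simp

theorem inr_cod_parRel : Sum.inr ⁻¹' (parRel θ φ).cod = φ.cod := by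
  ext a; simp

theorem parRel_subset {θ θ' : SetRel α α} {φ φ' : SetRel β β}
    (h : parRel θ φ ⊆ parRel θ' φ') : θ ⊆ θ' ∧ φ ⊆ φ' :=
  ⟨fun p hp => by simpa using @h (Sum.inl p.1, Sum.inl p.2) (by simpa using hp),
    fun p hp => by simpa using @h (Sum.inr p.1, Sum.inr p.2) (by simpa using hp)⟩

theorem parRel_inj {θ θ' : SetRel α α} {φ φ' : SetRel β β}
    (h : parRel θ φ = parRel θ' φ') : θ = θ' ∧ φ = φ' :=
  ⟨(parRel_subset h.subset).1.antisymm (parRel_subset h.symm.subset).1,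
    (parRel_subset h.subset).2.antisymm (parRel_subset h.symm.subset).2⟩

end parRel

/-- The symmetries of `E ∥ F` are the `θ ∥ φ` for `θ`, `φ` symmetries of `E`, `F`. -/
@[reducible] def IsoFamily.par {E : EvStr.{u}} {F : EvStr.{v}} (I : IsoFamily E) (J : IsoFamily F) :
    IsoFamily (E.par F) where
  sym := {χ | ∃ θ ∈ I.sym, ∃ φ ∈ J.sym, χ = parRel θ φ}
  dom_conf := by
    rintro _ ⟨θ, hθ, φ, hφ, rfl⟩
    rw [EvStr.isConf_par, inl_dom_parRel, inr_dom_parRel]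
    exact ⟨I.dom_conf _ hθ, J.dom_conf _ hφ⟩
  cod_conf := by
    rintro _ ⟨θ, hθ, φ, hφ, rfl⟩
    rw [EvStr.isConf_par, inl_cod_parRel, inr_cod_parRel]
    exact ⟨I.cod_conf _ hθ, J.cod_conf _ hφ⟩
  bij := by
    rintro _ ⟨θ, hθ, φ, hφ, rfl⟩ ⟨a | a, a' | a'⟩ hp ⟨b | b, b' | b'⟩ hq <;> simp at hp hq ⊢
    · exact I.bij _ hθ _ hp _ hq
    · exact J.bij _ hφ _ hp _ hq
  id_mem := by
    intro x hx
    rw [EvStr.isConf_par] at hx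
    refine ⟨_, I.id_mem _ hx.1, _, J.id_mem _ hx.2, ?_⟩
    ext ⟨a | a, b | b⟩ <;> simp [idRel]
  inv_mem := by
    rintro _ ⟨θ, hθ, φ, hφ, rfl⟩
    refine ⟨_, I.inv_mem _ hθ, _, J.inv_mem _ hφ, ?_⟩
    ext ⟨a | a, b | b⟩ <;> simp
  comp_mem := by
    rintro _ ⟨θ, hθ, φ, hφ, rfl⟩ _ ⟨θ', hθ', φ', hφ', rfl⟩ h
    refine ⟨_, I.comp_mem _ hθ _ hθ' ?_, _, J.comp_mem _ hφ _ hφ' ?_, ?_⟩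
    · rw [← inl_cod_parRel θ φ, h, inl_dom_parRel]
    · rw [← inr_cod_parRel θ φ, h, inr_dom_parRel]
    · ext ⟨a | a, b | b⟩ <;> simp
  restrict := by
    rintro _ ⟨θ, hθ, φ, hφ, rfl⟩ x hx hsub
    rw [EvStr.isConf_par] at hx
    refine ⟨_, I.restrict _ hθ _ hx.1 ?_, _, J.restrict _ hφ _ hx.2 ?_, ?_⟩
    · rw [← inl_dom_parRel θ φ]; exact Set.preimage_mono hsub
    · rw [← inr_dom_parRel θ φ]; exact Set.preimage_mono hsub
    · ext ⟨a | a, b | b⟩ <;> simp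
  extend := by
    rintro _ ⟨θ, hθ, φ, hφ, rfl⟩ x hx hsub
    rw [EvStr.isConf_par] at hx
    obtain ⟨θ', hθ', h1, h1'⟩ := I.extend _ hθ _ hx.1
      (by rw [← inl_dom_parRel θ φ]; exact Set.preimage_mono hsub)
    obtain ⟨φ', hφ', h2, h2'⟩ := J.extend _ hφ _ hx.2
      (by rw [← inr_dom_parRel θ φ]; exact Set.preimage_mono hsub)
    refine ⟨_, ⟨θ', hθ', φ', hφ', rfl⟩, ?_, ?_⟩
    · rintro ⟨a | a, b | b⟩ h <;> simp at h ⊢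
      · exact h1 h
      · exact h2 h
    · ext (a | a)
      · have := Set.ext_iff.1 h1' a
        rw [← inl_dom_parRel θ' φ'] at this
        exact this
      · have := Set.ext_iff.1 h2' a
        rw [← inr_dom_parRel θ' φ'] at this
        exact this

/-! ## Thin concurrent games -/

/-- `θ ⊆ φ`, where `φ` adds only pairs of events of polarity `ε`. -/
def PolEvStr.ExtBy (E : PolEvStr.{u}) (ε : Pol) (θ φ : SetRel E.Ev E.Ev) : Prop :=
  θ ⊆ φ ∧ ∀ p ∈ φ, p ∉ θ → E.pol p.1 = ε ∧ E.pol p.2 = ε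

/-- Thin concurrent games: an event structure with polarities, a polarity-preserving symmetry
and its positive and negative sub-symmetries. -/
structure TCG extends PolEvStr.{u} where
  iso : IsoFamily toEvStr
  isoPos : IsoFamily toEvStr
  isoNeg : IsoFamily toEvStr
  pol_iso : ∀ θ ∈ iso.sym, ∀ p ∈ θ, pol p.1 = pol p.2
  pos_le : isoPos.sym ⊆ iso.sym
  neg_le : isoNeg.sym ⊆ iso.sym
  pos_inter_neg : ∀ θ ∈ isoPos.sym, θ ∈ isoNeg.sym → ∀ p ∈ θ, p.1 = p.2
  pos_ext : ∀ θ ∈ isoPos.sym, ∀ φ ∈ iso.sym, toPolEvStr.ExtBy Pol.pos θ φ → φ ∈ isoPos.sym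
  neg_ext : ∀ θ ∈ isoNeg.sym, ∀ φ ∈ iso.sym, toPolEvStr.ExtBy Pol.neg θ φ → φ ∈ isoNeg.sym

/-- The dual game `A^⊥`. -/
@[reducible] def TCG.dual (A : TCG.{u}) : TCG.{u} where
  toPolEvStr := A.toPolEvStr.dual
  iso := A.iso
  isoPos := A.isoNeg
  isoNeg := A.isoPos
  pol_iso := fun θ hθ p hp => congrArg Pol.op (A.pol_iso θ hθ p hp)
  pos_le := A.neg_le
  neg_le := A.pos_le
  pos_inter_neg := fun θ h1 h2 => A.pos_inter_neg θ h2 h1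
  pos_ext := fun θ hθ φ hφ h => A.neg_ext θ hθ φ hφ ⟨h.1, fun p hp hp' => by
    have := h.2 p hp hp'
    revert this
    cases h1 : A.pol p.1 <;> cases h2 : A.pol p.2 <;> simp [h1, h2, Pol.op]⟩
  neg_ext := fun θ hθ φ hφ h => A.pos_ext θ hθ φ hφ ⟨h.1, fun p hp hp' => by
    have := h.2 p hp hp'
    revert this
    cases h1 : A.pol p.1 <;> cases h2 : A.pol p.2 <;> simp [h1, h2, Pol.op]⟩

theorem extBy_par {E : PolEvStr.{u}} {F : PolEvStr.{v}} {ε : Pol} {θ θ' : SetRel E.Ev E.Ev}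
    {φ φ' : SetRel F.Ev F.Ev} (h : (E.par F).ExtBy ε (parRel θ φ) (parRel θ' φ')) :
    E.ExtBy ε θ θ' ∧ F.ExtBy ε φ φ' := by
  refine ⟨⟨(parRel_subset h.1).1, fun p hp hp' => ?_⟩, (parRel_subset h.1).2, fun p hp hp' => ?_⟩
  · exact h.2 (Sum.inl p.1, Sum.inl p.2) (by simpa using hp) (by simpa using hp')
  · exact h.2 (Sum.inr p.1, Sum.inr p.2) (by simpa using hp) (by simpa using hp')

/-- The parallel composition `A ∥ B` of games. -/
@[reducible] def TCG.par (A : TCG.{u}) (B : TCG.{v}) : TCG.{max u v} where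
  toPolEvStr := A.toPolEvStr.par B.toPolEvStr
  iso := A.iso.par B.iso
  isoPos := A.isoPos.par B.isoPos
  isoNeg := A.isoNeg.par B.isoNeg
  pol_iso := by
    rintro _ ⟨θ, hθ, φ, hφ, rfl⟩ ⟨a | a, b | b⟩ h <;> simp at h ⊢
    · exact A.pol_iso _ hθ _ h
    · exact B.pol_iso _ hφ _ h
  pos_le := by
    rintro _ ⟨θ, hθ, φ, hφ, rfl⟩
    exact ⟨_, A.pos_le hθ, _, B.pos_le hφ, rfl⟩
  neg_le := by
    rintro _ ⟨θ, hθ, φ, hφ, rfl⟩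
    exact ⟨_, A.neg_le hθ, _, B.neg_le hφ, rfl⟩
  pos_inter_neg := by
    rintro _ ⟨θ, hθ, φ, hφ, rfl⟩ ⟨θ', hθ', φ', hφ', h⟩
    obtain ⟨rfl, rfl⟩ := parRel_inj h
    rintro ⟨a | a, b | b⟩ h <;> simp at h ⊢
    · exact A.pos_inter_neg _ hθ hθ' _ h
    · exact B.pos_inter_neg _ hφ hφ' _ h
  pos_ext := by
    rintro _ ⟨θ, hθ, φ, hφ, rfl⟩ _ ⟨θ', hθ', φ', hφ', rfl⟩ h
    obtain ⟨h1, h2⟩ := extBy_par h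
    exact ⟨_, A.pos_ext _ hθ _ hθ' h1, _, B.pos_ext _ hφ _ hφ' h2, rfl⟩
  neg_ext := by
    rintro _ ⟨θ, hθ, φ, hφ, rfl⟩ _ ⟨θ', hθ', φ', hφ', rfl⟩ h
    obtain ⟨h1, h2⟩ := extBy_par h
    exact ⟨_, A.neg_ext _ hθ _ hθ' h1, _, B.neg_ext _ hφ _ hφ' h2, rfl⟩

theorem iso_comp {E : EvStr.{u}} {F : IsoFamily E} {x y z : Set E.Ev}
    {θ φ : SetRel E.Ev E.Ev} (hθ : F.Iso θ x y) (hφ : F.Iso φ y z) : F.Iso (θ.comp φ) x z := by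
  obtain ⟨h1, rfl, rfl⟩ := hθ
  obtain ⟨h2, h3, rfl⟩ := hφ
  refine ⟨F.comp_mem _ h1 _ h2 h3.symm, ?_, ?_⟩
  · ext a
    constructor
    · rintro ⟨c, b, hb, -⟩
      exact ⟨b, hb⟩
    · rintro ⟨b, hb⟩
      obtain ⟨c, hc⟩ := (h3 ▸ (⟨a, hb⟩ : b ∈ θ.cod) : b ∈ φ.dom)
      exact ⟨c, b, hb, hc⟩
  · ext c
    constructor
    · rintro ⟨a, b, -, hb⟩
      exact ⟨b, hb⟩
    · rintro ⟨b, hb⟩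
      obtain ⟨a, ha⟩ := (h3 ▸ (⟨c, hb⟩ : b ∈ φ.dom) : b ∈ θ.cod)
      exact ⟨a, b, ha, hb⟩

/-- The relation `x ≅_A y` on configurations of a game. -/
def TCG.confSetoid (A : TCG.{u}) : Setoid A.Conf where
  r x y := A.iso.Related x.1 y.1
  iseqv := {
    refl := fun x => ⟨idRel x.1, A.iso.id_mem _ x.2, by ext a; simp [idRel],
      by ext a; simp [idRel]⟩
    symm := fun ⟨θ, h1, h2, h3⟩ => ⟨θ.inv, A.iso.inv_mem _ h1, h3, h2⟩
    trans := fun ⟨_, h⟩ ⟨_, h'⟩ => ⟨_, iso_comp h h'⟩ }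

/-- Symmetry classes of configurations of `A`. -/
def TCG.SymClass (A : TCG.{u}) : Type u := Quotient A.confSetoid

/-- `x` is canonical if every `θ : x ≅ x` factors uniquely as a negative endosymmetry of `x`
followed by a positive endosymmetry of `x`. -/
def TCG.Canonical (A : TCG.{u}) (x : A.Conf) : Prop :=
  ∀ θ, A.iso.Iso θ x.1 x.1 →
    ∃! p : SetRel A.Ev A.Ev × SetRel A.Ev A.Ev,
      A.isoNeg.Iso p.1 x.1 x.1 ∧ A.isoPos.Iso p.2 x.1 x.1 ∧ θ = p.1.comp p.2

/-- `A` is representable if every symmetry class contains a canonical configuration. -/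
def TCG.Representable (A : TCG.{u}) : Prop :=
  ∀ X : A.SymClass, ∃ x : A.Conf, Quotient.mk A.confSetoid x = X ∧ A.Canonical x

/-- A choice of a representative in every symmetry class. -/
structure TCG.Reps (A : TCG.{u}) where
  rep : A.SymClass → A.Conf
  rep_mem : ∀ X, Quotient.mk A.confSetoid (rep X) = X

/-! ## Strategies -/

/-- Maps of event structures with polarities `S → G`. -/
structure PreStrategy (G : PolEvStr.{v}) where
  S : PolEvStr.{u}
  map : EvMap S.toEvStr G.toEvStr
  map_pol : ∀ s, G.pol (map.toFun s) = S.pol s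

/-- The image `σ θ` of a relation. -/
def PreStrategy.mapRel {G : PolEvStr.{v}} (σ : PreStrategy.{u} G) (θ : SetRel σ.S.Ev σ.S.Ev) :
    SetRel G.Ev G.Ev :=
  Prod.map σ.map.toFun σ.map.toFun '' θ

/-- (Thin concurrent) strategies on the game `G`. -/
structure Strategy (G : TCG.{v}) extends PreStrategy.{u} G.toPolEvStr where
  iso : IsoFamily S.toEvStr
  map_iso : ∀ θ ∈ iso.sym, toPreStrategy.mapRel θ ∈ G.iso.sym
  courteous : ∀ s s', s ⋖ s' → (S.pol s = Pol.pos ∨ S.pol s' = Pol.neg) →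
    map.toFun s ⋖ map.toFun s'
  receptive : ∀ x, S.IsConf x → ∀ a, a ∉ map.toFun '' x → G.pol a = Pol.neg →
    G.IsConf (insert a (map.toFun '' x)) → ∃! s, S.IsConf (insert s x) ∧ map.toFun s = a
  sim_receptive : ∀ θ ∈ iso.sym, ∀ a b, (a, b) ∉ toPreStrategy.mapRel θ →
    G.pol a = Pol.neg → G.pol b = Pol.neg → insert (a, b) (toPreStrategy.mapRel θ) ∈ G.iso.sym →
    ∃! p : S.Ev × S.Ev, insert p θ ∈ iso.sym ∧ map.toFun p.1 = a ∧ map.toFun p.2 = b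
  thin : ∀ x, S.IsConf x → ∀ s s', s ∉ x → S.pol s = Pol.pos → S.pol s' = Pol.pos →
    insert (s, s') (idRel x) ∈ iso.sym → s = s'

/-- Maps of event structures with polarities `S → A^⊥ ∥ B`. -/
abbrev PreStrat (A : TCG.{u}) (B : TCG.{v}) := PreStrategy.{w} (A.dual.par B).toPolEvStr

/-- Strategies from `A` to `B`. -/
abbrev Strat (A : TCG.{u}) (B : TCG.{v}) := Strategy.{w} (A.dual.par B)

section Strat

variable {A : TCG.{u}} {B : TCG.{v}}

/-- The displayed event, in `A` or in `B`. -/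
def PreStrategy.lbl (σ : PreStrat.{u, v, w} A B) (s : σ.S.Ev) : A.Ev ⊕ B.Ev := σ.map.toFun s

/-- `x_A`, where `σ x = x_A ∥ x_B`. -/
def PreStrategy.left (σ : PreStrat.{u, v, w} A B) (x : Set σ.S.Ev) : Set A.Ev :=
  {a | ∃ s ∈ x, σ.lbl s = Sum.inl a}

/-- `x_B`, where `σ x = x_A ∥ x_B`. -/
def PreStrategy.right (σ : PreStrat.{u, v, w} A B) (x : Set σ.S.Ev) : Set B.Ev :=
  {b | ∃ s ∈ x, σ.lbl s = Sum.inr b}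

end Strat

/-- `x` is `+`-covered if all its maximal events are positive. -/
def PolEvStr.PlusCovered (S : PolEvStr.{u}) (x : Set S.Ev) : Prop :=
  ∀ s, Maximal (· ∈ x) s → S.pol s = Pol.pos

/-- The witnesses of `σ` for a pair of symmetry classes, with respect to chosen representatives.
(They do not involve the symmetry of `σ`.) -/
def PreStrategy.wit {A : TCG.{u}} {B : TCG.{v}} (σ : PreStrat.{u, v, w} A B) (rA : A.Reps)
    (rB : B.Reps) (X : A.SymClass) (Y : B.SymClass) : Set σ.S.Conf :=
  {x | σ.S.PlusCovered x.1 ∧ A.isoNeg.Related (σ.left x.1) (rA.rep X).1 ∧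
    B.isoPos.Related (σ.right x.1) (rB.rep Y).1}

/-- The weighted relation counting the witnesses of `σ`. -/
noncomputable def PreStrategy.coll {A : TCG.{u}} {B : TCG.{v}} (σ : PreStrat.{u, v, w} A B)
    (rA : A.Reps) (rB : B.Reps) (X : A.SymClass) (Y : B.SymClass) : ℕ∞ :=
  (σ.wit rA rB X Y).encard

/-! ## Secured bijections and pullbacks -/

section Secured

variable {P : Type u} {Q : Type v} [PartialOrder P] [PartialOrder Q]

/-- The one-step causality induced on the pairs of `φ` by the two orders. -/
def causes (φ : Set (P × Q)) (p q : P × Q) : Prop :=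
  p ∈ φ ∧ q ∈ φ ∧ (p.1 < q.1 ∨ p.2 < q.2)

theorem causes_mono {φ ψ : Set (P × Q)} (h : φ ⊆ ψ) : causes φ ≤ causes ψ :=
  fun _ _ hc => ⟨h hc.1, h hc.2.1, hc.2.2⟩

/-- A bijection (given by its graph) is secured if the induced causality is acyclic. -/
def Secured (φ : Set (P × Q)) : Prop :=
  ∀ p ∈ φ, ¬ Relation.TransGen (causes φ) p p

/-- `p` is below `q` for the causal order induced on `φ`. -/
def Below (φ : Set (P × Q)) (p q : P × Q) : Prop := Relation.ReflTransGen (causes φ) p q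

end Secured

section Pullback

variable {P : EvStr.{u}} {Q : EvStr.{v}} {G : EvStr.{w}} (f : EvMap P G) (g : EvMap Q G)

/-- The secured bijections `x ≃ f x = g y ≃ y`, for configurations `x` of `P` and `y` of `Q`
with `f x = g y`. By local injectivity of `f` and `g`, the graphs below are those of bijections. -/
def SecBij : Set (Set (P.Ev × Q.Ev)) :=
  {φ | P.IsConf (Prod.fst '' φ) ∧ Q.IsConf (Prod.snd '' φ) ∧
    (∀ p ∈ φ, f.toFun p.1 = g.toFun p.2) ∧ Secured φ}

/-- Secured bijections with a greatest element for the induced causal order. -/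
def PrimeBij : Type (max u v) :=
  {φ : Set (P.Ev × Q.Ev) // φ ∈ SecBij f g ∧ ∃ p ∈ φ, ∀ q ∈ φ, Below φ q p}

/-- The greatest element of a prime secured bijection. -/
noncomputable def PrimeBij.top {f : EvMap P G} {g : EvMap Q G} (φ : PrimeBij f g) : P.Ev × Q.Ev :=
  φ.2.2.choose

theorem PrimeBij.top_mem {f : EvMap P G} {g : EvMap Q G} (φ : PrimeBij f g) : φ.top ∈ φ.1 :=
  φ.2.2.choose_spec.1

theorem PrimeBij.below_top {f : EvMap P G} {g : EvMap Q G} (φ : PrimeBij f g) :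
    ∀ q ∈ φ.1, Below φ.1 q φ.top :=
  φ.2.2.choose_spec.2

theorem SecBij.finite {f : EvMap P G} {g : EvMap Q G} {φ : Set (P.Ev × Q.Ev)}
    (h : φ ∈ SecBij f g) : φ.Finite :=
  ((P.con_finite _ h.1.1).prod (Q.con_finite _ h.2.1.1)).subset
    fun p hp => ⟨⟨p, hp, rfl⟩, ⟨p, hp, rfl⟩⟩

instance : PartialOrder (PrimeBij f g) :=
  inferInstanceAs (PartialOrder
    {φ : Set (P.Ev × Q.Ev) // φ ∈ SecBij f g ∧ ∃ p ∈ φ, ∀ q ∈ φ, Below φ q p})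

/-- The pullback of `f` and `g`: its events are the prime secured bijections, ordered by
inclusion, and a finite set of events is consistent if it is bounded by a secured bijection. -/
@[reducible] def pullback : EvStr.{max u v} where
  Ev := PrimeBij f g
  Con := {X | X.Finite ∧ ∃ ψ ∈ SecBij f g, ∀ φ ∈ X, φ.1 ⊆ ψ}
  finite_causes := fun φ =>
    ((SecBij.finite φ.2.1).finite_subsets.preimage Subtype.val_injective.injOn).subset
      fun _ h => h
  con_finite := fun _ h => h.1
  con_empty := by
    refine ⟨Set.finite_empty, ∅, ⟨?_, ?_, by simp, by simp [Secured]⟩, by simp⟩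
    · rw [Set.image_empty]; exact ⟨P.con_empty, by simp⟩
    · rw [Set.image_empty]; exact ⟨Q.con_empty, by simp⟩
  con_singleton := fun φ => ⟨Set.finite_singleton _, φ.1, φ.2.1, by simp⟩
  con_subset := fun _ h _ hY =>
    ⟨h.1.subset hY, h.2.imp fun _ hψ => ⟨hψ.1, fun φ hφ => hψ.2 φ (hY hφ)⟩⟩
  con_insert := by
    rintro X ⟨h1, ψ, hψ, h2⟩ φ φ' hφ' hle
    refine ⟨h1.insert _, ψ, hψ, ?_⟩
    rintro χ (rfl | hχ)
    · exact Set.Subset.trans hle (h2 _ hφ')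
    · exact h2 _ hχ

end Pullback

/-- The restriction of an event structure to a subset `V` of (visible) events. -/
@[reducible] def EvStr.hide (E : EvStr.{u}) (V : Set E.Ev) : EvStr.{u} where
  Ev := {e // e ∈ V}
  Con := {X | Subtype.val '' X ∈ E.Con}
  finite_causes := fun e =>
    ((E.finite_causes e.1).preimage Subtype.val_injective.injOn).subset fun _ h => h
  con_finite := fun _ h => (E.con_finite _ h).of_finite_image Subtype.val_injective.injOn
  con_empty := by
    change Subtype.val '' (∅ : Set {e // e ∈ V}) ∈ E.Con
    rw [Set.image_empty]; exact E.con_empty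
  con_singleton := fun e => by
    change Subtype.val '' {e} ∈ E.Con
    rw [Set.image_singleton]; exact E.con_singleton _
  con_subset := fun _ h _ hY => E.con_subset _ h _ (Set.image_mono hY)
  con_insert := fun X h e e' he' hle => by
    change Subtype.val '' (insert e X) ∈ E.Con
    rw [Set.image_insert_eq]
    exact E.con_insert _ h e.1 e'.1 ⟨e', he', rfl⟩ hle

section Primes

variable {P : EvStr.{u}} {Q : EvStr.{v}} {G : EvStr.{w}} {f : EvMap P G} {g : EvMap Q G}

theorem SecBij.eq_of_fst {ψ : Set (P.Ev × Q.Ev)} (h : ψ ∈ SecBij f g) {p q : P.Ev × Q.Ev}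
    (hp : p ∈ ψ) (hq : q ∈ ψ) (hpq : p.1 = q.1) : p = q := by
  refine Prod.ext hpq (g.locally_inj _ h.2.1 ⟨p, hp, rfl⟩ ⟨q, hq, rfl⟩ ?_)
  rw [← h.2.2.1 p hp, ← h.2.2.1 q hq, hpq]

theorem SecBij.eq_of_snd {ψ : Set (P.Ev × Q.Ev)} (h : ψ ∈ SecBij f g) {p q : P.Ev × Q.Ev}
    (hp : p ∈ ψ) (hq : q ∈ ψ) (hpq : p.2 = q.2) : p = q := by
  refine Prod.ext (f.locally_inj _ h.1 ⟨p, hp, rfl⟩ ⟨q, hq, rfl⟩ ?_) hpq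
  rw [h.2.2.1 p hp, h.2.2.1 q hq, hpq]

/-- The part of a secured bijection below one of its elements is a prime secured bijection. -/
def PrimeBij.gen {ψ : Set (P.Ev × Q.Ev)} (h : ψ ∈ SecBij f g) {p : P.Ev × Q.Ev} (hp : p ∈ ψ) :
    PrimeBij f g := by
  refine ⟨{q ∈ ψ | Below ψ q p}, ⟨⟨?_, ?_⟩, ⟨?_, ?_⟩, ?_, ?_⟩, p, ⟨hp, .refl⟩, ?_⟩
  · exact P.con_subset _ h.1.1 _ (Set.image_mono fun _ hq => hq.1)
  · rintro _ ⟨q, hq, rfl⟩ e he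
    obtain ⟨r, hr, rfl⟩ := h.1.2 _ ⟨q, hq.1, rfl⟩ e he
    rcases he.eq_or_lt with h' | h'
    · exact ⟨q, hq, h'.symm⟩
    · exact ⟨r, ⟨hr, .head ⟨hr, hq.1, Or.inl h'⟩ hq.2⟩, rfl⟩
  · exact Q.con_subset _ h.2.1.1 _ (Set.image_mono fun _ hq => hq.1)
  · rintro _ ⟨q, hq, rfl⟩ e he
    obtain ⟨r, hr, rfl⟩ := h.2.1.2 _ ⟨q, hq.1, rfl⟩ e he
    rcases he.eq_or_lt with h' | h'
    · exact ⟨q, hq, h'.symm⟩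
    · exact ⟨r, ⟨hr, .head ⟨hr, hq.1, Or.inr h'⟩ hq.2⟩, rfl⟩
  · exact fun q hq => h.2.2.1 q hq.1
  · exact fun q hq hc => h.2.2.2 q hq.1 
      (Relation.TransGen.mono (causes_mono fun _ hq => hq.1) _ _ hc)
  · rintro q ⟨-, hq⟩
    induction hq using Relation.ReflTransGen.head_induction_on with
    | refl => exact .refl
    | head h1 h2 ih => exact .head ⟨⟨h1.1, .head h1 h2⟩, ⟨h1.2.1, h2⟩, h1.2.2⟩ ih

theorem PrimeBij.top_eq (φ : PrimeBij f g) {p : P.Ev × Q.Ev} (hp : p ∈ φ.1)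
    (h : ∀ q ∈ φ.1, Below φ.1 q p) : φ.top = p := by
  by_contra hne
  have h1 := h _ φ.top_mem
  have h2 := φ.below_top _ hp
  rcases Relation.reflTransGen_iff_eq_or_transGen.1 h1 with h3 | h3
  · exact hne h3.symm
  · exact φ.2.1.2.2.2 _ φ.top_mem (h3.trans_left h2)

theorem PrimeBij.gen_le (φ : PrimeBij f g) {p : P.Ev × Q.Ev} (hp : p ∈ φ.1) :
    PrimeBij.gen φ.2.1 hp ≤ φ := fun _ hq => hq.1

theorem PrimeBij.top_gen {ψ : Set (P.Ev × Q.Ev)} (h : ψ ∈ SecBij f g) {p : P.Ev × Q.Ev}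
    (hp : p ∈ ψ) : (PrimeBij.gen h hp).top = p := by
  refine PrimeBij.top_eq _ ⟨hp, .refl⟩ ?_
  rintro q ⟨-, hq⟩
  induction hq using Relation.ReflTransGen.head_induction_on with
  | refl => exact .refl
  | head h1 h2 ih => exact .head ⟨⟨h1.1, .head h1 h2⟩, ⟨h1.2.1, h2⟩, h1.2.2⟩ ih

theorem SecBij.mem_of_below {φ ψ : Set (P.Ev × Q.Ev)} (hφ : φ ∈ SecBij f g) (hψ : ψ ∈ SecBij f g)
    (hsub : φ ⊆ ψ) {p q : P.Ev × Q.Ev} (hp : p ∈ φ) (h : Below ψ q p) : q ∈ φ := by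
  induction h using Relation.ReflTransGen.head_induction_on with
  | refl => exact hp
  | @head a c h1 h2 ih =>
    rcases h1.2.2 with h3 | h3
    · obtain ⟨r, hr, hr'⟩ := hφ.1.2 _ ⟨c, ih, rfl⟩ _ h3.le
      exact SecBij.eq_of_fst hψ (hsub hr) h1.1 hr' ▸ hr
    · obtain ⟨r, hr, hr'⟩ := hφ.2.1.2 _ ⟨c, ih, rfl⟩ _ h3.le
      exact SecBij.eq_of_snd hψ (hsub hr) h1.1 hr' ▸ hr

theorem PrimeBij.eq_of_top {ψ : Set (P.Ev × Q.Ev)} (hψ : ψ ∈ SecBij f g) {φ χ : PrimeBij f g}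
    (h1 : φ.1 ⊆ ψ) (h2 : χ.1 ⊆ ψ) (h : φ.top = χ.top) : φ = χ := by
  have key : ∀ {φ χ : PrimeBij f g}, φ.1 ⊆ ψ → χ.1 ⊆ ψ → φ.top = χ.top → φ.1 ⊆ χ.1 := by
    intro φ χ h1 h2 h q hq
    refine SecBij.mem_of_below χ.2.1 hψ h2 χ.top_mem ?_
    rw [← h]
    exact Relation.ReflTransGen.mono (causes_mono h1) _ _ (φ.below_top q hq)
  exact Subtype.ext ((key h1 h2 h).antisymm (key h2 h1 h.symm))

end Primes

/-! ## Interaction and composition -/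

section Maps

variable {S : EvStr.{u}} {T : EvStr.{v}} {A : EvStr.{u₁}} {B : EvStr.{u₂}} {C : EvStr.{u₃}}

/-- `f ∥ C : S ∥ C → A ∥ B ∥ C`, for `f : S → A ∥ B`. -/
def EvMap.parRight (f : EvMap S (A.par B)) (C : EvStr.{u₃}) :
    EvMap (S.par C) (A.par (B.par C)) where
  toFun := fun e => Equiv.sumAssoc A.Ev B.Ev C.Ev (Sum.map f.toFun id e)
  map_conf := by
    intro x hx
    rw [EvStr.isConf_par] at hx
    have h := EvStr.isConf_par.1 (f.map_conf _ hx.1)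
    rw [EvStr.isConf_par, EvStr.isConf_par]
    refine ⟨?_, ?_, ?_⟩
    · convert h.1 using 1
      ext a
      constructor
      · rintro ⟨s | c, hs, he⟩
        · rcases h' : f.toFun s with a' | b' <;> simp [h'] at he
          exact ⟨s, hs, by rw [h', he]⟩
        · simp at he
      · rintro ⟨s, hs, he⟩
        exact ⟨Sum.inl s, hs, by simp [he]⟩
    · convert h.2 using 1
      ext a
      constructor
      · rintro ⟨s | c, hs, he⟩
        · rcases h' : f.toFun s with a' | b' <;> simp [h'] at he
          exact ⟨s, hs, by rw [h', he]⟩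
        · simp at he
      · rintro ⟨s, hs, he⟩
        exact ⟨Sum.inl s, hs, by simp [he]⟩
    · convert hx.2 using 1
      ext a
      constructor
      · rintro ⟨s | c, hs, he⟩
        · rcases h' : f.toFun s with a' | b' <;> simp [h'] at he
        · simp at he
          exact he ▸ hs
      · intro hs
        exact ⟨Sum.inr a, hs, by simp⟩
  locally_inj := by
    intro x hx
    rw [EvStr.isConf_par] at hx
    rintro (a | a) ha (b | b) hb h
    · exact congrArg _ (f.locally_inj _ hx.1 ha hb (by simpa using h))
    · rcases h' : f.toFun a with a' | b' <;> simp [h'] at h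
    · rcases h' : f.toFun b with a' | b' <;> simp [h'] at h
    · simpa using h

/-- `A ∥ g : A ∥ T → A ∥ B ∥ C`, for `g : T → B ∥ C`. -/
def EvMap.parLeft (g : EvMap T (B.par C)) (A : EvStr.{u₁}) :
    EvMap (A.par T) (A.par (B.par C)) where
  toFun := Sum.map id g.toFun
  map_conf := by
    intro x hx
    rw [EvStr.isConf_par] at hx
    rw [EvStr.isConf_par]
    constructor
    · convert hx.1 using 1
      ext a
      simp
    · convert g.map_conf _ hx.2 using 1
      ext a
      simp
  locally_inj := by
    intro x hx
    rw [EvStr.isConf_par] at hx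
    rintro (a | a) ha (b | b) hb h
    · simpa using h
    · simp at h
    · simp at h
    · exact congrArg _ (g.locally_inj _ hx.2 ha hb (by simpa using h))

/-- The interaction `T ⊛ S` of `f : S → A ∥ B` and `g : T → B ∥ C`: the pullback of `f ∥ C` and
`A ∥ g`. -/
@[reducible] def interaction (f : EvMap S (A.par B)) (g : EvMap T (B.par C)) :
    EvStr.{max (max u u₃) (max u₁ v)} :=
  pullback (f.parRight C) (g.parLeft A)

/-- The inclusion of `A ∥ C` in `A ∥ B ∥ C`. -/
def outer (A : EvStr.{u₁}) (B : EvStr.{u₂}) (C : EvStr.{u₃}) :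
    A.Ev ⊕ C.Ev → A.Ev ⊕ (B.Ev ⊕ C.Ev) :=
  Sum.map id Sum.inr

/-- The label in `A ∥ B ∥ C` of an event of the interaction. -/
noncomputable def interactionLbl (f : EvMap S (A.par B)) (g : EvMap T (B.par C))
    (e : (interaction f g).Ev) : A.Ev ⊕ (B.Ev ⊕ C.Ev) :=
  (f.parRight C).toFun (PrimeBij.top e).1

/-- The visible events of the interaction: those whose label is not in `B`. -/
def visible (f : EvMap S (A.par B)) (g : EvMap T (B.par C)) : Set (interaction f g).Ev :=
  {e | ∃ z, outer A B C z = interactionLbl f g e}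

/-- The event structure `T ⊙ S`: the interaction with the events in `B` hidden. -/
@[reducible] def composite (f : EvMap S (A.par B)) (g : EvMap T (B.par C)) :
    EvStr.{max (max u u₃) (max u₁ v)} :=
  (interaction f g).hide (visible f g)

/-- The label in `A ∥ C` of an event of `T ⊙ S`. -/
noncomputable def compositeLbl (f : EvMap S (A.par B)) (g : EvMap T (B.par C))
    (e : (composite f g).Ev) : A.Ev ⊕ C.Ev :=
  e.2.choose

theorem outer_compositeLbl (f : EvMap S (A.par B)) (g : EvMap T (B.par C))
    (e : (composite f g).Ev) :
    outer A B C (compositeLbl f g e) = interactionLbl f g e.1 :=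
  e.2.choose_spec

theorem outer_injective : Function.Injective (outer A B C) := by
  rintro (a | a) (b | b) h <;> simp_all [outer]

theorem outer_mono {z z' : A.Ev ⊕ C.Ev} (h : z ≤ z') : outer A B C z ≤ outer A B C z' := by
  rcases z with z | z <;> rcases z' with z' | z' <;> simp_all [outer]

/-- The composite map `T ⊙ S → A ∥ C`. -/
noncomputable def compositeMap (f : EvMap S (A.par B)) (g : EvMap T (B.par C)) :
    EvMap (composite f g) (A.par C) where
  toFun := compositeLbl f g
  map_conf := by
    rintro x ⟨⟨-, ψ, hψ, hx⟩, hlow⟩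
    have hW := (f.parRight C).map_conf _ hψ.1
    have hsub : ∀ z ∈ compositeLbl f g '' x,
        outer A B C z ∈ (f.parRight C).toFun '' (Prod.fst '' ψ) := by
      rintro _ ⟨e, he, rfl⟩
      rw [outer_compositeLbl]
      exact ⟨_, ⟨_, hx _ ⟨e, he, rfl⟩ (PrimeBij.top_mem e.1), rfl⟩, rfl⟩
    refine ⟨⟨A.con_subset _ hW.1.1 _ fun a ha => hsub _ ha,
      C.con_subset _ hW.1.2.2 _ fun c hc => hsub _ hc⟩, ?_⟩
    rintro _ ⟨e, he, rfl⟩ z hz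
    have hle := outer_mono (B := B) hz
    rw [outer_compositeLbl] at hle
    have hconf := (f.parRight C).map_conf _ e.1.2.1.1
    obtain ⟨_, ⟨p, hp, rfl⟩, hpz⟩ := hconf.2 _ ⟨_, ⟨_, PrimeBij.top_mem e.1, rfl⟩, rfl⟩ _ hle
    have hlbl : outer A B C z = interactionLbl f g (PrimeBij.gen e.1.2.1 hp) := by
      rw [interactionLbl, PrimeBij.top_gen, hpz]
    let e' : (composite f g).Ev := ⟨PrimeBij.gen e.1.2.1 hp, z, hlbl⟩
    refine ⟨e', hlow e he e' (PrimeBij.gen_le e.1 hp), ?_⟩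
    apply outer_injective (B := B)
    rw [outer_compositeLbl, hlbl]
  locally_inj := by
    rintro x ⟨⟨-, ψ, hψ, hx⟩, -⟩ e he e' he' h
    have h1 := outer_compositeLbl f g e
    rw [h, outer_compositeLbl] at h1
    have hm := hx _ ⟨e, he, rfl⟩
    have hm' := hx _ ⟨e', he', rfl⟩
    have htop : (PrimeBij.top e.1).1 = (PrimeBij.top e'.1).1 :=
      (f.parRight C).locally_inj _ hψ.1 ⟨_, hm (PrimeBij.top_mem e.1), rfl⟩
        ⟨_, hm' (PrimeBij.top_mem e'.1), rfl⟩ h1.symm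
    exact Subtype.ext (PrimeBij.eq_of_top hψ hm hm' (SecBij.eq_of_fst hψ
      (hm (PrimeBij.top_mem e.1)) (hm' (PrimeBij.top_mem e'.1)) htop))

end Maps

section Composition

variable {A : TCG.{u₁}} {B : TCG.{u₂}} {C : TCG.{u₃}}

/-- The composition `τ ⊙ σ`, with the polarities of `A^⊥ ∥ C`. -/
noncomputable def PreStrategy.comp (τ : PreStrat.{u₂, u₃, v} B C) (σ : PreStrat.{u₁, u₂, u} A B) :
    PreStrat.{u₁, u₃, max (max u u₃) (max u₁ v)} A C where
  S := {
    toEvStr := composite (A := A.toEvStr) (B := B.toEvStr) (C := C.toEvStr) σ.map τ.map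
    pol := fun e => (A.dual.par C).pol (compositeLbl (A := A.toEvStr) (B := B.toEvStr)
      (C := C.toEvStr) σ.map τ.map e) }
  map := compositeMap (A := A.toEvStr) (B := B.toEvStr) (C := C.toEvStr) σ.map τ.map
  map_pol := fun _ => rfl

/-- The composite bijection `x^S ∥ x^T_C ≃ x^S_A ∥ x^S_B ∥ x^T_C ≃ x^S_A ∥ x^T_B ∥ x^T_C ≃
x^S_A ∥ x^T` induced by `θ : x^S_B ≅ x^T_B`. -/
def syncBij (σ : PreStrat.{u₁, u₂, u} A B) (τ : PreStrat.{u₂, u₃, v} B C) (x : Set σ.S.Ev)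
    (y : Set τ.S.Ev) (θ : SetRel B.Ev B.Ev) : Set ((σ.S.Ev ⊕ C.Ev) × (A.Ev ⊕ τ.S.Ev)) :=
  {p | (∃ s ∈ x, ∃ a, σ.lbl s = Sum.inl a ∧ p = (Sum.inl s, Sum.inl a)) ∨
    (∃ s ∈ x, ∃ t ∈ y, ∃ b b', σ.lbl s = Sum.inr b ∧ τ.lbl t = Sum.inl b' ∧ (b, b') ∈ θ ∧
      p = (Sum.inl s, Sum.inr t)) ∨
    (∃ t ∈ y, ∃ c, τ.lbl t = Sum.inr c ∧ p = (Sum.inr c, Sum.inr t))}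

/-- `σ` and `τ` do not deadlock. -/
def DoNotDeadlock (σ : PreStrat.{u₁, u₂, u} A B) (τ : PreStrat.{u₂, u₃, v} B C) : Prop :=
  ∀ x y θ, σ.S.IsConf x → τ.S.IsConf y → B.iso.Iso θ (σ.right x) (τ.left y) →
    Secured (syncBij σ τ x y θ)

end Composition

end ThinGames

/-! The composition sees pairs of configurations that agree strictly on `B`, while the matrix
product sees pairs that agree there only up to symmetry. The proof compares the two by counting
configurations together with symmetries.

A `+`-covered configuration of the composition amounts to a pair of `+`-covered configurations `x`
of `σ` and `y` of `τ` with `x_B = y_B` (`coll_comp`). Absence of deadlock makes the induced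
bijection secured, and courtesy shows that its maximal elements are visible and positive exactly
when `x` and `y` are `+`-covered (`plusMaximal_matchBij`).

Such pairs are sorted by the class of `x_B`. Fix a class with canonical representative `b`. The
number of pairs times `#(b ≅ b)` counts triples `(x, y, θ : x_B ≅ b)`. The product of the two
numbers of witnesses, times `#(b ≅⁺ b) · #(b ≅⁻ b)`, counts quadruples made of a witness `x'` with
`θ₁ : x'_B ≅⁺ b` and a witness `y'` with `θ₂ : y'_B ≅⁻ b`. Canonicity makes the two factors equal,
and they are finite and nonzero, so a bijection between triples and quadruples suffices
(`card_matching_related`).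

From triples to quadruples, every symmetry out of the display of a configuration factors uniquely as
the display of a symmetry of the strategy followed by a positive symmetry (`Strategy.exists_lift`,
`Strategy.lift_unique`). In `σ` this makes `θ` positive; in `τ`, where `B` is dualized, it makes `θ`
negative.

Back from quadruples, `θ₂⁻¹ ∘ θ₁` matches `x'_B` with `y'_B`, and absence of deadlock allows both
configurations to be moved, event by event, until they agree on `B` (`exists_sync`). Each event of
`B` is positive for exactly one strategy, which chooses its image; the other follows by
`∼`-receptivity. Uniqueness (`sync_unique`) comes from thinness, receptivity and the fact that a
symmetry both positive and negative is an identity. -/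

namespace ThinGames

/-! ## Cardinalities in `ℕ∞` -/

section Card

/-- Partial sums increase in a complete lattice, hence converge to their supremum; no `tsum` in `ℕ∞`
below is a default value. -/
theorem enat_summable {ι : Type u} (f : ι → ℕ∞) : Summable f :=
  ⟨_, tendsto_atTop_iSup fun _ _ h => Finset.sum_le_sum_of_subset h⟩

theorem enat_card_sigma {ι : Type u} (α : ι → Type v) :
    ENat.card (Σ i, α i) = ∑' i, ENat.card (α i) := by
  apply ENat.toENNReal_strictMono.injective
  -- The embedding in the extended nonnegative reals is injective, additive and continuous, so it
  -- commutes with sums. There a cardinality is a sum of ones, and a sum over a sigma type is an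
  -- iterated sum.
  have h : ENat.toENNReal (∑' i, ENat.card (α i)) = ∑' i, ENat.toENNReal (ENat.card (α i)) :=
    (enat_summable fun i => ENat.card (α i)).map_tsum ENat.toENNRealRingHom
      ENat.continuous_toENNReal
  rw [h, ← ENNReal.tsum_one, ENNReal.tsum_sigma']
  simp

theorem enat_card_eq_tsum_fiber {α : Type u} {ι : Type v} (f : α → ι) :
    ENat.card α = ∑' i, ENat.card {a // f a = i} := by
  rw [← enat_card_sigma]
  exact ENat.card_congr (Equiv.sigmaFiberEquiv f).symm

/-- Transport along symmetries is only given as a relation between witnesses, with existence and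
uniqueness proved separately in each direction; this form assembles the four facts. -/
theorem enat_card_eq_of_rel {α : Type u} {β : Type v} (R : α → β → Prop) (h₁ : ∀ a, ∃ b, R a b)
    (h₂ : ∀ b, ∃ a, R a b) (h₃ : ∀ a b b', R a b → R a b' → b = b')
    (h₄ : ∀ a a' b, R a b → R a' b → a = a') : ENat.card α = ENat.card β := by
  choose f hf using h₁
  refine ENat.card_congr (Equiv.ofBijective f ⟨fun a a' h => ?_, fun b => ?_⟩)
  · exact h₄ _ _ _ (hf a) (h ▸ hf a')
  · obtain ⟨a, ha⟩ := h₂ b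
    exact ⟨a, h₃ _ _ _ (hf a) ha⟩

theorem enat_mul_right_cancel {a b c : ℕ∞} (h0 : c ≠ 0) (ht : c ≠ ⊤) (h : a * c = b * c) :
    a = b := by
  lift c to ℕ using ht
  have h0 : c ≠ 0 := by simpa using h0
  induction a using ENat.recTopCoe with
  | top =>
    induction b using ENat.recTopCoe with
    | top => rfl
    | coe b =>
      rw [ENat.top_mul (by simpa using h0)] at h
      exact absurd h.symm (by rw [← Nat.cast_mul]; exact ENat.natCast_ne_top _)
  | coe a =>
    induction b using ENat.recTopCoe with
    | top =>
      rw [ENat.top_mul (by simpa using h0)] at h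
      exact absurd h (by rw [← Nat.cast_mul]; exact ENat.natCast_ne_top _)
    | coe b =>
      norm_cast at h ⊢
      exact Nat.eq_of_mul_eq_mul_right (Nat.pos_of_ne_zero h0) h

end Card

/-! ## Configurations -/

theorem EvStr.isConf_empty (E : EvStr.{u}) : E.IsConf ∅ := ⟨E.con_empty, by simp⟩

theorem EvStr.IsConf.finite {E : EvStr.{u}} {x : Set E.Ev} (h : E.IsConf x) : x.Finite :=
  E.con_finite _ h.1

theorem EvStr.IsConf.mem {E : EvStr.{u}} {x : Set E.Ev} (h : E.IsConf x) {e e' : E.Ev}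
    (he : e ∈ x) (hle : e' ≤ e) : e' ∈ x := h.2 e he e' hle

theorem EvStr.isConf_Iic (E : EvStr.{u}) (e : E.Ev) : E.IsConf (Set.Iic e) := by
  -- The axioms add one cause at a time to a consistent set, so the history of `e` is reached from
  -- `{e}` by adding its finitely many causes.
  have key : ∀ t : Set E.Ev, t.Finite → t ⊆ Set.Iic e → insert e t ∈ E.Con := by
    intro t ht
    induction t, ht using Set.Finite.induction_on with
    | empty => intro _; simpa using E.con_singleton e
    | @insert a s _ _ ih =>
      intro h
      rw [Set.insert_comm]
      exact E.con_insert _ (ih fun _ h' => h (Or.inr h')) _ e (Or.inl rfl) (h (Or.inl rfl))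
  refine ⟨?_, fun a ha b hb => le_trans hb ha⟩
  simpa using key _ (E.finite_causes e) subset_rfl

/-- Removing a maximal event of a configuration. -/
theorem EvStr.IsConf.sdiff_maximal {E : EvStr.{u}} {x : Set E.Ev} (h : E.IsConf x) {e : E.Ev}
    (he : ∀ e' ∈ x, ¬ e < e') : E.IsConf (x \ {e}) := by
  refine ⟨E.con_subset _ h.1 _ Set.sdiff_subset, fun a ha b hb => ⟨h.mem ha.1 hb, ?_⟩⟩
  rintro rfl
  rcases hb.eq_or_lt with h' | h'
  · exact ha.2 h'.symm
  · exact he _ ha.1 h'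

/-- A nonempty configuration is finite, so it has a maximal event, and the rest is again a
configuration. Growing configurations event by event is what lets extension and receptivity be
applied. -/
theorem EvStr.IsConf.induction {E : EvStr.{u}} {p : Set E.Ev → Prop} (empty : p ∅)
    (insert : ∀ e x, E.IsConf x → e ∉ x → E.IsConf (insert e x) → p x → p (insert e x))
    {x : Set E.Ev} (hx : E.IsConf x) : p x := by
  induction hn : x.ncard generalizing x with
  | zero => rwa [(Set.ncard_eq_zero hx.finite).1 hn]
  | succ n ih =>
    obtain ⟨e, he⟩ := hx.finite.exists_maximal
      ((Set.ncard_pos hx.finite).1 (by omega))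
    have hx' := hx.sdiff_maximal (e := e) fun e' h' hlt => hlt.not_ge (he.2 h' hlt.le)
    have hi : Insert.insert e (x \ {e}) = x := by simp [Set.insert_eq_of_mem he.1]
    rw [← hi]
    refine insert _ _ hx' (by simp) (hi.symm ▸ hx) (ih hx' ?_)
    rw [Set.ncard_sdiff_singleton_of_mem he.1, hn]
    rfl

/-- The image of the history of `s'` is down-closed, so it contains the label of `s`; local
injectivity identifies the event found there with `s`. -/
theorem EvMap.lt_of_map_lt {E : EvStr.{u}} {F : EvStr.{v}} (f : EvMap E F) {x : Set E.Ev}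
    (hx : E.IsConf x) {s s' : E.Ev} (hs : s ∈ x) (hs' : s' ∈ x) (h : f.toFun s < f.toFun s') :
    s < s' := by
  obtain ⟨r, hr, hr'⟩ := (f.map_conf _ (E.isConf_Iic s')).mem ⟨s', le_rfl, rfl⟩ h.le
  have : r = s := f.locally_inj _ hx (hx.mem hs' hr) hs hr'
  subst this
  exact lt_of_le_of_ne hr (by rintro rfl; exact lt_irrefl _ h)

/-! ## Calculus of bijections -/

section Rel

variable {α : Type u} {β : Type v}

@[simp] theorem mem_idRel {x : Set α} {p : α × α} : p ∈ idRel x ↔ p.1 ∈ x ∧ p.1 = p.2 := Iff.rfl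

@[simp] theorem idRel_dom (x : Set α) : (idRel x).dom = x := by ext a; simp [idRel]

@[simp] theorem idRel_cod (x : Set α) : (idRel x).cod = x := by ext a; simp [idRel]

theorem idRel_empty : idRel (∅ : Set α) = ∅ := by ext; simp

theorem idRel_insert (a : α) (x : Set α) : idRel (insert a x) = insert (a, a) (idRel x) := by
  ext ⟨b, c⟩; simp only [mem_idRel, Set.mem_insert_iff, Prod.mk.injEq]; grind

theorem idRel_comp {x : Set α} {θ : SetRel α β} (h : θ.dom ⊆ x) : (idRel x).comp θ = θ := by
  ext ⟨a, b⟩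
  constructor
  · rintro ⟨c, ⟨-, rfl : a = c⟩, h'⟩; exact h'
  · exact fun h' => ⟨a, ⟨h ⟨b, h'⟩, rfl⟩, h'⟩

theorem comp_idRel {x : Set β} {θ : SetRel α β} (h : θ.cod ⊆ x) : θ.comp (idRel x) = θ := by
  ext ⟨a, b⟩
  constructor
  · rintro ⟨c, h', ⟨-, rfl : c = b⟩⟩; exact h'
  · exact fun h' => ⟨b, h', h ⟨a, h'⟩, rfl⟩

theorem insert_dom (a : α) (b : β) (θ : SetRel α β) :
    SetRel.dom (insert (a, b) θ) = insert a θ.dom := by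
  ext c; simp only [SetRel.mem_dom, Set.mem_insert_iff, Prod.mk.injEq]; grind

theorem insert_cod (a : α) (b : β) (θ : SetRel α β) :
    SetRel.cod (insert (a, b) θ) = insert b θ.cod := by
  ext c; simp only [SetRel.mem_cod, Set.mem_insert_iff, Prod.mk.injEq]; grind

theorem insert_inv (a : α) (b : β) (θ : SetRel α β) :
    SetRel.inv (insert (a, b) θ) = insert (b, a) θ.inv := by
  ext ⟨c, d⟩; simp only [SetRel.mem_inv, Set.mem_insert_iff, Prod.mk.injEq]; grind

theorem insert_comp_insert {γ : Type w} {a : α} {b : β} {c : γ} {θ : SetRel α β}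
    {φ : SetRel β γ} (h : b ∉ θ.cod) (h' : b ∉ φ.dom) :
    SetRel.comp (insert (a, b) θ) (insert (b, c) φ) = insert (a, c) (θ.comp φ) := by
  ext ⟨d, e⟩
  constructor
  · rintro ⟨m, hm | hm, hm' | hm'⟩
    · obtain ⟨rfl, -⟩ := Prod.mk.inj hm
      obtain ⟨-, rfl⟩ := Prod.mk.inj hm'
      exact Or.inl rfl
    · obtain ⟨-, rfl⟩ := Prod.mk.inj hm
      exact absurd ⟨_, hm'⟩ h'
    · obtain ⟨rfl, -⟩ := Prod.mk.inj hm'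
      exact absurd ⟨_, hm⟩ h
    · exact Or.inr ⟨m, hm, hm'⟩
  · rintro (hm | ⟨m, hm, hm'⟩)
    · obtain ⟨rfl, rfl⟩ := Prod.mk.inj hm
      exact ⟨b, Or.inl rfl, Or.inl rfl⟩
    · exact ⟨m, Or.inr hm, Or.inr hm'⟩

theorem comp_dom {γ : Type w} {θ : SetRel α β} {φ : SetRel β γ} (h : θ.cod = φ.dom) :
    (θ.comp φ).dom = θ.dom := by
  ext a
  constructor
  · rintro ⟨c, b, hb, -⟩
    exact ⟨b, hb⟩
  · rintro ⟨b, hb⟩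
    obtain ⟨c, hc⟩ : b ∈ φ.dom := h ▸ ⟨a, hb⟩
    exact ⟨c, b, hb, hc⟩

theorem comp_cod {γ : Type w} {θ : SetRel α β} {φ : SetRel β γ} (h : θ.cod = φ.dom) :
    (θ.comp φ).cod = φ.cod := by
  ext c
  constructor
  · rintro ⟨a, b, -, hb⟩
    exact ⟨b, hb⟩
  · rintro ⟨b, hb⟩
    obtain ⟨a, ha⟩ : b ∈ θ.cod := h ▸ ⟨c, hb⟩
    exact ⟨a, b, ha, hb⟩

theorem insert_pair_inj {a : α} {b b' : β} {θ θ' : SetRel α β} (ha : a ∉ θ.dom) (ha' : a ∉ θ'.dom)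
    (h : (insert (a, b) θ : SetRel α β) = insert (a, b') θ') : b = b' ∧ θ = θ' := by
  have hb : b = b' := by
    rcases (h ▸ Or.inl rfl : (a, b) ∈ (insert (a, b') θ' : Set (α × β))) with h1 | h1
    · exact (Prod.mk.inj h1).2
    · exact absurd ⟨b, h1⟩ ha'
  subst hb
  refine ⟨rfl, ?_⟩
  rw [← Set.insert_sdiff_self_of_notMem (fun hm => ha ⟨b, hm⟩ : (a, b) ∉ θ), h,
    Set.insert_sdiff_self_of_notMem (fun hm => ha' ⟨b, hm⟩ : (a, b) ∉ θ')]

theorem parRel_inv (θ : SetRel α α) (φ : SetRel β β) :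
    (parRel θ φ).inv = parRel θ.inv φ.inv := by
  ext ⟨a | a, b | b⟩ <;> simp

theorem parRel_comp (θ θ' : SetRel α α) (φ φ' : SetRel β β) :
    (parRel θ φ).comp (parRel θ' φ') = parRel (θ.comp θ') (φ.comp φ') := by
  ext ⟨a | a, b | b⟩ <;> simp

theorem insert_inl_parRel (a a' : α) (θ : SetRel α α) (φ : SetRel β β) :
    insert (Sum.inl a, Sum.inl a') (parRel θ φ) = parRel (insert (a, a') θ) φ := by
  ext ⟨b | b, c | c⟩ <;> simp

theorem insert_inr_parRel (b b' : β) (θ : SetRel α α) (φ : SetRel β β) :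
    insert (Sum.inr b, Sum.inr b') (parRel θ φ) = parRel θ (insert (b, b') φ) := by
  ext ⟨b | b, c | c⟩ <;> simp

theorem idRel_par (x : Set (α ⊕ β)) :
    idRel x = parRel (idRel (Sum.inl ⁻¹' x)) (idRel (Sum.inr ⁻¹' x)) := by
  ext ⟨a | a, b | b⟩ <;> simp

theorem parRel_dom (θ : SetRel α α) (φ : SetRel β β) :
    (parRel θ φ).dom = Sum.inl '' θ.dom ∪ Sum.inr '' φ.dom := by
  ext (a | a) <;> simp

theorem parRel_cod (θ : SetRel α α) (φ : SetRel β β) :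
    (parRel θ φ).cod = Sum.inl '' θ.cod ∪ Sum.inr '' φ.cod := by
  ext (a | a) <;> simp

end Rel

/-! ## Isomorphism families -/

namespace IsoFamily

variable {E : EvStr.{u}} {F : IsoFamily E} {θ φ : SetRel E.Ev E.Ev}

theorem eq_snd (hθ : θ ∈ F.sym) {a b c : E.Ev} (h : (a, b) ∈ θ) (h' : (a, c) ∈ θ) : b = c :=
  (F.bij θ hθ _ h _ h').1 rfl

theorem eq_fst (hθ : θ ∈ F.sym) {a b c : E.Ev} (h : (a, c) ∈ θ) (h' : (b, c) ∈ θ) : a = b :=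
  (F.bij θ hθ _ h _ h').2 rfl

theorem comp_inv_self (hθ : θ ∈ F.sym) : θ.comp θ.inv = idRel θ.dom := by
  ext ⟨a, b⟩
  constructor
  · rintro ⟨c, h, h'⟩; exact ⟨⟨c, h⟩, eq_fst hθ h h'⟩
  · rintro ⟨⟨c, h⟩, h'⟩; exact ⟨c, h, by cases h'; exact h⟩

theorem inv_comp_self (hθ : θ ∈ F.sym) : θ.inv.comp θ = idRel θ.cod :=
  comp_inv_self (F.inv_mem _ hθ)

theorem inv_comp_cancel (hθ : θ ∈ F.sym) (h : φ.dom ⊆ θ.cod) : θ.inv.comp (θ.comp φ) = φ := by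
  rw [← SetRel.comp_assoc, inv_comp_self hθ, idRel_comp h]

theorem comp_inv_cancel (hθ : θ ∈ F.sym) (h : φ.dom ⊆ θ.dom) : θ.comp (θ.inv.comp φ) = φ :=
  inv_comp_cancel (F.inv_mem _ hθ) h

theorem cancel_comp_inv (hθ : θ ∈ F.sym) (h : φ.cod ⊆ θ.dom) : (φ.comp θ).comp θ.inv = φ := by
  rw [SetRel.comp_assoc, comp_inv_self hθ, comp_idRel h]

theorem cancel_inv_comp (hθ : θ ∈ F.sym) (h : φ.cod ⊆ θ.cod) : (φ.comp θ.inv).comp θ = φ :=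
  cancel_comp_inv (F.inv_mem _ hθ) h

theorem iso_refl (F : IsoFamily E) {x : Set E.Ev} (hx : E.IsConf x) : F.Iso (idRel x) x x :=
  ⟨F.id_mem _ hx, idRel_dom x, idRel_cod x⟩

theorem Iso.symm {x y : Set E.Ev} (h : F.Iso θ x y) : F.Iso θ.inv y x :=
  ⟨F.inv_mem _ h.1, h.2.2, h.2.1⟩

theorem Related.symm {x y : Set E.Ev} (h : F.Related x y) : F.Related y x := by
  obtain ⟨θ, hθ⟩ := h
  exact ⟨_, hθ.symm⟩

/-- By bijectivity, an extension to one more event agrees with `θ` wherever `θ` is defined, so it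
adds a single pair. -/
theorem extend_one (hθ : θ ∈ F.sym) {e : E.Ev} (h : E.IsConf (insert e θ.dom)) :
    ∃ e', insert (e, e') θ ∈ F.sym := by
  obtain ⟨φ, hφ, hsub, hdom⟩ := F.extend _ hθ _ h (Set.subset_insert _ _)
  obtain ⟨e', he'⟩ : e ∈ φ.dom := hdom ▸ Set.mem_insert _ _
  refine ⟨e', ?_⟩
  convert hφ using 1
  refine (Set.insert_subset he' hsub).antisymm ?_
  rintro ⟨a, b⟩ hab
  rcases (hdom ▸ (⟨b, hab⟩ : a ∈ φ.dom) : a ∈ insert e θ.dom) with rfl | ⟨c, hc⟩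
  · exact Or.inl (by rw [eq_snd hφ hab he'])
  · exact Or.inr (by rwa [eq_snd hφ hab (hsub hc)])

theorem exists_insert_of_dom {e : E.Ev} {x : Set E.Ev} (hθ : θ ∈ F.sym)
    (hx : E.IsConf x) (hex : e ∉ x) (h : θ.dom = insert e x) :
    ∃ e' θ', θ' ∈ F.sym ∧ θ'.dom = x ∧ θ = insert (e, e') θ' := by
  obtain ⟨e', he'⟩ : e ∈ θ.dom := h ▸ Set.mem_insert _ _
  refine ⟨e', _, F.restrict θ hθ x hx (h ▸ Set.subset_insert _ _), ?_, ?_⟩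
  · ext a
    constructor
    · rintro ⟨b, -, hb⟩; exact hb
    · intro ha
      obtain ⟨b, hb⟩ : a ∈ θ.dom := h ▸ Or.inr ha
      exact ⟨b, hb, ha⟩
  · ext ⟨a, b⟩
    constructor
    · intro hab
      rcases (h ▸ (⟨b, hab⟩ : a ∈ θ.dom) : a ∈ insert e x) with rfl | hc
      · exact Or.inl (by rw [eq_snd hθ hab he'])
      · exact Or.inr ⟨hab, hc⟩
    · rintro (hab | hab)
      · rwa [hab]
      · exact hab.1

theorem notMem_cod_of_insert {e e' : E.Ev} (h : insert (e, e') θ ∈ F.sym) (he : e ∉ θ.dom) :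
    e' ∉ θ.cod := by
  rintro ⟨a, ha⟩
  exact he ⟨e', eq_fst h (Or.inl rfl) (Or.inr ha) ▸ ha⟩

/-- Restriction to the smaller domain gives back `θ`. In inductions, this passes positivity or
negativity down to the part already treated. -/
theorem mem_of_insert {e e' : E.Ev} (h : insert (e, e') θ ∈ F.sym) (he : e ∉ θ.dom)
    (hd : E.IsConf θ.dom) : θ ∈ F.sym := by
  convert F.restrict _ h _ hd (by rw [insert_dom]; exact Set.subset_insert _ _) using 1
  ext ⟨a, b⟩
  constructor
  · exact fun hab => ⟨Or.inr hab, b, hab⟩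
  · rintro ⟨hab | hab, h'⟩
    · cases hab
      exact absurd h' he
    · exact hab

/-- Symmetries preserve and reflect the causal order. -/
theorem lt_of_lt (hθ : θ ∈ F.sym) {a a' b b' : E.Ev} (h : (a, b) ∈ θ) (h' : (a', b') ∈ θ)
    (hlt : a < a') : b < b' := by
  -- The inverse symmetry restricted to the history of `b'` has a down-closed codomain containing
  -- `a'`, hence `a`; so the partner of `a` lies below `b'`.
  have hinv := F.restrict _ (F.inv_mem _ hθ) _ (E.isConf_Iic b') fun c hc =>
    (F.cod_conf _ hθ).mem ⟨a', h'⟩ hc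
  obtain ⟨c, hc, hcb⟩ := (F.cod_conf _ hinv).mem 
    (⟨b', h', le_rfl⟩ : a' ∈ SetRel.cod {p ∈ θ.inv | p.1 ∈ Set.Iic b'}) hlt.le
  obtain rfl : b = c := eq_snd hθ h hc
  refine lt_of_le_of_ne hcb ?_
  rintro rfl
  exact hlt.ne (eq_fst hθ h h')

end IsoFamily

/-! ## Symmetries of strategies -/

namespace PreStrategy

variable {G : PolEvStr.{v}} (σ : PreStrategy.{u} G)

@[simp] theorem mapRel_empty : σ.mapRel ∅ = ∅ := by simp [mapRel]

theorem mapRel_insert (s s' : σ.S.Ev) (θ : SetRel σ.S.Ev σ.S.Ev) :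
    σ.mapRel (insert (s, s') θ) = insert (σ.map.toFun s, σ.map.toFun s') (σ.mapRel θ) := by
  simp [mapRel, Set.image_insert_eq]

theorem mem_mapRel {θ : SetRel σ.S.Ev σ.S.Ev} {s s' : σ.S.Ev} (h : (s, s') ∈ θ) :
    (σ.map.toFun s, σ.map.toFun s') ∈ σ.mapRel θ := ⟨_, h, rfl⟩

theorem mapRel_dom (θ : SetRel σ.S.Ev σ.S.Ev) : (σ.mapRel θ).dom = σ.map.toFun '' θ.dom := by
  ext a
  constructor
  · rintro ⟨b, ⟨s, s'⟩, h, h'⟩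
    exact ⟨s, ⟨s', h⟩, congrArg Prod.fst h'⟩
  · rintro ⟨s, ⟨s', h⟩, rfl⟩
    exact ⟨_, σ.mem_mapRel h⟩

theorem mapRel_inv (θ : SetRel σ.S.Ev σ.S.Ev) : σ.mapRel θ.inv = (σ.mapRel θ).inv := by
  ext ⟨a, b⟩
  constructor
  · rintro ⟨⟨s, s'⟩, h, h'⟩
    exact ⟨(s', s), h, congrArg Prod.swap h'⟩
  · rintro ⟨⟨s, s'⟩, h, h'⟩
    exact ⟨(s', s), h, congrArg Prod.swap h'⟩

theorem mapRel_cod (θ : SetRel σ.S.Ev σ.S.Ev) : (σ.mapRel θ).cod = σ.map.toFun '' θ.cod := by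
  rw [← SetRel.dom_inv, ← mapRel_inv, mapRel_dom, SetRel.dom_inv]

theorem mapRel_idRel (x : Set σ.S.Ev) : σ.mapRel (idRel x) = idRel (σ.map.toFun '' x) := by
  ext ⟨a, b⟩
  constructor
  · rintro ⟨⟨s, s'⟩, ⟨h, h''⟩, h'⟩
    cases h''
    cases h'
    exact ⟨⟨s, h, rfl⟩, rfl⟩
  · rintro ⟨⟨s, h, rfl⟩, h'⟩
    cases h'
    exact σ.mem_mapRel ⟨h, rfl⟩

/-- Composability is needed for one inclusion: two middle events with the same label lie in the
common configuration `θ.cod = φ.dom`, where the map is injective. -/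
theorem mapRel_comp {F : IsoFamily σ.S.toEvStr} {θ φ : SetRel σ.S.Ev σ.S.Ev} (hθ : θ ∈ F.sym)
    (h : θ.cod = φ.dom) : σ.mapRel (θ.comp φ) = (σ.mapRel θ).comp (σ.mapRel φ) := by
  ext ⟨a, b⟩
  constructor
  · rintro ⟨⟨s, s'⟩, ⟨r, h1, h2⟩, h'⟩
    cases h'
    exact ⟨_, σ.mem_mapRel h1, σ.mem_mapRel h2⟩
  · rintro ⟨c, ⟨⟨s, r⟩, h1, h1'⟩, ⟨⟨r', s'⟩, h2, h2'⟩⟩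
    simp only [Prod.map_apply, Prod.mk.injEq] at h1' h2'
    obtain rfl : r = r' := σ.map.locally_inj _ (F.cod_conf _ hθ) ⟨s, h1⟩
      (h ▸ (⟨s', h2⟩ : r' ∈ φ.dom)) (h1'.2.trans h2'.1.symm)
    exact ⟨(s, s'), ⟨r, h1, h2⟩, Prod.ext h1'.1 h2'.2⟩

theorem map_notMem {x : Set σ.S.Ev} {s : σ.S.Ev} (hs : s ∉ x) (h : σ.S.IsConf (insert s x)) :
    σ.map.toFun s ∉ σ.map.toFun '' x := by
  rintro ⟨r, hr, h'⟩
  exact hs (σ.map.locally_inj _ h (Or.inr hr) (Or.inl rfl) h' ▸ hr)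

end PreStrategy

/-- An identity is also a negative symmetry, and adding a negative pair keeps it negative. The
extension is then both positive and negative, hence an identity. -/
theorem TCG.eq_of_insert_idRel_pos (G : TCG.{v}) {x : Set G.Ev} (hx : G.IsConf x) {a a' : G.Ev}
    (h : insert (a, a') (idRel x) ∈ G.isoPos.sym) (ha : G.pol a = Pol.neg) : a = a' := by
  refine G.pos_inter_neg _ h ?_ _ (Or.inl rfl)
  refine G.neg_ext (idRel x) (G.isoNeg.id_mem _ hx) _ (G.pos_le h) ⟨Set.subset_insert _ _, ?_⟩
  rintro p (rfl | h1) h2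
  · exact ⟨ha, (G.pol_iso _ (G.pos_le h) _ (Or.inl rfl)).symm.trans ha⟩
  · exact absurd h1 h2

namespace Strategy

variable {G : TCG.{v}} (σ : Strategy.{u} G)

theorem pol_iso {θ : SetRel σ.S.Ev σ.S.Ev} (hθ : θ ∈ σ.iso.sym) {s s' : σ.S.Ev}
    (h : (s, s') ∈ θ) : σ.S.pol s = σ.S.pol s' := by
  rw [← σ.map_pol, ← σ.map_pol]
  exact G.pol_iso _ (σ.map_iso _ hθ) _ (σ.mem_mapRel h)

/-- Two negative extensions of a configuration with the same label are equal. -/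
theorem eq_of_neg {x : Set σ.S.Ev} (hx : σ.S.IsConf x) {s s' : σ.S.Ev} (hs : s ∉ x)
    (h : σ.S.IsConf (insert s x)) (h' : σ.S.IsConf (insert s' x)) (hn : σ.S.pol s = Pol.neg)
    (he : σ.map.toFun s = σ.map.toFun s') : s = s' := by
  refine (σ.receptive x hx (σ.map.toFun s) (σ.map_notMem hs h) ?_ ?_).unique ⟨h, rfl⟩ ⟨h', he.symm⟩
  · rw [σ.map_pol, hn]
  · rw [← Set.image_insert_eq]
    exact σ.map.map_conf _ h

/-- A symmetry extending an identity by one pair is an identity as soon as the pair is positive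
or its members have the same label. -/
theorem eq_of_insert_idRel {x : Set σ.S.Ev} (hx : σ.S.IsConf x) {s s' : σ.S.Ev} (hs : s ∉ x)
    (h : insert (s, s') (idRel x) ∈ σ.iso.sym)
    (hp : σ.S.pol s = Pol.pos ∨ σ.map.toFun s = σ.map.toFun s') : s = s' := by
  have hd := σ.iso.dom_conf _ h
  have hc := σ.iso.cod_conf _ h
  rw [insert_dom, idRel_dom] at hd
  rw [insert_cod, idRel_cod] at hc
  -- Thinness settles positive events; receptivity settles negative ones, whose label is then
  -- assumed to be kept.
  cases hpol : σ.S.pol s with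
  | pos => exact σ.thin x hx s s' hs hpol ((σ.pol_iso h (Or.inl rfl)).symm.trans hpol) h
  | neg =>
    rw [hpol] at hp
    exact σ.eq_of_neg hx hs hd hc hpol (hp.resolve_left (by simp))

/-- Negative extensions of symmetries lift along a strategy. -/
theorem lift_neg {θ : SetRel σ.S.Ev σ.S.Ev} (hθ : θ ∈ σ.iso.sym) {s : σ.S.Ev} (hs : s ∉ θ.dom)
    (h : σ.S.IsConf (insert s θ.dom)) (hn : σ.S.pol s = Pol.neg) {g : G.Ev}
    (hg : insert (σ.map.toFun s, g) (σ.mapRel θ) ∈ G.iso.sym) :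
    ∃ s', σ.map.toFun s' = g ∧ insert (s, s') θ ∈ σ.iso.sym := by
  have h1 : G.pol (σ.map.toFun s) = Pol.neg := by rw [σ.map_pol, hn]
  have h2 : G.pol g = Pol.neg := (G.pol_iso _ hg _ (Or.inl rfl)).symm.trans h1
  -- `∼`-receptivity produces both members of the new pair; the first, `r`, is then identified with
  -- `s` by receptivity.
  obtain ⟨⟨r, s'⟩, ⟨h3, h4, h5⟩, -⟩ := σ.sim_receptive θ hθ _ _ (fun hm => by
    refine σ.map_notMem hs h ?_
    rw [← σ.mapRel_dom]
    exact ⟨_, hm⟩) h1 h2 hg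
  have hd := σ.iso.dom_conf _ h3
  rw [insert_dom] at hd
  obtain rfl := σ.eq_of_neg (σ.iso.dom_conf _ hθ) hs h hd hn h4.symm
  exact ⟨s', h5, h3⟩

/-- Extension of a symmetry by one event, keeping its display in a sub-symmetry `K` of the game
which is closed under positive extensions by the display of this event. -/
theorem extend_within {K : IsoFamily G.toEvStr} (hK : K.sym ⊆ G.iso.sym)
    {θ : SetRel σ.S.Ev σ.S.Ev} (hθ : θ ∈ σ.iso.sym) (hθK : σ.mapRel θ ∈ K.sym) {s : σ.S.Ev}
    (hs : s ∉ θ.dom) (h : σ.S.IsConf (insert s θ.dom))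
    (hpos : ∀ g, σ.S.pol s = Pol.pos → insert (σ.map.toFun s, g) (σ.mapRel θ) ∈ G.iso.sym →
      insert (σ.map.toFun s, g) (σ.mapRel θ) ∈ K.sym) :
    ∃ s', insert (s, s') θ ∈ σ.iso.sym ∧ σ.mapRel (insert (s, s') θ) ∈ K.sym := by
  -- A positive event is moved by an arbitrary extension in the strategy, which `hpos` keeps in `K`.
  -- For a negative event, the image is first chosen in `K` and then lifted.
  cases hp : σ.S.pol s with
  | pos =>
    obtain ⟨s', hs'⟩ := IsoFamily.extend_one hθ h
    refine ⟨s', hs', ?_⟩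
    have := σ.map_iso _ hs'
    rw [σ.mapRel_insert] at this ⊢
    exact hpos _ hp this
  | neg =>
    obtain ⟨g, hg⟩ := IsoFamily.extend_one hθK (e := σ.map.toFun s) (by
      rw [σ.mapRel_dom, ← Set.image_insert_eq]; exact σ.map.map_conf _ h)
    obtain ⟨s', rfl, hs'⟩ := σ.lift_neg hθ hs h hp (hK hg)
    exact ⟨s', hs', by rwa [σ.mapRel_insert]⟩

/-- Every symmetry from the display of a configuration factors as the display of a symmetry of
the strategy followed by a positive symmetry. -/
theorem exists_lift {x : Set σ.S.Ev} (hx : σ.S.IsConf x) : ∀ θ ∈ G.iso.sym,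
    θ.dom = σ.map.toFun '' x →
    ∃ φ ∈ σ.iso.sym, φ.dom = x ∧ (σ.mapRel φ).inv.comp θ ∈ G.isoPos.sym := by
  refine EvStr.IsConf.induction (p := fun x => ∀ θ ∈ G.iso.sym, θ.dom = σ.map.toFun '' x →
    ∃ φ ∈ σ.iso.sym, φ.dom = x ∧ (σ.mapRel φ).inv.comp θ ∈ G.isoPos.sym) ?_ ?_ hx
  · intro θ _ hθ
    rw [Set.image_empty, SetRel.dom_eq_empty_iff] at hθ
    subst hθ
    refine ⟨∅, ?_, by simp, ?_⟩
    · rw [← idRel_empty]; exact σ.iso.id_mem _ (EvStr.isConf_empty _)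
    · rw [σ.mapRel_empty, SetRel.inv_empty, SetRel.comp_empty, ← idRel_empty]
      exact G.isoPos.id_mem _ (EvStr.isConf_empty _)
  · intro s x hx hs hsx ih θ hθ hdom
    rw [Set.image_insert_eq] at hdom
    obtain ⟨w, θ', hθ', hdom', rfl⟩ := IsoFamily.exists_insert_of_dom hθ (σ.map.map_conf _ hx)
      (σ.map_notMem hs hsx) hdom
    obtain ⟨φ, hφ, rfl, hχ⟩ := ih θ' hθ' hdom'
    have hsd : σ.map.toFun s ∉ (σ.mapRel φ).dom := by
      rw [σ.mapRel_dom]; exact σ.map_notMem hs hsx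
    have hmd : (σ.mapRel φ).dom = θ'.dom := by rw [σ.mapRel_dom, hdom']
    cases hp : σ.S.pol s with
    | pos =>
      -- A positive event may be moved by any extension: the residual symmetry only gains a positive
      -- pair, so it stays positive.
      obtain ⟨s', hs'⟩ := IsoFamily.extend_one hφ hsx
      refine ⟨_, hs', insert_dom _ _ _, ?_⟩
      have hm := σ.map_iso _ hs'
      have hcomp : (σ.mapRel (insert (s, s') φ)).inv.comp (insert (σ.map.toFun s, w) θ') =
          insert (σ.map.toFun s', w) ((σ.mapRel φ).inv.comp θ') := by
        rw [σ.mapRel_insert, insert_inv, insert_comp_insert]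
        · exact hsd
        · exact hmd ▸ hsd
      have hiso : (σ.mapRel (insert (s, s') φ)).inv.comp (insert (σ.map.toFun s, w) θ') ∈
          G.iso.sym := by
        refine G.iso.comp_mem _ (G.iso.inv_mem _ hm) _ hθ ?_
        rw [SetRel.cod_inv, σ.mapRel_insert, insert_dom, insert_dom, hmd]
      refine G.pos_ext _ hχ _ hiso ⟨hcomp ▸ Set.subset_insert _ _, ?_⟩
      rw [hcomp] at hiso ⊢
      rintro p (rfl | hpm) hpn
      · have : G.pol (σ.map.toFun s') = Pol.pos := by
          rw [σ.map_pol, ← σ.pol_iso hs' (Or.inl rfl), hp]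
        exact ⟨this, (G.pol_iso _ hiso _ (Or.inl rfl)).symm.trans this⟩
      · exact absurd hpm hpn
    | neg =>
      have hχd : ((σ.mapRel φ).inv.comp θ').inv.dom = θ'.cod := by
        rw [SetRel.dom_inv]
        refine Set.Subset.antisymm ?_ ?_
        · rintro b ⟨a, c, -, h⟩; exact ⟨c, h⟩
        · rintro b ⟨c, h⟩
          obtain ⟨a, ha⟩ : c ∈ (σ.mapRel φ).dom := hmd ▸ ⟨b, h⟩
          exact ⟨a, c, ha, h⟩
      have hwc : w ∉ θ'.cod := IsoFamily.notMem_cod_of_insert hθ (hmd ▸ hsd)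
      -- For a negative event the residual symmetry is extended backwards first, from `w` to some
      -- `g`, within positive symmetries; `∼`-receptivity then realizes `g` as the label of an event
      -- of the strategy.
      obtain ⟨g, hg⟩ := IsoFamily.extend_one (G.isoPos.inv_mem _ hχ) (e := w) (by
        rw [hχd, ← insert_cod (σ.map.toFun s)]
        exact G.iso.cod_conf _ hθ)
      have hcomp : (insert (σ.map.toFun s, w) θ').comp
          (insert (w, g) ((σ.mapRel φ).inv.comp θ').inv) =
          insert (σ.map.toFun s, g) (σ.mapRel φ) := by
        rw [insert_comp_insert hwc (hχd ▸ hwc), SetRel.inv_comp, SetRel.inv_inv,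
          IsoFamily.comp_inv_cancel hθ' hmd.subset]
      have hm : insert (σ.map.toFun s, g) (σ.mapRel φ) ∈ G.iso.sym := by
        rw [← hcomp]
        refine G.iso.comp_mem _ hθ _ (G.pos_le hg) ?_
        rw [insert_cod, insert_dom, hχd]
      obtain ⟨s', rfl, hs'⟩ := σ.lift_neg hφ hs hsx hp hm
      refine ⟨_, hs', insert_dom _ _ _, ?_⟩
      rw [σ.mapRel_insert, insert_inv, insert_comp_insert hsd (hmd ▸ hsd)]
      have := G.isoPos.inv_mem _ hg
      rwa [insert_inv, SetRel.inv_inv] at this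

/-- A symmetry of a strategy whose display is positive is an identity. -/
theorem eq_idRel_of_pos {θ : SetRel σ.S.Ev σ.S.Ev} (hθ : θ ∈ σ.iso.sym)
    (hpos : σ.mapRel θ ∈ G.isoPos.sym) : θ = idRel θ.dom := by
  suffices H : ∀ {x}, σ.S.IsConf x → ∀ θ ∈ σ.iso.sym, θ.dom = x → σ.mapRel θ ∈ G.isoPos.sym →
      θ = idRel x from H (σ.iso.dom_conf _ hθ) θ hθ rfl hpos
  intro x hx
  refine EvStr.IsConf.induction (p := fun x => ∀ θ ∈ σ.iso.sym, θ.dom = x →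
    σ.mapRel θ ∈ G.isoPos.sym → θ = idRel x) ?_ ?_ hx
  · intro θ _ hd _
    rw [SetRel.dom_eq_empty_iff] at hd
    subst hd
    ext; simp
  · intro s x hx hs hsx ih θ hθ hd hpos
    obtain ⟨s', θ', hθ', hd', rfl⟩ := IsoFamily.exists_insert_of_dom hθ hx hs hd
    have hpos' : σ.mapRel θ' ∈ G.isoPos.sym := by
      rw [σ.mapRel_insert] at hpos
      refine IsoFamily.mem_of_insert hpos ?_ ?_ <;> rw [σ.mapRel_dom, hd']
      · exact σ.map_notMem hs hsx
      · exact σ.map.map_conf _ hx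
    obtain rfl := ih θ' hθ' hd' hpos'
    -- Positive events are fixed by thinness. At a negative event the positive display extends an
    -- identity by a negative pair, so the label is fixed and receptivity concludes.
    obtain rfl : s = s' := by
      refine σ.eq_of_insert_idRel hx hs hθ ?_
      cases hp : σ.S.pol s with
      | pos => exact Or.inl rfl
      | neg =>
        right
        rw [σ.mapRel_insert, σ.mapRel_idRel] at hpos
        exact G.eq_of_insert_idRel_pos (σ.map.map_conf _ hx) hpos (by rw [σ.map_pol, hp])
    rw [idRel_insert]

/-- Uniqueness of the factorization in `exists_lift`. -/
theorem lift_unique {φ φ' : SetRel σ.S.Ev σ.S.Ev} (hφ : φ ∈ σ.iso.sym) (hφ' : φ' ∈ σ.iso.sym)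
    (hd : φ.dom = φ'.dom) {θ θ' : SetRel G.Ev G.Ev} (hθ : θ ∈ G.isoPos.sym)
    (hθ' : θ' ∈ G.isoPos.sym) (h1 : (σ.mapRel φ).cod = θ.dom) (h1' : (σ.mapRel φ').cod = θ'.dom)
    (h : (σ.mapRel φ).comp θ = (σ.mapRel φ').comp θ') : φ.cod = φ'.cod ∧ θ = θ' := by
  have hmd : (σ.mapRel φ).dom = (σ.mapRel φ').dom := by rw [σ.mapRel_dom, σ.mapRel_dom, hd]
  have hm : σ.mapRel (φ.inv.comp φ') = (σ.mapRel φ).inv.comp (σ.mapRel φ') := by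
    rw [σ.mapRel_comp (σ.iso.inv_mem _ hφ) hd, σ.mapRel_inv]
  have he : θ = ((σ.mapRel φ).inv.comp (σ.mapRel φ')).comp θ' := by
    rw [SetRel.comp_assoc, ← h, IsoFamily.inv_comp_cancel (σ.map_iso _ hφ) h1.symm.subset]
  have hc : θ.cod = θ'.cod := by rw [← comp_cod h1, h, comp_cod h1']
  -- Comparing the factorizations, `φ⁻¹` followed by `φ'` displays as `θ` followed by `θ'⁻¹`, which
  -- is positive; `eq_idRel_of_pos` then applies.
  have hpos : σ.mapRel (φ.inv.comp φ') ∈ G.isoPos.sym := by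
    have : θ.comp θ'.inv = σ.mapRel (φ.inv.comp φ') := by
      rw [he, hm, IsoFamily.cancel_comp_inv hθ']
      rw [← h1', comp_cod (θ := (σ.mapRel φ).inv) hmd]
    rw [← this]
    exact G.isoPos.comp_mem _ hθ _ (G.isoPos.inv_mem _ hθ') hc
  have hid := σ.eq_idRel_of_pos (σ.iso.comp_mem _ (σ.iso.inv_mem _ hφ) _ hφ' hd) hpos
  have hdom : (φ.inv.comp φ').dom = φ.cod := comp_dom hd
  have hcod : φ.cod = φ'.cod := by
    rw [← hdom, ← idRel_cod (φ.inv.comp φ').dom, ← hid]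
    exact comp_cod hd
  refine ⟨hcod, ?_⟩
  rw [he, ← hm, hid, σ.mapRel_idRel, idRel_comp]
  rw [← h1', σ.mapRel_cod, hdom, hcod]

/-- Symmetries preserve `+`-coverage. -/
theorem plusCovered_iso {x y : Set σ.S.Ev} {θ : SetRel σ.S.Ev σ.S.Ev} (hθ : σ.iso.Iso θ x y)
    (hx : σ.S.PlusCovered x) : σ.S.PlusCovered y := by
  obtain ⟨hθ, rfl, rfl⟩ := hθ
  rintro t ⟨⟨s, hs⟩, ht⟩
  rw [← σ.pol_iso hθ hs]
  refine hx s ⟨⟨t, hs⟩, ?_⟩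
  rintro s' ⟨t', hs'⟩ hle
  rcases hle.eq_or_lt with rfl | hlt
  · exact le_rfl
  · have := IsoFamily.lt_of_lt hθ hs hs' hlt
    exact absurd (ht ⟨s', hs'⟩ this.le) this.not_ge

end Strategy

/-! ## Strategies on parallel compositions of games -/

theorem Pol.op_eq_pos {p : Pol} : p.op = Pol.pos ↔ p = Pol.neg := by cases p <;> simp [Pol.op]

theorem insert_inl_eq_parRel {α : Type u} {β : Type v} {a : α} {g : α ⊕ β} {θ θ' : SetRel α α}
    {φ φ' : SetRel β β} (h : insert (Sum.inl a, g) (parRel θ φ) = parRel θ' φ') :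
    ∃ a', g = Sum.inl a' ∧ insert (a, a') θ = θ' ∧ φ = φ' := by
  rcases g with a' | b
  · rw [insert_inl_parRel] at h
    exact ⟨a', rfl, parRel_inj h⟩
  · exact absurd (h ▸ Set.mem_insert _ _) (inl_inr_mem_parRel θ' φ')

theorem insert_inr_eq_parRel {α : Type u} {β : Type v} {b : β} {g : α ⊕ β} {θ θ' : SetRel α α}
    {φ φ' : SetRel β β} (h : insert (Sum.inr b, g) (parRel θ φ) = parRel θ' φ') :
    ∃ b', g = Sum.inr b' ∧ θ = θ' ∧ insert (b, b') φ = φ' := by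
  rcases g with a' | b'
  · exact absurd (h ▸ Set.mem_insert _ _) (inr_inl_mem_parRel θ' φ')
  · rw [insert_inr_parRel] at h
    exact ⟨b', rfl, parRel_inj h⟩

namespace Strategy

variable {P : TCG.{u}} {Q : TCG.{v}} (σ : Strategy.{w} (P.par Q)) {θ : SetRel σ.S.Ev σ.S.Ev}
  {α : SetRel P.Ev P.Ev} {β : SetRel Q.Ev Q.Ev} {s : σ.S.Ev}

theorem mem_iso_of_mapRel_eq (hθ : θ ∈ σ.iso.sym) (hm : σ.mapRel θ = parRel α β) :
    α ∈ P.iso.sym ∧ β ∈ Q.iso.sym := by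
  obtain ⟨α', hα', β', hβ', h⟩ := σ.map_iso _ hθ
  rw [hm] at h
  obtain ⟨rfl, rfl⟩ := parRel_inj h
  exact ⟨hα', hβ'⟩

theorem exists_mapRel_eq (hθ : θ ∈ σ.iso.sym) :
    ∃ α ∈ P.iso.sym, ∃ β ∈ Q.iso.sym, σ.mapRel θ = parRel α β := σ.map_iso _ hθ

/-- The case `K = P.isoPos ∥ Q.iso` of `extend_within`, which constrains the left component only.
With `P = A.dual`, positivity here is negativity in `A`. -/
theorem extend_inl (hθ : θ ∈ σ.iso.sym) (hm : σ.mapRel θ = parRel α β)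
    (hα : α ∈ P.isoPos.sym) (hs : s ∉ θ.dom) (h : σ.S.IsConf (insert s θ.dom)) {a : P.Ev}
    (ha : σ.map.toFun s = Sum.inl a) :
    ∃ s' a', insert (s, s') θ ∈ σ.iso.sym ∧
      σ.mapRel (insert (s, s') θ) = parRel (insert (a, a') α) β ∧
      insert (a, a') α ∈ P.isoPos.sym := by
  have hβ := (σ.mem_iso_of_mapRel_eq hθ hm).2
  obtain ⟨s', hs', α', hα', β', hβ', hK⟩ := σ.extend_within (K := P.isoPos.par Q.iso)
    (by rintro _ ⟨θ, hθ, φ, hφ, rfl⟩; exact ⟨_, P.pos_le hθ, _, hφ, rfl⟩) hθ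
    ⟨_, hα, _, hβ, hm⟩ hs h (by
      rintro g hp ⟨α', hα', β', hβ', h⟩
      rw [h]
      rw [hm, ha] at h
      obtain ⟨a', rfl, rfl, rfl⟩ := insert_inl_eq_parRel h
      refine ⟨_, P.pos_ext _ hα _ hα' ⟨Set.subset_insert _ _, ?_⟩, _, hβ, rfl⟩
      have hpa : P.pol a = Pol.pos := by
        rw [← hp, ← σ.map_pol, ha]; rfl
      rintro p (rfl | h) h'
      · exact ⟨hpa, (P.pol_iso _ hα' _ (Or.inl rfl)).symm.trans hpa⟩
      · exact absurd h h')
  have hK' := hK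
  rw [σ.mapRel_insert, hm, ha] at hK'
  obtain ⟨a', h1, rfl, rfl⟩ := insert_inl_eq_parRel hK'
  exact ⟨s', a', hs', hK, hα'⟩

theorem extend_inr (hθ : θ ∈ σ.iso.sym) (hm : σ.mapRel θ = parRel α β)
    (hβ : β ∈ Q.isoPos.sym) (hs : s ∉ θ.dom) (h : σ.S.IsConf (insert s θ.dom)) {b : Q.Ev}
    (hb : σ.map.toFun s = Sum.inr b) :
    ∃ s' b', insert (s, s') θ ∈ σ.iso.sym ∧
      σ.mapRel (insert (s, s') θ) = parRel α (insert (b, b') β) ∧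
      insert (b, b') β ∈ Q.isoPos.sym := by
  have hα := (σ.mem_iso_of_mapRel_eq hθ hm).1
  obtain ⟨s', hs', α', hα', β', hβ', hK⟩ := σ.extend_within (K := P.iso.par Q.isoPos)
    (by rintro _ ⟨θ, hθ, φ, hφ, rfl⟩; exact ⟨_, hθ, _, Q.pos_le hφ, rfl⟩) hθ
    ⟨_, hα, _, hβ, hm⟩ hs h (by
      rintro g hp ⟨α', hα', β', hβ', h⟩
      rw [h]
      rw [hm, hb] at h
      obtain ⟨b', rfl, rfl, rfl⟩ := insert_inr_eq_parRel h
      refine ⟨_, hα, _, Q.pos_ext _ hβ _ hβ' ⟨Set.subset_insert _ _, ?_⟩, rfl⟩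
      have hpb : Q.pol b = Pol.pos := by
        rw [← hp, ← σ.map_pol, hb]; rfl
      rintro p (rfl | h) h'
      · exact ⟨hpb, (Q.pol_iso _ hβ' _ (Or.inl rfl)).symm.trans hpb⟩
      · exact absurd h h')
  have hK' := hK
  rw [σ.mapRel_insert, hm, hb] at hK'
  obtain ⟨b', h1, rfl, rfl⟩ := insert_inr_eq_parRel hK'
  exact ⟨s', b', hs', hK, hβ'⟩

theorem extend_inl_iso (hθ : θ ∈ σ.iso.sym) (hm : σ.mapRel θ = parRel α β)
    (h : σ.S.IsConf (insert s θ.dom)) {a : P.Ev} (ha : σ.map.toFun s = Sum.inl a) :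
    ∃ s' a', insert (s, s') θ ∈ σ.iso.sym ∧
      σ.mapRel (insert (s, s') θ) = parRel (insert (a, a') α) β := by
  obtain ⟨s', hs'⟩ := IsoFamily.extend_one hθ h
  obtain ⟨α', -, β', -, hK⟩ := σ.exists_mapRel_eq hs'
  have hK' := hK
  rw [σ.mapRel_insert, hm, ha] at hK'
  obtain ⟨a', h1, rfl, rfl⟩ := insert_inl_eq_parRel hK'
  exact ⟨s', a', hs', hK⟩

theorem extend_inr_iso (hθ : θ ∈ σ.iso.sym) (hm : σ.mapRel θ = parRel α β)
    (h : σ.S.IsConf (insert s θ.dom)) {b : Q.Ev} (hb : σ.map.toFun s = Sum.inr b) :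
    ∃ s' b', insert (s, s') θ ∈ σ.iso.sym ∧
      σ.mapRel (insert (s, s') θ) = parRel α (insert (b, b') β) := by
  obtain ⟨s', hs'⟩ := IsoFamily.extend_one hθ h
  obtain ⟨α', -, β', -, hK⟩ := σ.exists_mapRel_eq hs'
  have hK' := hK
  rw [σ.mapRel_insert, hm, hb] at hK'
  obtain ⟨b', h1, rfl, rfl⟩ := insert_inr_eq_parRel hK'
  exact ⟨s', b', hs', hK⟩

/-- Here the image `a'` is imposed in advance, as `∼`-receptivity allows for negative events: this
is how one strategy follows a choice made by the other. -/
theorem extend_inl_neg (hθ : θ ∈ σ.iso.sym) (hm : σ.mapRel θ = parRel α β) (hs : s ∉ θ.dom)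
    (h : σ.S.IsConf (insert s θ.dom)) {a a' : P.Ev} (ha : σ.map.toFun s = Sum.inl a)
    (hn : σ.S.pol s = Pol.neg) (hα : insert (a, a') α ∈ P.iso.sym) :
    ∃ s', insert (s, s') θ ∈ σ.iso.sym ∧
      σ.mapRel (insert (s, s') θ) = parRel (insert (a, a') α) β := by
  have hβ := (σ.mem_iso_of_mapRel_eq hθ hm).2
  obtain ⟨s', h1, h2⟩ := σ.lift_neg hθ hs h hn (g := Sum.inl a')
    ⟨_, hα, _, hβ, by rw [ha, hm, insert_inl_parRel]⟩
  exact ⟨s', h2, by rw [σ.mapRel_insert, h1, ha, hm, insert_inl_parRel]⟩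

theorem extend_inr_neg (hθ : θ ∈ σ.iso.sym) (hm : σ.mapRel θ = parRel α β) (hs : s ∉ θ.dom)
    (h : σ.S.IsConf (insert s θ.dom)) {b b' : Q.Ev} (hb : σ.map.toFun s = Sum.inr b)
    (hn : σ.S.pol s = Pol.neg) (hβ : insert (b, b') β ∈ Q.iso.sym) :
    ∃ s', insert (s, s') θ ∈ σ.iso.sym ∧
      σ.mapRel (insert (s, s') θ) = parRel α (insert (b, b') β) := by
  have hα := (σ.mem_iso_of_mapRel_eq hθ hm).1
  obtain ⟨s', h1, h2⟩ := σ.lift_neg hθ hs h hn (g := Sum.inr b')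
    ⟨_, hα, _, hβ, by rw [hb, hm, insert_inr_parRel]⟩
  exact ⟨s', h2, by rw [σ.mapRel_insert, h1, hb, hm, insert_inr_parRel]⟩

end Strategy

/-! ## Displays -/

namespace PreStrategy

variable {A : TCG.{u}} {B : TCG.{v}} (σ : PreStrat.{u, v, w} A B)

theorem left_eq (x : Set σ.S.Ev) : σ.left x = Sum.inl ⁻¹' (σ.map.toFun '' x) := rfl

theorem right_eq (x : Set σ.S.Ev) : σ.right x = Sum.inr ⁻¹' (σ.map.toFun '' x) := rfl

variable {σ}

theorem isConf_left {x : Set σ.S.Ev} (hx : σ.S.IsConf x) : A.IsConf (σ.left x) :=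
  (EvStr.isConf_par.1 (σ.map.map_conf _ hx)).1

theorem isConf_right {x : Set σ.S.Ev} (hx : σ.S.IsConf x) : B.IsConf (σ.right x) :=
  (EvStr.isConf_par.1 (σ.map.map_conf _ hx)).2

theorem left_insert_inl {x : Set σ.S.Ev} {s : σ.S.Ev} {a : A.Ev} (h : σ.lbl s = Sum.inl a) :
    σ.left (insert s x) = insert a (σ.left x) := by
  ext c; simp [left, h, eq_comm]

theorem left_insert_inr {x : Set σ.S.Ev} {s : σ.S.Ev} {b : B.Ev} (h : σ.lbl s = Sum.inr b) :
    σ.left (insert s x) = σ.left x := by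
  ext c; simp [left, h]

theorem right_insert_inl {x : Set σ.S.Ev} {s : σ.S.Ev} {a : A.Ev} (h : σ.lbl s = Sum.inl a) :
    σ.right (insert s x) = σ.right x := by
  ext c; simp [right, h]

theorem right_insert_inr {x : Set σ.S.Ev} {s : σ.S.Ev} {b : B.Ev} (h : σ.lbl s = Sum.inr b) :
    σ.right (insert s x) = insert b (σ.right x) := by
  ext c; simp [right, h, eq_comm]

theorem notMem_left {x : Set σ.S.Ev} {s : σ.S.Ev} {a : A.Ev} (h : σ.lbl s = Sum.inl a)
    (hs : s ∉ x) (hx : σ.S.IsConf (insert s x)) : a ∉ σ.left x := fun hm =>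
  σ.map_notMem hs hx (by rw [left_eq] at hm; change σ.lbl s ∈ _; rw [h]; exact hm)

theorem notMem_right {x : Set σ.S.Ev} {s : σ.S.Ev} {b : B.Ev} (h : σ.lbl s = Sum.inr b)
    (hs : s ∉ x) (hx : σ.S.IsConf (insert s x)) : b ∉ σ.right x := fun hm =>
  σ.map_notMem hs hx (by rw [right_eq] at hm; change σ.lbl s ∈ _; rw [h]; exact hm)

variable {θ : SetRel σ.S.Ev σ.S.Ev} {α : SetRel A.Ev A.Ev} {β : SetRel B.Ev B.Ev}

theorem left_dom (hm : σ.mapRel θ = parRel α β) : σ.left θ.dom = α.dom := by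
  rw [left_eq, ← mapRel_dom, hm, inl_dom_parRel]

theorem left_cod (hm : σ.mapRel θ = parRel α β) : σ.left θ.cod = α.cod := by
  rw [left_eq, ← mapRel_cod, hm, inl_cod_parRel]

theorem right_dom (hm : σ.mapRel θ = parRel α β) : σ.right θ.dom = β.dom := by
  rw [right_eq, ← mapRel_dom, hm, inr_dom_parRel]

theorem right_cod (hm : σ.mapRel θ = parRel α β) : σ.right θ.cod = β.cod := by
  rw [right_eq, ← mapRel_cod, hm, inr_cod_parRel]

end PreStrategy

/-! ## Synchronization of strategies which do not deadlock -/

/-- On a finite set, the reverse of an acyclic causality generates a well-founded relation. -/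
theorem Secured.exists_maximal {P : Type u} {Q : Type v} [PartialOrder P] [PartialOrder Q]
    {φ : Set (P × Q)} (h : Secured φ) (hf : φ.Finite) (hn : φ.Nonempty) :
    ∃ p ∈ φ, ∀ q ∈ φ, ¬ (p.1 < q.1 ∨ p.2 < q.2) := by
  have : Finite φ := hf
  let r : φ → φ → Prop := fun p q => Relation.TransGen (causes φ) q.1 p.1
  have : Std.Irrefl r := ⟨fun p => h p.1 p.2⟩
  have : IsTrans φ r := ⟨fun _ _ _ h h' => h'.trans h⟩
  obtain ⟨p, -, hp⟩ := (Finite.wellFounded_of_trans_of_irrefl r).has_min Set.univ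
    ⟨⟨hn.some, hn.some_mem⟩, trivial⟩
  exact ⟨p.1, p.2, fun q hq hc => hp ⟨q, hq⟩ trivial (.single ⟨p.2, hq, hc⟩)⟩

theorem IsoFamily.Iso.exists_insert {E : EvStr.{u}} {F : IsoFamily E} {θ : SetRel E.Ev E.Ev}
    {x y : Set E.Ev} {e e' : E.Ev} (hθ : F.Iso θ (insert e x) (insert e' y)) (hx : E.IsConf x)
    (he : e ∉ x) (he' : e' ∉ y) (h : (e, e') ∈ θ) :
    ∃ θ', F.Iso θ' x y ∧ θ = insert (e, e') θ' := by
  obtain ⟨hθ, hd, hc⟩ := hθ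
  obtain ⟨e'', θ', hθ', rfl, rfl⟩ := exists_insert_of_dom hθ hx he hd
  obtain rfl : e' = e'' := eq_snd hθ h (Or.inl rfl)
  refine ⟨θ', ⟨hθ', rfl, ?_⟩, rfl⟩
  have h1 := notMem_cod_of_insert hθ he
  rw [insert_cod] at hc
  rw [← Set.insert_sdiff_self_of_notMem h1, hc, Set.insert_sdiff_self_of_notMem he']

section Sync

variable {A : TCG.{u₁}} {B : TCG.{u₂}} {C : TCG.{u₃}}

theorem syncBij_finite {σ : PreStrat.{u₁, u₂, u} A B} {τ : PreStrat.{u₂, u₃, v} B C}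
    {x : Set σ.S.Ev} {y : Set τ.S.Ev} (hx : σ.S.IsConf x) (hy : τ.S.IsConf y)
    (θ : SetRel B.Ev B.Ev) : (syncBij σ τ x y θ).Finite := by
  refine (((hx.finite.image Sum.inl).union
    ((PreStrategy.isConf_right hy).finite.image Sum.inr)).prod
    (((PreStrategy.isConf_left hx).finite.image Sum.inl).union
      (hy.finite.image Sum.inr))).subset ?_
  rintro _ (⟨s, hs, a, ha, rfl⟩ | ⟨s, hs, t, ht, b, b', -, -, -, rfl⟩ | ⟨t, ht, c, hc, rfl⟩)
  · exact ⟨Or.inl ⟨s, hs, rfl⟩, Or.inl ⟨a, ⟨s, hs, ha⟩, rfl⟩⟩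
  · exact ⟨Or.inl ⟨s, hs, rfl⟩, Or.inr ⟨t, ht, rfl⟩⟩
  · exact ⟨Or.inr ⟨c, ⟨t, ht, hc⟩, rfl⟩, Or.inr ⟨t, ht, rfl⟩⟩

theorem syncBij_exists_left {σ : PreStrat.{u₁, u₂, u} A B} {τ : PreStrat.{u₂, u₃, v} B C}
    {x : Set σ.S.Ev} {y : Set τ.S.Ev} {θ : SetRel B.Ev B.Ev}
    (hθ : B.iso.Iso θ (σ.right x) (τ.left y)) {s : σ.S.Ev} (hs : s ∈ x) :
    ∃ q, (Sum.inl s, q) ∈ syncBij σ τ x y θ := by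
  rcases h : σ.lbl s with a | b
  · exact ⟨_, Or.inl ⟨s, hs, a, h, rfl⟩⟩
  · obtain ⟨b', hb'⟩ : b ∈ θ.dom := hθ.2.1 ▸ ⟨s, hs, h⟩
    obtain ⟨t, ht, htb⟩ : b' ∈ τ.left y := hθ.2.2 ▸ ⟨b, hb'⟩
    exact ⟨_, Or.inr (Or.inl ⟨s, hs, t, ht, b, b', h, htb, hb', rfl⟩)⟩

theorem syncBij_exists_right {σ : PreStrat.{u₁, u₂, u} A B} {τ : PreStrat.{u₂, u₃, v} B C}
    {x : Set σ.S.Ev} {y : Set τ.S.Ev} {θ : SetRel B.Ev B.Ev}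
    (hθ : B.iso.Iso θ (σ.right x) (τ.left y)) {t : τ.S.Ev} (ht : t ∈ y) :
    ∃ q, (q, Sum.inr t) ∈ syncBij σ τ x y θ := by
  rcases h : τ.lbl t with b' | c
  · obtain ⟨b, hb'⟩ : b' ∈ θ.cod := hθ.2.2 ▸ ⟨t, ht, h⟩
    obtain ⟨s, hs, hsb⟩ : b ∈ σ.right x := hθ.2.1 ▸ ⟨b', hb'⟩
    exact ⟨_, Or.inr (Or.inl ⟨s, hs, t, ht, b, b', hsb, h, hb', rfl⟩)⟩
  · exact ⟨_, Or.inr (Or.inr ⟨t, ht, c, h, rfl⟩)⟩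

/-- Induction on matching pairs of configurations along a common causal order. -/
theorem DoNotDeadlock.induction {σ : PreStrat.{u₁, u₂, u} A B} {τ : PreStrat.{u₂, u₃, v} B C}
    (hdl : DoNotDeadlock σ τ) {p : Set σ.S.Ev → Set τ.S.Ev → SetRel B.Ev B.Ev → Prop}
    (empty : p ∅ ∅ ∅)
    (left : ∀ s x y θ a, σ.S.IsConf x → τ.S.IsConf y → s ∉ x → σ.S.IsConf (insert s x) →
      B.iso.Iso θ (σ.right x) (τ.left y) → σ.lbl s = Sum.inl a → p x y θ → p (insert s x) y θ)
    (right : ∀ t x y θ c, σ.S.IsConf x → τ.S.IsConf y → t ∉ y → τ.S.IsConf (insert t y) →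
      B.iso.Iso θ (σ.right x) (τ.left y) → τ.lbl t = Sum.inr c → p x y θ → p x (insert t y) θ)
    (mid : ∀ s t x y θ b b', σ.S.IsConf x → τ.S.IsConf y → s ∉ x → σ.S.IsConf (insert s x) →
      t ∉ y → τ.S.IsConf (insert t y) → B.iso.Iso θ (σ.right x) (τ.left y) →
      insert (b, b') θ ∈ B.iso.sym → σ.lbl s = Sum.inr b → τ.lbl t = Sum.inl b' →
      p x y θ → p (insert s x) (insert t y) (insert (b, b') θ))
    {x : Set σ.S.Ev} {y : Set τ.S.Ev} {θ : SetRel B.Ev B.Ev} (hx : σ.S.IsConf x)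
    (hy : τ.S.IsConf y) (hθ : B.iso.Iso θ (σ.right x) (τ.left y)) : p x y θ := by
  induction hn : x.ncard + y.ncard using Nat.strong_induction_on generalizing x y θ with
  | _ n ih =>
  subst hn
  by_cases hne : (syncBij σ τ x y θ).Nonempty
  · have hdx : ∀ {s}, s ∈ x → (x \ {s}).ncard < x.ncard := fun hs => by
      rw [← Set.ncard_sdiff_singleton_add_one hs hx.finite]; exact Nat.lt_succ_self _
    have hdy : ∀ {t}, t ∈ y → (y \ {t}).ncard < y.ncard := fun ht => by
      rw [← Set.ncard_sdiff_singleton_add_one ht hy.finite]; exact Nat.lt_succ_self _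
    have hix : ∀ {s}, s ∈ x → insert s (x \ {s}) = x := fun hs => by
      simp [Set.insert_eq_of_mem hs]
    have hiy : ∀ {t}, t ∈ y → insert t (y \ {t}) = y := fun ht => by
      simp [Set.insert_eq_of_mem ht]
    -- Absence of deadlock yields a pair that is maximal for both causal orders at once, so its
    -- components can be removed together, leaving a smaller matching pair.
    obtain ⟨q, hq, hmax⟩ := (hdl x y θ hx hy hθ).exists_maximal (syncBij_finite hx hy θ) hne
    have hcx : ∀ {s r}, q = (Sum.inl s, r) → σ.S.IsConf (x \ {s}) := by
      rintro s r rfl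
      refine hx.sdiff_maximal fun s' hs' hlt => ?_
      obtain ⟨r', hr'⟩ := syncBij_exists_left hθ hs'
      exact hmax _ hr' (Or.inl (Sum.inl_lt_inl_iff.2 hlt))
    have hcy : ∀ {t r}, q = (r, Sum.inr t) → τ.S.IsConf (y \ {t}) := by
      rintro t r rfl
      refine hy.sdiff_maximal fun t' ht' hlt => ?_
      obtain ⟨r', hr'⟩ := syncBij_exists_right hθ ht'
      exact hmax _ hr' (Or.inr (Sum.inr_lt_inr_iff.2 hlt))
    rcases hq with ⟨s, hs, a, ha, rfl⟩ | ⟨s, hs, t, ht, b, b', hb, hb', hbb, rfl⟩ |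
      ⟨t, ht, c, hc, rfl⟩
    · have hc := hcx rfl
      rw [← hix hs, PreStrategy.right_insert_inl ha] at hθ
      have := left s _ y θ a hc hy (by simp) (by rwa [hix hs]) hθ ha
        (ih _ (Nat.add_lt_add_right (hdx hs) _) hc hy hθ rfl)
      rwa [hix hs] at this
    · have hc := hcx rfl
      have hc' := hcy rfl
      have hx' : σ.S.IsConf (insert s (x \ {s})) := by rwa [hix hs]
      have hy' : τ.S.IsConf (insert t (y \ {t})) := by rwa [hiy ht]
      rw [← hix hs, ← hiy ht, PreStrategy.right_insert_inr hb,
        PreStrategy.left_insert_inl hb'] at hθ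
      obtain ⟨θ', hθ', rfl⟩ := hθ.exists_insert (PreStrategy.isConf_right hc)
        (PreStrategy.notMem_right hb (by simp) hx') (PreStrategy.notMem_left hb' (by simp) hy') hbb
      have := mid s t _ _ θ' b b' hc hc' (by simp) hx' (by simp) hy' hθ' hθ.1 hb hb'
        (ih _ (Nat.add_lt_add (hdx hs) (hdy ht)) hc hc' hθ' rfl)
      rwa [hix hs, hiy ht] at this
    · have hc' := hcy rfl
      rw [← hiy ht, PreStrategy.left_insert_inr hc] at hθ
      have := right t x _ θ c hx hc' (by simp) (by rwa [hiy ht]) hθ hc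
        (ih _ (Nat.add_lt_add_left (hdy ht) _) hx hc' hθ rfl)
      rwa [hiy ht] at this
  · obtain rfl : x = ∅ := by
      by_contra h
      obtain ⟨s, hs⟩ := Set.nonempty_iff_ne_empty.2 h
      exact hne ⟨_, (syncBij_exists_left hθ hs).choose_spec⟩
    obtain rfl : y = ∅ := by
      by_contra h
      obtain ⟨s, hs⟩ := Set.nonempty_iff_ne_empty.2 h
      exact hne ⟨_, (syncBij_exists_right hθ hs).choose_spec⟩
    obtain rfl : θ = ∅ := by
      rw [← SetRel.dom_eq_empty_iff, hθ.2.1]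
      simp [PreStrategy.right]
    exact empty

variable (σ : Strat.{u₁, u₂, u} A B) (τ : Strat.{u₂, u₃, v} B C)

/-- Synchronization up to symmetry. -/
theorem exists_sync (hdl : DoNotDeadlock σ.toPreStrategy τ.toPreStrategy)
    {x : Set σ.S.Ev} {y : Set τ.S.Ev} {θ : SetRel B.Ev B.Ev} (hx : σ.S.IsConf x)
    (hy : τ.S.IsConf y) (hθ : B.iso.Iso θ (σ.right x) (τ.left y)) :
    ∃ φ ∈ σ.iso.sym, ∃ ψ ∈ τ.iso.sym, φ.dom = x ∧ ψ.dom = y ∧ ∃ α ∈ A.isoNeg.sym,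
      ∃ γ ∈ C.isoPos.sym, ∃ β, σ.mapRel φ = parRel α (θ.comp β) ∧ τ.mapRel ψ = parRel β γ := by
  -- The display on `B` is `θ` followed by `β` for `σ`, and `β` for `τ`: the codomains of `φ` and
  -- `ψ` then agree on `B`.
  refine hdl.induction (p := fun x y θ =>
    ∃ φ ∈ σ.iso.sym, ∃ ψ ∈ τ.iso.sym, φ.dom = x ∧ ψ.dom = y ∧ ∃ α ∈ A.isoNeg.sym,
      ∃ γ ∈ C.isoPos.sym, ∃ β, σ.mapRel φ = parRel α (θ.comp β) ∧ τ.mapRel ψ = parRel β γ)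
    ?_ ?_ ?_ ?_ hx hy hθ
  · have h1 := σ.iso.id_mem _ (EvStr.isConf_empty _)
    have h2 := τ.iso.id_mem _ (EvStr.isConf_empty _)
    have h3 := A.isoNeg.id_mem _ (EvStr.isConf_empty _)
    have h4 := C.isoPos.id_mem _ (EvStr.isConf_empty _)
    rw [idRel_empty] at h1 h2 h3 h4
    refine ⟨∅, h1, ∅, h2, by simp, by simp, ∅, h3, ∅, h4, ∅, ?_, ?_⟩ <;>
      simp [PreStrategy.mapRel, parRel] <;> ext ⟨a | a, b | b⟩ <;> simp
  -- An event of `A` or of `C` concerns one strategy only, and its image can be chosen within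
  -- `A.isoNeg`, respectively `C.isoPos`.
  · rintro s _ _ θ a hx hy hs hsx hθ ha ⟨φ, hφ, ψ, hψ, rfl, rfl, α, hα, γ, hγ, β, h1, h2⟩
    obtain ⟨s', a', h3, h4, h5⟩ := σ.extend_inl (P := A.dual) hφ h1 hα hs hsx ha
    exact ⟨_, h3, ψ, hψ, insert_dom _ _ _, rfl, _, h5, γ, hγ, β, h4, h2⟩
  · rintro t _ _ θ c hx hy ht hty hθ hc ⟨φ, hφ, ψ, hψ, rfl, rfl, α, hα, γ, hγ, β, h1, h2⟩
    obtain ⟨t', c', h3, h4, h5⟩ := τ.extend_inr (P := B.dual) hψ h2 hγ ht hty hc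
    exact ⟨φ, hφ, _, h3, rfl, insert_dom _ _ _, α, hα, _, h5, β, h1, h4⟩
  · rintro s t _ _ θ b b' hx hy hs hsx ht hty hθ hθ' hb hb'
      ⟨φ, hφ, ψ, hψ, rfl, rfl, α, hα, γ, hγ, β, h1, h2⟩
    have hβd : β.dom = θ.cod := by rw [hθ.2.2, PreStrategy.left_dom h2]
    have hbd : b ∉ θ.dom := hθ.2.1 ▸ PreStrategy.notMem_right hb hs hsx
    have hbc : b' ∉ θ.cod := hθ.2.2 ▸ PreStrategy.notMem_left hb' ht hty
    have hcomp : ∀ d, (insert (b, b') θ).comp (insert (b', d) β) = insert (b, d) (θ.comp β) :=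
      fun d => insert_comp_insert hbc (hβd ▸ hbc)
    have hpol : B.pol b = B.pol b' := B.pol_iso _ hθ' _ (Or.inl rfl)
    have hps : B.pol b = σ.S.pol s := by
      have := σ.map_pol s
      rw [show σ.map.toFun s = _ from hb] at this
      exact this
    have hpt : (B.pol b').op = τ.S.pol t := by
      have := τ.map_pol t
      rw [show τ.map.toFun t = _ from hb'] at this
      exact this
    suffices H : ∃ s' t' d, insert (s, s') φ ∈ σ.iso.sym ∧ insert (t, t') ψ ∈ τ.iso.sym ∧
        σ.mapRel (insert (s, s') φ) = parRel α (insert (b, d) (θ.comp β)) ∧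
        τ.mapRel (insert (t, t') ψ) = parRel (insert (b', d) β) γ by
      obtain ⟨s', t', d, h3, h4, h5, h6⟩ := H
      exact ⟨_, h3, _, h4, insert_dom _ _ _, insert_dom _ _ _, α, hα, γ, hγ, _,
        by rw [hcomp]; exact h5, h6⟩
    -- The strategy for which the event is positive is extended freely, which determines `d`; the
    -- other sees a negative event and follows by `∼`-receptivity.
    cases hp : σ.S.pol s with
    | pos =>
      obtain ⟨s', d, h3, h4⟩ := σ.extend_inr_iso (P := A.dual) hφ h1 hsx hb
      have h5 := (σ.mem_iso_of_mapRel_eq (P := A.dual) h3 h4).2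
      have h6 : insert (b', d) β ∈ B.iso.sym := by
        have : insert (b', d) β = (insert (b, b') θ).inv.comp (insert (b, d) (θ.comp β)) := by
          rw [← hcomp, IsoFamily.inv_comp_cancel hθ']
          rw [insert_dom, insert_cod, hβd]
        rw [this]
        refine B.iso.comp_mem _ (B.iso.inv_mem _ hθ') _ h5 ?_
        rw [SetRel.cod_inv, insert_dom, insert_dom, hθ.2.1, PreStrategy.right_dom h1]
      obtain ⟨t', h7, h8⟩ := τ.extend_inl_neg (P := B.dual) hψ h2 ht hty hb'
        (by rw [← hpt, ← hpol, hps, hp]; rfl) h6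
      exact ⟨s', t', d, h3, h7, h4, h8⟩
    | neg =>
      obtain ⟨t', d, h3, h4⟩ := τ.extend_inl_iso (P := B.dual) hψ h2 hty hb'
      have h5 : insert (b', d) β ∈ B.iso.sym := (τ.mem_iso_of_mapRel_eq (P := B.dual) h3 h4).1
      have h6 : insert (b, d) (θ.comp β) ∈ B.iso.sym := by
        rw [← hcomp]
        refine B.iso.comp_mem _ hθ' _ h5 ?_
        rw [insert_dom, insert_cod, hβd]
      obtain ⟨s', h7, h8⟩ := σ.extend_inr_neg (P := A.dual) hφ h1 hs hsx hb hp h6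
      exact ⟨s', t', d, h7, h3, h8, h4⟩

end Sync

/-! ## Uniqueness of synchronization -/

section Sync

variable {A : TCG.{u₁}} {B : TCG.{u₂}} {C : TCG.{u₃}}
  (σ : Strat.{u₁, u₂, u} A B) (τ : Strat.{u₂, u₃, v} B C)

/-- Synchronized symmetries which are negative on `A` and positive on `C` are identities. -/
theorem sync_unique (hdl : DoNotDeadlock σ.toPreStrategy τ.toPreStrategy)
    {φ : SetRel σ.S.Ev σ.S.Ev} {ψ : SetRel τ.S.Ev τ.S.Ev} (hφ : φ ∈ σ.iso.sym)
    (hψ : ψ ∈ τ.iso.sym) (hm : σ.right φ.dom = τ.left ψ.dom) {α β γ} (hα : α ∈ A.isoNeg.sym)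
    (hγ : γ ∈ C.isoPos.sym) (h1 : σ.mapRel φ = parRel α β) (h2 : τ.mapRel ψ = parRel β γ) :
    φ = idRel φ.dom ∧ ψ = idRel ψ.dom := by
  have hx := σ.iso.dom_conf _ hφ
  have hy := τ.iso.dom_conf _ hψ
  have hθ : B.iso.Iso (idRel (σ.right φ.dom)) (σ.right φ.dom) (τ.left ψ.dom) := by
    rw [← hm]
    exact IsoFamily.iso_refl _ (PreStrategy.isConf_right hx)
  -- The induction ranges over arbitrary matchings, so the motive carries the fact that `θ` is an
  -- identity.
  refine hdl.induction (p := fun x y θ => (∀ q ∈ θ, q.1 = q.2) → ∀ φ ∈ σ.iso.sym,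
    ∀ ψ ∈ τ.iso.sym, φ.dom = x → ψ.dom = y → ∀ α ∈ A.isoNeg.sym, ∀ β, ∀ γ ∈ C.isoPos.sym,
    σ.mapRel φ = parRel α β → τ.mapRel ψ = parRel β γ → φ = idRel x ∧ ψ = idRel y)
    ?_ ?_ ?_ ?_ hx hy hθ (fun q hq => hq.2) φ hφ ψ hψ rfl rfl α hα β γ hγ h1 h2
  · intro _ φ _ ψ _ h1 h2 _ _ _ _ _ _ _
    rw [SetRel.dom_eq_empty_iff] at h1 h2
    rw [h1, h2, idRel_empty, idRel_empty]
    exact ⟨rfl, rfl⟩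
  · rintro s x y θ a hx hy hs hsx hθ ha ih hid φ hφ ψ hψ hd hd' α hα β γ hγ h1 h2
    obtain ⟨s', φ, hφ', rfl, rfl⟩ := IsoFamily.exists_insert_of_dom hφ hx hs hd
    obtain ⟨α', hα', β', -, h3⟩ := σ.exists_mapRel_eq (P := A.dual) hφ'
    have h4 := h1
    rw [σ.mapRel_insert, h3, show σ.map.toFun s = _ from ha] at h4
    obtain ⟨a', ha', rfl, rfl⟩ := insert_inl_eq_parRel h4
    have had : a ∉ α'.dom := PreStrategy.left_dom h3 ▸ PreStrategy.notMem_left ha hs hsx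
    have hα'' := IsoFamily.mem_of_insert hα had (A.iso.dom_conf _ hα')
    obtain ⟨h5, rfl⟩ := ih hid φ hφ' ψ hψ rfl hd' α' hα'' β' γ hγ h3 h2
    refine ⟨?_, rfl⟩
    rw [h5] at hφ
    rw [h5, σ.mapRel_idRel, idRel_par] at h3
    obtain ⟨rfl, -⟩ := parRel_inj h3
    obtain rfl : s = s' := by
      refine σ.eq_of_insert_idRel hx hs hφ ?_
      cases hp : σ.S.pol s with
      | pos => exact Or.inl rfl
      | neg =>
        right
        -- A negative symmetry of `A` is a positive symmetry of `A.dual`, where the polarity of `a`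
        -- is that of `s`.
        have := A.dual.eq_of_insert_idRel_pos (x := σ.left φ.dom)
          (PreStrategy.isConf_left hx) hα (by
          rw [← hp, ← σ.map_pol, show σ.map.toFun s = _ from ha]; rfl)
        rw [ha', show σ.map.toFun s = _ from ha, this]
    rw [idRel_insert, ← h5]
  · rintro t x y θ c hx hy ht hty hθ hc ih hid φ hφ ψ hψ hd hd' α hα β γ hγ h1 h2
    obtain ⟨t', ψ, hψ', rfl, rfl⟩ := IsoFamily.exists_insert_of_dom hψ hy ht hd'
    obtain ⟨β', -, γ', hγ', h3⟩ := τ.exists_mapRel_eq (P := B.dual) hψ'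
    have h4 := h2
    rw [τ.mapRel_insert, h3, show τ.map.toFun t = _ from hc] at h4
    obtain ⟨c', hc', rfl, rfl⟩ := insert_inr_eq_parRel h4
    have hcd : c ∉ γ'.dom := PreStrategy.right_dom h3 ▸ PreStrategy.notMem_right hc ht hty
    have hγ'' := IsoFamily.mem_of_insert hγ hcd (C.iso.dom_conf _ hγ')
    obtain ⟨rfl, h5⟩ := ih hid φ hφ ψ hψ' hd rfl α hα β' γ' hγ'' h1 h3
    refine ⟨rfl, ?_⟩
    rw [h5] at hψ
    rw [h5, τ.mapRel_idRel, idRel_par] at h3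
    obtain ⟨-, rfl⟩ := parRel_inj h3
    obtain rfl : t = t' := by
      refine τ.eq_of_insert_idRel hy ht hψ ?_
      cases hp : τ.S.pol t with
      | pos => exact Or.inl rfl
      | neg =>
        right
        have := C.eq_of_insert_idRel_pos (PreStrategy.isConf_right hy) hγ (by
          rw [← hp, ← τ.map_pol, show τ.map.toFun t = _ from hc]; rfl)
        rw [hc', show τ.map.toFun t = _ from hc, this]
    rw [idRel_insert, ← h5]
  · rintro s t x y θ b b' hx hy hs hsx ht hty hθ hθ' hb hb' ih hid φ hφ ψ hψ hd hd' α hα β γ hγ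
      h1 h2
    obtain rfl : b = b' := hid _ (Or.inl rfl)
    obtain ⟨s', φ, hφ', rfl, rfl⟩ := IsoFamily.exists_insert_of_dom hφ hx hs hd
    obtain ⟨t', ψ, hψ', rfl, rfl⟩ := IsoFamily.exists_insert_of_dom hψ hy ht hd'
    obtain ⟨α', -, β', -, h3⟩ := σ.exists_mapRel_eq (P := A.dual) hφ'
    obtain ⟨β'', -, γ', -, h4⟩ := τ.exists_mapRel_eq (P := B.dual) hψ'
    have h5 := h1
    rw [σ.mapRel_insert, h3, show σ.map.toFun s = _ from hb] at h5
    obtain ⟨d, hd1, rfl, rfl⟩ := insert_inr_eq_parRel h5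
    have h6 := h2
    rw [τ.mapRel_insert, h4, show τ.map.toFun t = _ from hb'] at h6
    obtain ⟨d', hd2, h7, rfl⟩ := insert_inl_eq_parRel h6
    obtain ⟨rfl, rfl⟩ := insert_pair_inj
      (PreStrategy.left_dom h4 ▸ PreStrategy.notMem_left hb' ht hty)
      (PreStrategy.right_dom h3 ▸ PreStrategy.notMem_right hb hs hsx) h7
    obtain ⟨h8, h9⟩ := ih (fun q hq => hid q (Or.inr hq)) φ hφ' ψ hψ' rfl rfl _ hα _ _ hγ h3 h4
    rw [h8] at hφ
    rw [h9] at hψ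
    have hpol : (σ.S.pol s).op = τ.S.pol t := by
      rw [← σ.map_pol, ← τ.map_pol, show σ.map.toFun s = _ from hb,
        show τ.map.toFun t = _ from hb']
      rfl
    -- Thinness fixes the event on the side where it is positive; the common display on `B` then
    -- fixes the label on the other side, and receptivity fixes its event.
    have hst : s = s' ∧ t = t' := by
      cases hp : σ.S.pol s with
      | pos =>
        obtain rfl := σ.eq_of_insert_idRel hx hs hφ (Or.inl hp)
        refine ⟨rfl, τ.eq_of_insert_idRel hy ht hψ (Or.inr ?_)⟩
        rw [hd2, show τ.map.toFun t = _ from hb']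
        rw [show σ.map.toFun s = _ from hb] at hd1
        rw [Sum.inr_injective hd1]
      | neg =>
        rw [hp] at hpol
        obtain rfl := τ.eq_of_insert_idRel hy ht hψ (Or.inl hpol.symm)
        refine ⟨σ.eq_of_insert_idRel hx hs hφ (Or.inr ?_), rfl⟩
        rw [hd1, show σ.map.toFun s = _ from hb]
        rw [show τ.map.toFun t = _ from hb'] at hd2
        rw [Sum.inl_injective hd2]
    obtain ⟨rfl, rfl⟩ := hst
    rw [idRel_insert, idRel_insert, ← h8, ← h9]
    exact ⟨rfl, rfl⟩

end Sync

/-! ## Counting witnesses together with symmetries -/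

section Count

theorem IsoFamily.card_iso_ne_top {E : EvStr.{u}} (F : IsoFamily E) {x : Set E.Ev}
    (hx : E.IsConf x) : ENat.card {θ // F.Iso θ x x} ≠ ⊤ := by
  have : {θ | F.Iso θ x x}.Finite := by
    refine (hx.finite.prod hx.finite).finite_subsets.subset ?_
    rintro θ ⟨-, rfl, hc⟩ ⟨a, b⟩ h
    exact ⟨⟨b, h⟩, hc ▸ ⟨a, h⟩⟩
  have : Finite {θ // F.Iso θ x x} := this
  exact ENat.card_lt_top_of_finite.ne

theorem IsoFamily.card_iso_ne_zero {E : EvStr.{u}} (F : IsoFamily E) {x : Set E.Ev}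
    (hx : E.IsConf x) : ENat.card {θ // F.Iso θ x x} ≠ 0 := by
  rw [ne_eq, ENat.card_eq_zero_iff_empty, not_isEmpty_iff]
  exact ⟨_, F.iso_refl hx⟩

/-- Composition with one chosen symmetry `f i ≅ b` identifies all of them with the endosymmetries of
`b`, so their number does not depend on `i`. -/
theorem IsoFamily.card_pairs {E : EvStr.{u}} (F : IsoFamily E) {ι : Type v} (p : Set ι)
    (f : ι → Set E.Ev) (b : Set E.Ev) (h : ∀ i ∈ p, F.Related (f i) b) :
    ENat.card {q : ι × SetRel E.Ev E.Ev // q.1 ∈ p ∧ F.Iso q.2 (f q.1) b} =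
      p.encard * ENat.card {θ // F.Iso θ b b} := by
  choose g hg using h
  rw [Set.encard, ← ENat.card_prod]
  exact ENat.card_congr
    { toFun := fun q => (⟨q.1.1, q.2.1⟩,
        ⟨(g _ q.2.1).inv.comp q.1.2, iso_comp (hg _ q.2.1).symm q.2.2⟩)
      invFun := fun r => ⟨(r.1.1, (g _ r.1.2).comp r.2.1), r.1.2, iso_comp (hg _ r.1.2) r.2.2⟩
      left_inv := by
        rintro ⟨⟨i, θ⟩, hi, hθ⟩
        refine Subtype.ext (Prod.ext rfl ?_)
        exact comp_inv_cancel (hg _ hi).1 (hθ.2.1.trans (hg _ hi).2.1.symm).subset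
      right_inv := by
        rintro ⟨⟨i, hi⟩, ⟨θ, hθ⟩⟩
        refine Prod.ext rfl (Subtype.ext ?_)
        exact inv_comp_cancel (hg _ hi).1 (hθ.2.1.trans (hg _ hi).2.2.symm).subset }

/-- Canonicity says that composing a negative with a positive endosymmetry reaches every
endosymmetry exactly once. Only this numerical consequence enters the count. -/
theorem TCG.Canonical.card_iso {A : TCG.{u}} {x : A.Conf} (h : A.Canonical x) :
    ENat.card {θ // A.iso.Iso θ x.1 x.1} =
      ENat.card {θ // A.isoNeg.Iso θ x.1 x.1} * ENat.card {θ // A.isoPos.Iso θ x.1 x.1} := by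
  rw [← ENat.card_prod]
  symm
  have hi : ∀ p : {θ // A.isoNeg.Iso θ x.1 x.1} × {θ // A.isoPos.Iso θ x.1 x.1},
      A.iso.Iso (p.1.1.comp p.2.1) x.1 x.1 := fun p =>
    iso_comp ⟨A.neg_le p.1.2.1, p.1.2.2⟩ ⟨A.pos_le p.2.2.1, p.2.2.2⟩
  refine ENat.card_congr (Equiv.ofBijective (fun p => ⟨p.1.1.comp p.2.1, hi p⟩) ⟨?_, ?_⟩)
  · intro p q hpq
    have := (h _ (hi p)).unique (y₁ := (p.1.1, p.2.1)) (y₂ := (q.1.1, q.2.1))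
      ⟨p.1.2, p.2.2, rfl⟩ ⟨q.1.2, q.2.2, Subtype.ext_iff.1 hpq⟩
    exact Prod.ext (Subtype.ext (Prod.ext_iff.1 this).1) (Subtype.ext (Prod.ext_iff.1 this).2)
  · rintro ⟨θ, hθ⟩
    obtain ⟨p, hp, -⟩ := h θ hθ
    exact ⟨(⟨p.1, hp.1⟩, ⟨p.2, hp.2.1⟩), Subtype.ext hp.2.2.symm⟩

end Count

/-! ### Transport of configurations along symmetries of a strategy -/

section Transport

variable {A : TCG.{u₁}} {B : TCG.{u₂}} (σ : Strat.{u₁, u₂, u} A B)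

/-- `θ'` is obtained from `θ : σ y_B ≅ b` by transport along a symmetry `y ≅ x` of the strategy
`σ : A → B` which is negative on `A`. -/
def TransportRight (y x : Set σ.S.Ev) (θ θ' : SetRel B.Ev B.Ev) : Prop :=
  ∃ φ, σ.iso.Iso φ y x ∧ ∃ α ∈ A.isoNeg.sym, ∃ β, σ.mapRel φ = parRel α β ∧ θ = β.comp θ'

/-- `θ'` is obtained from `θ : σ y_A ≅ a` by transport along a symmetry `y ≅ x` of the strategy
`σ : A → B` which is positive on `B`. -/
def TransportLeft (y x : Set σ.S.Ev) (θ θ' : SetRel A.Ev A.Ev) : Prop :=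
  ∃ φ, σ.iso.Iso φ y x ∧ ∃ α, ∃ β ∈ B.isoPos.sym, σ.mapRel φ = parRel α β ∧ θ = α.comp θ'

/-- `exists_lift` is applied to the identity on `A` beside `θ` on `B`. The residual symmetry is
positive in `A.dual ∥ B`: its left component is `α⁻¹`, so `α` is negative in `A`, and its right
component is `θ'`. -/
theorem exists_transportRight {y : Set σ.S.Ev} (hy : σ.S.IsConf y) {θ : SetRel B.Ev B.Ev}
    {b : Set B.Ev} (hθ : B.iso.Iso θ (σ.right y) b) :
    ∃ x θ', σ.S.IsConf x ∧ B.isoPos.Iso θ' (σ.right x) b ∧ TransportRight σ y x θ θ' := by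
  obtain ⟨φ, hφ, rfl, h⟩ := σ.exists_lift hy (parRel (idRel (σ.left y)) θ)
    ⟨_, A.iso.id_mem _ (PreStrategy.isConf_left hy), _, hθ.1, rfl⟩ (by
      ext (a | a)
      · rw [← Set.mem_preimage, inl_dom_parRel, idRel_dom]; rfl
      · rw [← Set.mem_preimage, inr_dom_parRel, hθ.2.1]; rfl)
  obtain ⟨α, hα, β, hβ, hm⟩ := σ.exists_mapRel_eq (P := A.dual) hφ
  have hd := PreStrategy.left_dom hm
  have hd' := PreStrategy.right_dom hm
  rw [hm, parRel_inv, parRel_comp, comp_idRel (by rw [SetRel.cod_inv, hd])] at h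
  obtain ⟨_, h1, _, h2, h3⟩ := h
  obtain ⟨rfl, rfl⟩ := parRel_inj h3
  have hi : B.iso.Iso β (σ.right φ.dom) (σ.right φ.cod) :=
    ⟨hβ, hd'.symm, (PreStrategy.right_cod hm).symm⟩
  refine ⟨φ.cod, β.inv.comp θ, σ.iso.cod_conf _ hφ, ⟨h2, (iso_comp hi.symm hθ).2⟩, φ,
    ⟨hφ, rfl, rfl⟩, α, A.isoNeg.inv_mem _ h1, β, hm, ?_⟩
  rw [IsoFamily.comp_inv_cancel hβ]
  rw [hθ.2.1, hd']

theorem exists_transportLeft {y : Set σ.S.Ev} (hy : σ.S.IsConf y) {θ : SetRel A.Ev A.Ev}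
    {a : Set A.Ev} (hθ : A.iso.Iso θ (σ.left y) a) :
    ∃ x θ', σ.S.IsConf x ∧ A.isoNeg.Iso θ' (σ.left x) a ∧ TransportLeft σ y x θ θ' := by
  obtain ⟨φ, hφ, rfl, h⟩ := σ.exists_lift hy (parRel θ (idRel (σ.right y)))
    ⟨_, hθ.1, _, B.iso.id_mem _ (PreStrategy.isConf_right hy), rfl⟩ (by
      ext (a | a)
      · rw [← Set.mem_preimage, inl_dom_parRel, hθ.2.1]; rfl
      · rw [← Set.mem_preimage, inr_dom_parRel, idRel_dom]; rfl)
  obtain ⟨α, hα, β, hβ, hm⟩ := σ.exists_mapRel_eq (P := A.dual) hφ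
  have hd := PreStrategy.left_dom hm
  have hd' := PreStrategy.right_dom hm
  rw [hm, parRel_inv, parRel_comp, comp_idRel (θ := β.inv) (by rw [SetRel.cod_inv, hd'])] at h
  obtain ⟨_, h1, _, h2, h3⟩ := h
  obtain ⟨rfl, rfl⟩ := parRel_inj h3
  have hi : A.iso.Iso α (σ.left φ.dom) (σ.left φ.cod) :=
    ⟨hα, hd.symm, (PreStrategy.left_cod hm).symm⟩
  refine ⟨φ.cod, α.inv.comp θ, σ.iso.cod_conf _ hφ, ⟨h1, (iso_comp hi.symm hθ).2⟩, φ,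
    ⟨hφ, rfl, rfl⟩, α, β, B.isoPos.inv_mem _ h2, hm, ?_⟩
  rw [IsoFamily.comp_inv_cancel (F := A.iso) hα]
  rw [hθ.2.1, hd]

variable {σ}

/-- Both transports factor the same symmetry, the identity on `A` beside `θ` on `B`, so
`lift_unique` compares them. -/
theorem TransportRight.unique {y x x' : Set σ.S.Ev} {θ θ₁ θ₂ : SetRel B.Ev B.Ev} {b : Set B.Ev}
    (h : TransportRight σ y x θ θ₁) (h' : TransportRight σ y x' θ θ₂)
    (h₁ : B.isoPos.Iso θ₁ (σ.right x) b) (h₂ : B.isoPos.Iso θ₂ (σ.right x') b) :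
    x = x' ∧ θ₁ = θ₂ := by
  obtain ⟨φ, ⟨hφ, rfl, rfl⟩, α, hα, β, hm, rfl⟩ := h
  obtain ⟨φ', ⟨hφ', hd, rfl⟩, α', hα', β', hm', he⟩ := h'
  have key := σ.lift_unique hφ hφ' hd.symm (θ := parRel α.inv θ₁) (θ' := parRel α'.inv θ₂)
    ⟨_, A.isoNeg.inv_mem _ hα, _, h₁.1, rfl⟩ ⟨_, A.isoNeg.inv_mem _ hα', _, h₂.1, rfl⟩
    (by rw [hm, parRel_cod, parRel_dom, h₁.2.1, PreStrategy.right_cod hm]; rfl)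
    (by rw [hm', parRel_cod, parRel_dom, h₂.2.1, PreStrategy.right_cod hm']; rfl)
    (by
      rw [hm, hm', parRel_comp, parRel_comp, he, IsoFamily.comp_inv_self hα,
        IsoFamily.comp_inv_self hα', ← PreStrategy.left_dom hm, ← PreStrategy.left_dom hm', hd])
  exact ⟨key.1, (parRel_inj key.2).2⟩

theorem TransportLeft.unique {y x x' : Set σ.S.Ev} {θ θ₁ θ₂ : SetRel A.Ev A.Ev} {a : Set A.Ev}
    (h : TransportLeft σ y x θ θ₁) (h' : TransportLeft σ y x' θ θ₂)
    (h₁ : A.isoNeg.Iso θ₁ (σ.left x) a) (h₂ : A.isoNeg.Iso θ₂ (σ.left x') a) :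
    x = x' ∧ θ₁ = θ₂ := by
  obtain ⟨φ, ⟨hφ, rfl, rfl⟩, α, β, hβ, hm, rfl⟩ := h
  obtain ⟨φ', ⟨hφ', hd, rfl⟩, α', β', hβ', hm', he⟩ := h'
  have key := σ.lift_unique hφ hφ' hd.symm (θ := parRel θ₁ β.inv) (θ' := parRel θ₂ β'.inv)
    ⟨_, h₁.1, _, B.isoPos.inv_mem _ hβ, rfl⟩ ⟨_, h₂.1, _, B.isoPos.inv_mem _ hβ', rfl⟩
    (by rw [hm, parRel_cod, parRel_dom, h₁.2.1, PreStrategy.left_cod hm]; rfl)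
    (by rw [hm', parRel_cod, parRel_dom, h₂.2.1, PreStrategy.left_cod hm']; rfl)
    (by
      rw [hm, hm', parRel_comp, parRel_comp, he, IsoFamily.comp_inv_self hβ,
        IsoFamily.comp_inv_self hβ', ← PreStrategy.right_dom hm, ← PreStrategy.right_dom hm', hd])
  exact ⟨key.1, (parRel_inj key.2).1⟩

end Transport

/-! ### Matching pairs against pairs of witnesses -/

section Matching

variable {A : TCG.{u₁}} {B : TCG.{u₂}} {C : TCG.{u₃}}

theorem IsoFamily.Related.trans {E : EvStr.{u}} {F : IsoFamily E} {x y z : Set E.Ev}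
    (h : F.Related x y) (h' : F.Related y z) : F.Related x z := by
  obtain ⟨θ, hθ⟩ := h
  obtain ⟨φ, hφ⟩ := h'
  exact ⟨_, iso_comp hθ hφ⟩

/-- The pairs of matching `+`-covered configurations of `σ` and `τ`, with display in the given
symmetry classes. -/
def matching (σ : PreStrat.{u₁, u₂, u} A B) (τ : PreStrat.{u₂, u₃, v} B C) (rA : A.Reps)
    (rC : C.Reps) (X : A.SymClass) (Z : C.SymClass) : Set (σ.S.Conf × τ.S.Conf) :=
  {p | σ.S.PlusCovered p.1.1 ∧ τ.S.PlusCovered p.2.1 ∧ σ.right p.1.1 = τ.left p.2.1 ∧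
    A.isoNeg.Related (σ.left p.1.1) (rA.rep X).1 ∧ C.isoPos.Related (τ.right p.2.1) (rC.rep Z).1}

variable (σ : Strat.{u₁, u₂, u} A B) (τ : Strat.{u₂, u₃, v} B C)

/-- Synchronization along `θ₁` followed by `θ₂⁻¹` moves `x` and `y` to configurations that agree on
`B`. Undoing these moves is the required transport, with `θ` equal to `β⁻¹` followed by `θ₂`. -/
theorem exists_transport_to (hdl : DoNotDeadlock σ.toPreStrategy τ.toPreStrategy)
    {x : Set σ.S.Ev} {y : Set τ.S.Ev} (hx : σ.S.IsConf x) (hy : τ.S.IsConf y)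
    {b : Set B.Ev} {θ₁ θ₂ : SetRel B.Ev B.Ev} (h₁ : B.isoPos.Iso θ₁ (σ.right x) b)
    (h₂ : B.isoNeg.Iso θ₂ (τ.left y) b) :
    ∃ x' y' θ, σ.S.IsConf x' ∧ τ.S.IsConf y' ∧ σ.right x' = τ.left y' ∧
      B.iso.Iso θ (σ.right x') b ∧ TransportRight σ x' x θ θ₁ ∧ TransportLeft τ y' y θ θ₂ := by
  have h₁' : B.iso.Iso θ₁ (σ.right x) b := ⟨B.pos_le h₁.1, h₁.2⟩
  have h₂' : B.iso.Iso θ₂ (τ.left y) b := ⟨B.neg_le h₂.1, h₂.2⟩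
  have hθ := iso_comp h₁' h₂'.symm
  obtain ⟨φ, hφ, ψ, hψ, rfl, rfl, α, hα, γ, hγ, β, h3, h4⟩ := exists_sync σ τ hdl hx hy hθ
  have hβ : β ∈ B.iso.sym := (τ.mem_iso_of_mapRel_eq (P := B.dual) hψ h4).1
  have hd : β.dom = τ.left ψ.dom := (PreStrategy.left_dom h4).symm
  have hc : β.cod = τ.left ψ.cod := (PreStrategy.left_cod h4).symm
  have hr : σ.right φ.cod = τ.left ψ.cod := by
    rw [PreStrategy.right_cod h3, comp_cod (hθ.2.2.trans hd.symm), hc]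
  have hi : B.iso.Iso β (τ.left ψ.dom) (τ.left ψ.cod) := ⟨hβ, hd, hc⟩
  refine ⟨φ.cod, ψ.cod, β.inv.comp θ₂, σ.iso.cod_conf _ hφ, τ.iso.cod_conf _ hψ, hr, ?_,
    ⟨φ.inv, ⟨σ.iso.inv_mem _ hφ, rfl, rfl⟩, α.inv, A.isoNeg.inv_mem _ hα, _,
      by rw [σ.mapRel_inv, h3, parRel_inv], ?_⟩,
    ⟨ψ.inv, ⟨τ.iso.inv_mem _ hψ, rfl, rfl⟩, β.inv, γ.inv, C.isoPos.inv_mem _ hγ,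
      by rw [τ.mapRel_inv, h4, parRel_inv], rfl⟩⟩
  · rw [hr]
    exact iso_comp hi.symm h₂'
  · rw [SetRel.inv_comp, SetRel.inv_comp, SetRel.inv_inv, SetRel.comp_assoc]
    congr 1
    rw [IsoFamily.cancel_inv_comp h₁'.1]
    rw [h₂'.2.2, h₁'.2.2]

/-- Going from one candidate to `(x, y)` and back to the other gives symmetries of `σ` and `τ` with
the same display on `B`, namely `θ` followed by `θ'⁻¹`, negative on `A` and positive on `C`;
`sync_unique` makes them identities. -/
theorem transport_to_unique (hdl : DoNotDeadlock σ.toPreStrategy τ.toPreStrategy)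
    {x x₁ x₂ : Set σ.S.Ev} {y y₁ y₂ : Set τ.S.Ev} {b : Set B.Ev}
    {θ₁ θ₂ θ θ' : SetRel B.Ev B.Ev} (hr₁ : σ.right x₁ = τ.left y₁) (hr₂ : σ.right x₂ = τ.left y₂)
    (hθ₁ : B.isoPos.Iso θ₁ (σ.right x) b) (hθ₂ : B.isoNeg.Iso θ₂ (τ.left y) b)
    (hθ : B.iso.Iso θ (σ.right x₁) b) (hθ' : B.iso.Iso θ' (σ.right x₂) b)
    (h₁ : TransportRight σ x₁ x θ θ₁) (h₁' : TransportLeft τ y₁ y θ θ₂)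
    (h₂ : TransportRight σ x₂ x θ' θ₁) (h₂' : TransportLeft τ y₂ y θ' θ₂) :
    x₁ = x₂ ∧ y₁ = y₂ ∧ θ = θ' := by
  obtain ⟨φ₁, ⟨hφ₁, rfl, rfl⟩, α₁, hα₁, β₁, h3, h4⟩ := h₁
  obtain ⟨φ₂, ⟨hφ₂, rfl, hc⟩, α₂, hα₂, β₂, h5, h6⟩ := h₂
  obtain ⟨ψ₁, ⟨hψ₁, rfl, rfl⟩, β₁', γ₁, hγ₁, h3', h4'⟩ := h₁'
  obtain ⟨ψ₂, ⟨hψ₂, rfl, hc'⟩, β₂', γ₂, hγ₂, h5', h6'⟩ := h₂'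
  have hq₁ : B.iso.sym θ₁ := B.pos_le hθ₁.1
  have hq₂ : B.iso.sym θ₂ := B.neg_le hθ₂.1
  have e1 : β₁ = θ.comp θ₁.inv := by
    rw [h4, IsoFamily.cancel_comp_inv hq₁]
    rw [hθ₁.2.1, PreStrategy.right_cod h3]
  have e2 : β₂ = θ'.comp θ₁.inv := by
    rw [h6, IsoFamily.cancel_comp_inv hq₁]
    rw [hθ₁.2.1, ← hc, PreStrategy.right_cod h5]
  have e1' : β₁' = θ.comp θ₂.inv := by
    rw [h4', IsoFamily.cancel_comp_inv hq₂]
    rw [hθ₂.2.1, PreStrategy.left_cod h3']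
  have e2' : β₂' = θ'.comp θ₂.inv := by
    rw [h6', IsoFamily.cancel_comp_inv hq₂]
    rw [hθ₂.2.1, ← hc', PreStrategy.left_cod h5']
  have k : ∀ {κ : SetRel B.Ev B.Ev} {z}, κ ∈ B.iso.sym → κ.cod = b →
      (θ.comp κ.inv).comp (θ'.comp κ.inv).inv = z → θ.comp θ'.inv = z := by
    rintro κ z hκ hκb rfl
    rw [SetRel.inv_comp, SetRel.inv_inv, ← SetRel.comp_assoc, IsoFamily.cancel_inv_comp hκ]
    rw [hθ.2.2, hκb]
  have k1 := k hq₁ hθ₁.2.2 rfl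
  have k2 := k hq₂ hθ₂.2.2 rfl
  rw [← e1, ← e2] at k1
  rw [← e1', ← e2'] at k2
  have hcod : φ₁.cod = φ₂.inv.dom := hc.symm
  have hcod' : ψ₁.cod = ψ₂.inv.dom := hc'.symm
  have m1 : σ.mapRel (φ₁.comp φ₂.inv) = parRel (α₁.comp α₂.inv) (θ.comp θ'.inv) := by
    rw [σ.mapRel_comp hφ₁ hcod, σ.mapRel_inv, h3, h5, parRel_inv, parRel_comp, k1]
  have m2 : τ.mapRel (ψ₁.comp ψ₂.inv) = parRel (θ.comp θ'.inv) (γ₁.comp γ₂.inv) := by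
    rw [τ.mapRel_comp hψ₁ hcod', τ.mapRel_inv, h3', h5', parRel_inv, parRel_comp, k2]
  have hα := A.isoNeg.comp_mem _ hα₁ _ (A.isoNeg.inv_mem _ hα₂) (by
    rw [SetRel.dom_inv, ← PreStrategy.left_cod h3, ← PreStrategy.left_cod h5, hc])
  have hγ := C.isoPos.comp_mem _ hγ₁ _ (C.isoPos.inv_mem _ hγ₂) (by
    rw [SetRel.dom_inv, ← PreStrategy.right_cod h3', ← PreStrategy.right_cod h5', hc'])
  have hd := comp_dom hcod
  have hd' := comp_dom hcod'
  obtain ⟨u1, u2⟩ := sync_unique σ τ hdl (σ.iso.comp_mem _ hφ₁ _ (σ.iso.inv_mem _ hφ₂) hcod)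
    (τ.iso.comp_mem _ hψ₁ _ (τ.iso.inv_mem _ hψ₂) hcod') (by rw [hd, hd', hr₁]) hα hγ m1 m2
  have v1 := congrArg SetRel.cod u1
  have v2 := congrArg SetRel.cod u2
  rw [comp_cod hcod, idRel_cod, hd] at v1
  rw [comp_cod hcod', idRel_cod, hd'] at v2
  refine ⟨v1.symm, v2.symm, ?_⟩
  rw [u1, σ.mapRel_idRel, idRel_par] at m1
  obtain ⟨-, w⟩ := parRel_inj m1
  rw [← IsoFamily.cancel_inv_comp hθ'.1 (φ := θ) (by rw [hθ.2.2, hθ'.2.2]), ← w, idRel_comp]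
  rw [hθ'.2.1, hd, ← v1]
  exact subset_rfl

/-- Transport depends on a symmetry to the representative, so configurations are counted together
with such symmetries. -/
theorem card_matching_related (hdl : DoNotDeadlock σ.toPreStrategy τ.toPreStrategy)
    (rA : A.Reps) (rB : B.Reps) (rC : C.Reps) (X : A.SymClass) (Y : B.SymClass) (Z : C.SymClass)
    (hY : B.Canonical (rB.rep Y)) :
    {p ∈ matching σ.toPreStrategy τ.toPreStrategy rA rC X Z |
      B.iso.Related (σ.right p.1.1) (rB.rep Y).1}.encard =
    σ.toPreStrategy.coll rA rB X Y * τ.toPreStrategy.coll rB rC Y Z := by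
  set b := (rB.rep Y).1
  have hb : B.IsConf b := (rB.rep Y).2
  have h1 := B.iso.card_pairs {p ∈ matching σ.toPreStrategy τ.toPreStrategy rA rC X Z |
    B.iso.Related (σ.right p.1.1) b} (fun p => σ.right p.1.1) b fun p hp => hp.2
  have h2 := B.isoPos.card_pairs (σ.toPreStrategy.wit rA rB X Y) (fun p => σ.right p.1) b
    fun p hp => hp.2.2
  have h3 := B.isoNeg.card_pairs (τ.toPreStrategy.wit rB rC Y Z) (fun p => τ.left p.1) b
    fun p hp => hp.2.1
  -- After multiplication by the number of endosymmetries of `b`, the left side counts triples `(x,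
  -- y, θ)` and, by canonicity, the right side counts quadruples `(x, θ₁, y, θ₂)`.
  refine enat_mul_right_cancel (B.iso.card_iso_ne_zero hb) (B.iso.card_iso_ne_top hb) ?_
  rw [← h1]
  refine Eq.trans ?_ (b := _ * _) ((congrArg₂ (· * ·) h2 h3).trans ?_)
  swap
  · rw [hY.card_iso, PreStrategy.coll, PreStrategy.coll]
    ring
  rw [← ENat.card_prod]
  -- The same `θ` is transported in `σ` to a positive symmetry and in `τ` to a negative one. Both
  -- transports preserve `+`-coverage and the conditions on `A` and `C`.
  refine enat_card_eq_of_rel (fun p q =>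
    TransportRight σ p.1.1.1.1 q.1.1.1.1 p.1.2 q.1.1.2 ∧
    TransportLeft τ p.1.1.2.1 q.2.1.1.1 p.1.2 q.2.1.2) ?_ ?_ ?_ ?_
  · rintro ⟨⟨⟨⟨x, hx⟩, ⟨y, hy⟩⟩, θ⟩, ⟨⟨hxp, hyp, hxy, hA, hC⟩, -⟩, hθ⟩
    obtain ⟨x', θ₁, hx', hθ₁, ht⟩ := exists_transportRight σ hx hθ
    obtain ⟨y', θ₂, hy', hθ₂, ht'⟩ := exists_transportLeft τ hy (hxy ▸ hθ)
    have ht1 := ht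
    have ht1' := ht'
    obtain ⟨φ, hφ, α, hα, β, hm, -⟩ := ht1
    obtain ⟨ψ, hψ, β', γ, hγ, hm', -⟩ := ht1'
    refine ⟨⟨⟨⟨⟨x', hx'⟩, θ₁⟩, ⟨σ.plusCovered_iso hφ hxp, ?_, ⟨_, hθ₁⟩⟩, hθ₁⟩,
      ⟨⟨⟨y', hy'⟩, θ₂⟩, ⟨τ.plusCovered_iso hψ hyp, ⟨_, hθ₂⟩, ?_⟩, hθ₂⟩⟩, ht, ht'⟩
    · obtain ⟨_, rfl, rfl⟩ := hφ
      exact IsoFamily.Related.trans (IsoFamily.Related.symm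
        ⟨α, hα, (PreStrategy.left_dom hm).symm, (PreStrategy.left_cod hm).symm⟩) hA
    · obtain ⟨_, rfl, rfl⟩ := hψ
      exact IsoFamily.Related.trans (IsoFamily.Related.symm
        ⟨γ, hγ, (PreStrategy.right_dom hm').symm, (PreStrategy.right_cod hm').symm⟩) hC
  · rintro ⟨⟨⟨⟨x, hx⟩, θ₁⟩, ⟨hxp, hA, -⟩, hθ₁⟩, ⟨⟨⟨y, hy⟩, θ₂⟩, ⟨hyp, -, hC⟩, hθ₂⟩⟩
    obtain ⟨x', y', θ, hx', hy', hr, hθ, ht, ht'⟩ := exists_transport_to σ τ hdl hx hy hθ₁ hθ₂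
    have ht1 := ht
    have ht1' := ht'
    obtain ⟨φ, hφ, α, hα, β, hm, -⟩ := ht1
    obtain ⟨ψ, hψ, β', γ, hγ, hm', -⟩ := ht1'
    refine ⟨⟨⟨⟨⟨x', hx'⟩, ⟨y', hy'⟩⟩, θ⟩, ⟨⟨σ.plusCovered_iso hφ.symm hxp,
      τ.plusCovered_iso hψ.symm hyp, hr, ?_, ?_⟩, ⟨_, hθ⟩⟩, hθ⟩, ht, ht'⟩
    · obtain ⟨_, rfl, rfl⟩ := hφ
      exact IsoFamily.Related.trans
        ⟨α, hα, (PreStrategy.left_dom hm).symm, (PreStrategy.left_cod hm).symm⟩ hA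
    · obtain ⟨_, rfl, rfl⟩ := hψ
      exact IsoFamily.Related.trans
        ⟨γ, hγ, (PreStrategy.right_dom hm').symm, (PreStrategy.right_cod hm').symm⟩ hC
  · rintro ⟨⟨⟨⟨x, hx⟩, ⟨y, hy⟩⟩, θ⟩, _, hθ⟩
      ⟨⟨⟨⟨x₁, hx₁⟩, θ₁⟩, _, hθ₁⟩, ⟨⟨⟨y₁, hy₁⟩, φ₁⟩, _, hφ₁⟩⟩
      ⟨⟨⟨⟨x₂, hx₂⟩, θ₂⟩, _, hθ₂⟩, ⟨⟨⟨y₂, hy₂⟩, φ₂⟩, _, hφ₂⟩⟩ ⟨h, h'⟩ ⟨k, k'⟩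
    obtain ⟨rfl, rfl⟩ : x₁ = x₂ ∧ θ₁ = θ₂ := h.unique k hθ₁ hθ₂
    obtain ⟨rfl, rfl⟩ : y₁ = y₂ ∧ φ₁ = φ₂ := h'.unique k' hφ₁ hφ₂
    rfl
  · rintro ⟨⟨⟨⟨x₁, hx₁⟩, ⟨y₁, hy₁⟩⟩, θ₁⟩, ⟨hm₁, _⟩, hθ₁⟩
      ⟨⟨⟨⟨x₂, hx₂⟩, ⟨y₂, hy₂⟩⟩, θ₂⟩, ⟨hm₂, _⟩, hθ₂⟩
      ⟨⟨⟨⟨x, hx⟩, θ⟩, _, hθ⟩, ⟨⟨⟨y, hy⟩, φ⟩, _, hφ⟩⟩ ⟨h, h'⟩ ⟨k, k'⟩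
    obtain ⟨rfl, rfl, rfl⟩ : x₁ = x₂ ∧ y₁ = y₂ ∧ θ₁ = θ₂ :=
      transport_to_unique σ τ hdl hm₁.2.2.1 hm₂.2.2.1 hθ hφ hθ₁ hθ₂ h h' k k'
    rfl

theorem card_matching (hdl : DoNotDeadlock σ.toPreStrategy τ.toPreStrategy)
    (rA : A.Reps) (rB : B.Reps) (rC : C.Reps) (hrB : ∀ Y, B.Canonical (rB.rep Y))
    (X : A.SymClass) (Z : C.SymClass) :
    (matching σ.toPreStrategy τ.toPreStrategy rA rC X Z).encard =
      ∑' Y : B.SymClass, σ.toPreStrategy.coll rA rB X Y * τ.toPreStrategy.coll rB rC Y Z := by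
  rw [Set.encard, enat_card_eq_tsum_fiber fun p => (Quotient.mk B.confSetoid
    ⟨σ.right p.1.1.1, PreStrategy.isConf_right p.1.1.2⟩ : B.SymClass)]
  refine tsum_congr fun Y => ?_
  rw [← card_matching_related σ τ hdl rA rB rC X Y Z (hrB Y), Set.encard]
  have hiff : ∀ p : σ.S.Conf × τ.S.Conf, (Quotient.mk B.confSetoid
      ⟨σ.right p.1.1, PreStrategy.isConf_right p.1.2⟩ : B.SymClass) = Y ↔
      B.iso.Related (σ.right p.1.1) (rB.rep Y).1 := fun p => by
    conv_lhs => rw [← rB.rep_mem Y]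
    exact Quotient.eq
  exact ENat.card_congr
    { toFun := fun a => ⟨a.1.1, a.1.2, (hiff _).1 a.2⟩
      invFun := fun a => ⟨⟨a.1, a.2.1⟩, (hiff _).2 a.2.2⟩
      left_inv := fun _ => rfl
      right_inv := fun _ => rfl }

end Matching

/-! ## Secured bijections as unions of their prime parts -/

section Pullback

variable {P : EvStr.{u}} {Q : EvStr.{v}} {G : EvStr.{w}} {f : EvMap P G} {g : EvMap Q G}

/-- `p` is maximal in `ψ` for the causal order induced on `ψ`. -/
def MaximalIn {P : Type u} {Q : Type v} [PartialOrder P] [PartialOrder Q] (ψ : Set (P × Q))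
    (p : P × Q) : Prop :=
  p ∈ ψ ∧ ∀ q ∈ ψ, ¬ (p.1 < q.1 ∨ p.2 < q.2)

theorem MaximalIn.eq_of_below {P : Type u} {Q : Type v} [PartialOrder P] [PartialOrder Q]
    {ψ φ : Set (P × Q)} {p q : P × Q} (h : MaximalIn ψ p) (hφ : φ ⊆ ψ) (hb : Below φ p q) :
    p = q := by
  rcases hb.cases_head with rfl | ⟨r, hr, -⟩
  · rfl
  · exact absurd hr.2.2 (h.2 r (hφ hr.2.1))

theorem SecBij.mono_secured {φ ψ : Set (P.Ev × Q.Ev)} (hψ : Secured ψ) (h : φ ⊆ ψ) :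
    Secured φ := fun p hp hc => hψ p (h hp) (Relation.TransGen.mono (causes_mono h) _ _ hc)

theorem SecBij.exists_maximal_above {ψ : Set (P.Ev × Q.Ev)} (hψ : ψ ∈ SecBij f g)
    {p : P.Ev × Q.Ev} (hp : p ∈ ψ) : ∃ q, MaximalIn ψ q ∧ Below ψ p q := by
  have hsub : {q ∈ ψ | Below ψ p q} ⊆ ψ := fun _ h => h.1
  obtain ⟨q, hq, hmax⟩ := (mono_secured hψ.2.2.2 hsub).exists_maximal
    ((SecBij.finite hψ).subset hsub) ⟨p, hp, .refl⟩
  refine ⟨q, ⟨hq.1, fun r hr hlt => hmax r ⟨hr, hq.2.tail ⟨hq.1, hr, hlt⟩⟩ hlt⟩, hq.2⟩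

/-- Consistency and security are inherited from the bound `ψ`, down-closure from the members. -/
theorem SecBij.biUnion {ψ : Set (P.Ev × Q.Ev)} (hψ : ψ ∈ SecBij f g)
    {X : Set (Set (P.Ev × Q.Ev))} (hX : ∀ φ ∈ X, φ ∈ SecBij f g ∧ φ ⊆ ψ) :
    ⋃₀ X ∈ SecBij f g := by
  have hsub : ⋃₀ X ⊆ ψ := Set.sUnion_subset fun φ hφ => (hX φ hφ).2
  refine ⟨⟨P.con_subset _ hψ.1.1 _ (Set.image_mono hsub), ?_⟩,
    ⟨Q.con_subset _ hψ.2.1.1 _ (Set.image_mono hsub), ?_⟩, fun p hp => hψ.2.2.1 p (hsub hp),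
    mono_secured hψ.2.2.2 hsub⟩
  · rintro _ ⟨p, ⟨φ, hφ, hp⟩, rfl⟩ e he
    obtain ⟨q, hq, rfl⟩ := (hX φ hφ).1.1.2 _ ⟨p, hp, rfl⟩ e he
    exact ⟨q, ⟨φ, hφ, hq⟩, rfl⟩
  · rintro _ ⟨p, ⟨φ, hφ, hp⟩, rfl⟩ e he
    obtain ⟨q, hq, rfl⟩ := (hX φ hφ).1.2.1.2 _ ⟨p, hp, rfl⟩ e he
    exact ⟨q, ⟨φ, hφ, hq⟩, rfl⟩

/-- Under a common bound a prime is determined by its top, so `φ` is the part of `χ` below `φ.top`.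
-/
theorem PrimeBij.le_of_top_mem {ψ : Set (P.Ev × Q.Ev)} (hψ : ψ ∈ SecBij f g) {φ χ : PrimeBij f g}
    (h1 : φ.1 ⊆ ψ) (h2 : χ.1 ⊆ ψ) (h : φ.top ∈ χ.1) : φ ≤ χ := by
  have : φ = PrimeBij.gen χ.2.1 h :=
    PrimeBij.eq_of_top hψ h1 (Set.Subset.trans (PrimeBij.gen_le χ h) h2) (by rw [top_gen])
  rw [this]
  exact PrimeBij.gen_le χ h

variable {V : Set (pullback f g).Ev}

/-- The union of the prime secured bijections in a set of events of a hiding of the pullback. -/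
def support (x : Set ((pullback f g).hide V).Ev) : Set (P.Ev × Q.Ev) :=
  {p | ∃ e ∈ x, p ∈ e.1.1}

theorem support_mem {x : Set ((pullback f g).hide V).Ev} (hx : ((pullback f g).hide V).IsConf x) :
    support x ∈ SecBij f g := by
  obtain ⟨⟨-, ψ, hψ, h⟩, -⟩ := hx
  have : support x = ⋃₀ ((fun e => e.1.1) '' x) := by ext p; simp [support]
  rw [this]
  refine SecBij.biUnion hψ ?_
  rintro _ ⟨e, he, rfl⟩
  exact ⟨e.1.2.1, h e.1 ⟨e, he, rfl⟩⟩

theorem subset_support {x : Set ((pullback f g).hide V).Ev} {e : ((pullback f g).hide V).Ev}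
    (he : e ∈ x) : e.1.1 ⊆ support x := fun _ hp => ⟨e, he, hp⟩

theorem mem_of_top_mem_support {x : Set ((pullback f g).hide V).Ev}
    (hx : ((pullback f g).hide V).IsConf x) {e : ((pullback f g).hide V).Ev}
    (he : e.1.1 ⊆ support x) : e ∈ x := by
  obtain ⟨e', he', h⟩ := he (PrimeBij.top_mem e.1)
  exact hx.2 e' he' e (PrimeBij.le_of_top_mem (support_mem hx) he (subset_support he') h)

/-- A configuration is recovered from its support as the set of visible primes contained in it. -/
theorem support_injOn {x y : Set ((pullback f g).hide V).Ev}
    (hx : ((pullback f g).hide V).IsConf x) (hy : ((pullback f g).hide V).IsConf y)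
    (h : support x = support y) : x = y := by
  ext e
  exact ⟨fun he => mem_of_top_mem_support hy (h ▸ subset_support he),
    fun he => mem_of_top_mem_support hx (h.symm ▸ subset_support he)⟩

theorem gen_mem_of_mem_support {x : Set ((pullback f g).hide V).Ev}
    (hx : ((pullback f g).hide V).IsConf x) {p : P.Ev × Q.Ev} (hp : p ∈ support x)
    (hV : PrimeBij.gen (support_mem hx) hp ∈ V) :
    (⟨PrimeBij.gen (support_mem hx) hp, hV⟩ : ((pullback f g).hide V).Ev) ∈ x :=
  mem_of_top_mem_support hx fun _ hq => hq.1

/-- The events of a hiding of the pullback below a secured bijection. -/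
def eventsBelow (V : Set (pullback f g).Ev) (ψ : Set (P.Ev × Q.Ev)) :
    Set ((pullback f g).hide V).Ev :=
  {e | e.1.1 ⊆ ψ}

theorem isConf_eventsBelow {ψ : Set (P.Ev × Q.Ev)} (hψ : ψ ∈ SecBij f g) :
    ((pullback f g).hide V).IsConf (eventsBelow V ψ) := by
  refine ⟨⟨?_, ψ, hψ, ?_⟩, fun e he e' hle => Set.Subset.trans hle he⟩
  · refine ((SecBij.finite hψ).finite_subsets.preimage
      (Subtype.val_injective (p := _)).injOn).subset ?_
    rintro _ ⟨e, he, rfl⟩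
    exact he
  · rintro _ ⟨e, he, rfl⟩
    exact he

/-- Every element lies below a maximal one, whose history is an event that survives hiding; so
nothing of `ψ` is lost. -/
theorem support_eventsBelow {ψ : Set (P.Ev × Q.Ev)} (hψ : ψ ∈ SecBij f g)
    (hV : ∀ q (hq : MaximalIn ψ q), PrimeBij.gen hψ hq.1 ∈ V) :
    support (eventsBelow V ψ) = ψ := by
  ext p
  constructor
  · rintro ⟨e, he, hp⟩; exact he hp
  · intro hp
    obtain ⟨q, hq, hb⟩ := SecBij.exists_maximal_above hψ hp
    exact ⟨⟨_, hV q hq⟩, fun _ h => h.1, hp, hb⟩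

/-- The top of a maximal event of a configuration whose support has visible maximal elements. -/
theorem maximalIn_top {x : Set ((pullback f g).hide V).Ev}
    (hx : ((pullback f g).hide V).IsConf x)
    (hV : ∀ q (hq : MaximalIn (support x) q), PrimeBij.gen (support_mem hx) hq.1 ∈ V)
    {e : ((pullback f g).hide V).Ev} (he : Maximal (· ∈ x) e) :
    MaximalIn (support x) (PrimeBij.top e.1) := by
  have hsub := subset_support he.1
  refine ⟨hsub (PrimeBij.top_mem e.1), fun r hr hlt => ?_⟩
  obtain ⟨q, hq, hb⟩ := SecBij.exists_maximal_above (support_mem hx) hr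
  have hc : causes (support x) (PrimeBij.top e.1) r := ⟨hsub (PrimeBij.top_mem e.1), hr, hlt⟩
  -- The event generated by `q` contains `e`, so by maximality of `e` it is included in `e`. Then
  -- `q` is below the top of `e`, which closes a cycle through `r`.
  have hle : e ≤ ⟨_, hV q hq⟩ := fun p hp => ⟨hsub hp,
    (Relation.ReflTransGen.mono (causes_mono hsub) _ _ (PrimeBij.below_top e.1 p hp)).trans
      (.head hc hb)⟩
  have hq' : q ∈ e.1.1 := he.2 (gen_mem_of_mem_support hx hq.1 (hV q hq)) hle ⟨hq.1, .refl⟩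
  have hb' : Below (support x) q (PrimeBij.top e.1) :=
    Relation.ReflTransGen.mono (causes_mono hsub) _ _ (PrimeBij.below_top e.1 q hq')
  exact (support_mem hx).2.2.2 _ hc.1 ((Relation.TransGen.single hc).trans_left (hb.trans hb'))

/-- Every maximal element of the support of a configuration is the top of a maximal event. -/
theorem exists_maximal_event {x : Set ((pullback f g).hide V).Ev}
    (hx : ((pullback f g).hide V).IsConf x) {q : P.Ev × Q.Ev} (hq : MaximalIn (support x) q) :
    ∃ e, Maximal (· ∈ x) e ∧ PrimeBij.top e.1 = q := by
  obtain ⟨e, he, hqe⟩ := hq.1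
  have htop : q = PrimeBij.top e.1 :=
    hq.eq_of_below (subset_support he) (PrimeBij.below_top e.1 q hqe)
  refine ⟨e, ⟨he, fun e' he' hle => ?_⟩, htop.symm⟩
  have hq' : q ∈ e'.1.1 := hle hqe
  have htop' := hq.eq_of_below (subset_support he') (PrimeBij.below_top e'.1 q hq')
  exact (PrimeBij.eq_of_top (support_mem hx) (subset_support he') (subset_support he)
    (htop'.symm.trans htop)).le

end Pullback

/-! ## Configurations of the composition -/

section Composition

variable {A : TCG.{u₁}} {B : TCG.{u₂}} {C : TCG.{u₃}}

/-- The map `σ ∥ C`. -/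
abbrev PreStrategy.mapPar (σ : PreStrat.{u₁, u₂, u} A B) (C : TCG.{u₃}) :=
  EvMap.parRight (A := A.toEvStr) (B := B.toEvStr) σ.map C.toEvStr

/-- The map `A ∥ τ`. -/
abbrev PreStrategy.parMap (τ : PreStrat.{u₂, u₃, v} B C) (A : TCG.{u₁}) :=
  EvMap.parLeft (B := B.toEvStr) (C := C.toEvStr) τ.map A.toEvStr

section

variable {σ : PreStrat.{u₁, u₂, u} A B} {τ : PreStrat.{u₂, u₃, v} B C}

theorem mapPar_inl_of_inl {s : σ.S.Ev} {a : A.Ev} (h : σ.lbl s = Sum.inl a) :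
    (σ.mapPar C).toFun (Sum.inl s) = Sum.inl a := by
  change Equiv.sumAssoc A.Ev B.Ev C.Ev (Sum.inl (σ.lbl s)) = _
  rw [h]; rfl

theorem mapPar_inl_of_inr {s : σ.S.Ev} {b : B.Ev} (h : σ.lbl s = Sum.inr b) :
    (σ.mapPar C).toFun (Sum.inl s) = Sum.inr (Sum.inl b) := by
  change Equiv.sumAssoc A.Ev B.Ev C.Ev (Sum.inl (σ.lbl s)) = _
  rw [h]; rfl

theorem mapPar_inr (c : C.Ev) : (σ.mapPar C).toFun (Sum.inr c) = Sum.inr (Sum.inr c) := rfl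

theorem parMap_inl (a : A.Ev) : (τ.parMap A).toFun (Sum.inl a) = Sum.inl a := rfl

theorem parMap_inr (t : τ.S.Ev) : (τ.parMap A).toFun (Sum.inr t) = Sum.inr (τ.lbl t) := rfl

/-- The three kinds of synchronized pairs. -/
theorem sync_cases {p : (σ.S.Ev ⊕ C.Ev) × (A.Ev ⊕ τ.S.Ev)}
    (h : (σ.mapPar C).toFun p.1 = (τ.parMap A).toFun p.2) :
    (∃ s a, σ.lbl s = Sum.inl a ∧ p = (Sum.inl s, Sum.inl a)) ∨
    (∃ s t b, σ.lbl s = Sum.inr b ∧ τ.lbl t = Sum.inl b ∧ p = (Sum.inl s, Sum.inr t)) ∨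
    (∃ t c, τ.lbl t = Sum.inr c ∧ p = (Sum.inr c, Sum.inr t)) := by
  obtain ⟨s | c, a | t⟩ := p <;> dsimp only at h
  · rcases hs : σ.lbl s with a' | b
    · rw [mapPar_inl_of_inl hs, parMap_inl] at h
      cases h
      exact Or.inl ⟨s, a, hs, rfl⟩
    · rw [mapPar_inl_of_inr hs, parMap_inl] at h
      cases h
  · rcases hs : σ.lbl s with a' | b
    · rw [mapPar_inl_of_inl hs, parMap_inr] at h
      cases h
    · rw [mapPar_inl_of_inr hs, parMap_inr] at h
      exact Or.inr (Or.inl ⟨s, t, b, hs, (Sum.inr_injective h).symm, rfl⟩)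
  · rw [mapPar_inr, parMap_inl] at h
    cases h
  · rw [mapPar_inr, parMap_inr] at h
    exact Or.inr (Or.inr ⟨t, c, (Sum.inr_injective h).symm, rfl⟩)

/-- The bijection induced by a matching pair of configurations. -/
def matchBij (σ : PreStrat.{u₁, u₂, u} A B) (τ : PreStrat.{u₂, u₃, v} B C) (x : Set σ.S.Ev)
    (y : Set τ.S.Ev) : Set ((σ.S.Ev ⊕ C.Ev) × (A.Ev ⊕ τ.S.Ev)) :=
  syncBij σ τ x y (idRel (σ.right x))

variable {x : Set σ.S.Ev} {y : Set τ.S.Ev}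

theorem mem_matchBij {p : (σ.S.Ev ⊕ C.Ev) × (A.Ev ⊕ τ.S.Ev)} :
    p ∈ matchBij σ τ x y ↔ (∃ s ∈ x, ∃ a, σ.lbl s = Sum.inl a ∧ p = (Sum.inl s, Sum.inl a)) ∨
    (∃ s ∈ x, ∃ t ∈ y, ∃ b, σ.lbl s = Sum.inr b ∧ τ.lbl t = Sum.inl b ∧
      p = (Sum.inl s, Sum.inr t)) ∨
    (∃ t ∈ y, ∃ c, τ.lbl t = Sum.inr c ∧ p = (Sum.inr c, Sum.inr t)) := by
  refine or_congr Iff.rfl (or_congr ⟨?_, ?_⟩ Iff.rfl)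
  · rintro ⟨s, hs, t, ht, b, b', h1, h2, ⟨-, rfl : b = b'⟩, h3⟩
    exact ⟨s, hs, t, ht, b, h1, h2, h3⟩
  · rintro ⟨s, hs, t, ht, b, h1, h2, h3⟩
    exact ⟨s, hs, t, ht, b, b, h1, h2, ⟨⟨s, hs, h1⟩, rfl⟩, h3⟩

theorem inl_mem_matchBij {s : σ.S.Ev} {q : A.Ev ⊕ τ.S.Ev}
    (h : (Sum.inl s, q) ∈ matchBij σ τ x y) : s ∈ x := by
  rcases mem_matchBij.1 h with ⟨s', hs, a, -, h⟩ | ⟨s', hs, t, -, b, -, -, h⟩ | ⟨t, -, c, -, h⟩ <;>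
    cases h
  · exact hs
  · exact hs

theorem inr_mem_matchBij {q : σ.S.Ev ⊕ C.Ev} {t : τ.S.Ev}
    (h : (q, Sum.inr t) ∈ matchBij σ τ x y) : t ∈ y := by
  rcases mem_matchBij.1 h with ⟨s', hs, a, -, h⟩ | ⟨s', -, t, ht, b, -, -, h⟩ | ⟨t, ht, c, -, h⟩ <;>
    cases h
  · exact ht
  · exact ht

theorem iso_idRel (hx : σ.S.IsConf x) (h : σ.right x = τ.left y) :
    B.iso.Iso (idRel (σ.right x)) (σ.right x) (τ.left y) := by
  rw [← h]
  exact IsoFamily.iso_refl _ (PreStrategy.isConf_right hx)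

theorem exists_inl_mem_matchBij (hx : σ.S.IsConf x) (h : σ.right x = τ.left y) {s : σ.S.Ev}
    (hs : s ∈ x) : ∃ q, (Sum.inl s, q) ∈ matchBij σ τ x y :=
  syncBij_exists_left (iso_idRel hx h) hs

theorem exists_inr_mem_matchBij (hx : σ.S.IsConf x) (h : σ.right x = τ.left y) {t : τ.S.Ev}
    (ht : t ∈ y) : ∃ q, (q, Sum.inr t) ∈ matchBij σ τ x y :=
  syncBij_exists_right (iso_idRel hx h) ht

theorem matchBij_inj {x' : Set σ.S.Ev} {y' : Set τ.S.Ev} (hx : σ.S.IsConf x)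
    (hx' : σ.S.IsConf x') (h : σ.right x = τ.left y) (h' : σ.right x' = τ.left y')
    (he : matchBij σ τ x y = matchBij σ τ x' y') : x = x' ∧ y = y' := by
  refine ⟨?_, ?_⟩
  · ext s
    constructor <;> intro hs
    · exact inl_mem_matchBij (he.subset (exists_inl_mem_matchBij hx h hs).choose_spec)
    · exact inl_mem_matchBij (he.symm.subset (exists_inl_mem_matchBij hx' h' hs).choose_spec)
  · ext s
    constructor <;> intro hs
    · exact inr_mem_matchBij (he.subset (exists_inr_mem_matchBij hx h hs).choose_spec)
    · exact inr_mem_matchBij (he.symm.subset (exists_inr_mem_matchBij hx' h' hs).choose_spec)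

/-- Security is absence of deadlock for the identity matching on `B`; the projections are `x ∥ y_C`
and `x_A ∥ y`. -/
theorem matchBij_mem_secBij (hdl : DoNotDeadlock σ τ) (hx : σ.S.IsConf x) (hy : τ.S.IsConf y)
    (h : σ.right x = τ.left y) : matchBij σ τ x y ∈ SecBij (σ.mapPar C) (τ.parMap A) := by
  refine ⟨?_, ?_, ?_, hdl x y _ hx hy (iso_idRel hx h)⟩
  · rw [EvStr.isConf_par]
    constructor
    · convert hx using 1
      ext s
      constructor
      · rintro ⟨⟨_, q⟩, hp, rfl⟩; exact inl_mem_matchBij hp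
      · intro hs
        exact ⟨_, (exists_inl_mem_matchBij hx h hs).choose_spec, rfl⟩
    · convert PreStrategy.isConf_right hy using 1
      ext c
      constructor
      · rintro ⟨⟨_, q⟩, hp, rfl⟩
        rcases mem_matchBij.1 hp with ⟨s, hs, a, -, h⟩ | ⟨s, hs, t, -, b, -, -, h⟩ |
          ⟨t, ht, c, hc, h⟩ <;> cases h
        exact ⟨t, ht, hc⟩
      · rintro ⟨t, ht, hc⟩
        exact ⟨_, mem_matchBij.2 (Or.inr (Or.inr ⟨t, ht, c, hc, rfl⟩)), rfl⟩
  · rw [EvStr.isConf_par]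
    constructor
    · convert PreStrategy.isConf_left hx using 1
      ext a
      constructor
      · rintro ⟨⟨q, _⟩, hp, rfl⟩
        rcases mem_matchBij.1 hp with ⟨s, hs, a, ha, h⟩ | ⟨s, hs, t, -, b, -, -, h⟩ |
          ⟨t, ht, c, hc, h⟩ <;> cases h
        exact ⟨s, hs, ha⟩
      · rintro ⟨s, hs, ha⟩
        exact ⟨_, mem_matchBij.2 (Or.inl ⟨s, hs, a, ha, rfl⟩), rfl⟩
    · convert hy using 1
      ext s
      constructor
      · rintro ⟨⟨q, _⟩, hp, rfl⟩; exact inr_mem_matchBij hp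
      · intro hs
        exact ⟨_, (exists_inr_mem_matchBij hx h hs).choose_spec, rfl⟩
  · intro p hp
    rcases mem_matchBij.1 hp with ⟨s, hs, a, ha, rfl⟩ | ⟨s, hs, t, -, b, hb, hb', rfl⟩ |
      ⟨t, ht, c, hc, rfl⟩
    · rw [mapPar_inl_of_inl ha]; rfl
    · rw [mapPar_inl_of_inr hb, parMap_inr, hb']
    · rw [parMap_inr, hc]; rfl

/-- Every secured bijection between `σ ∥ C` and `A ∥ τ` comes from a matching pair. -/
theorem exists_eq_matchBij {ψ : Set ((σ.S.Ev ⊕ C.Ev) × (A.Ev ⊕ τ.S.Ev))}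
    (hψ : ψ ∈ SecBij (σ.mapPar C) (τ.parMap A)) :
    ∃ x y, σ.S.IsConf x ∧ τ.S.IsConf y ∧ σ.right x = τ.left y ∧ ψ = matchBij σ τ x y := by
  have hx := (EvStr.isConf_par.1 hψ.1).1
  have hy := (EvStr.isConf_par.1 hψ.2.1).2
  refine ⟨_, _, hx, hy, ?_, ?_⟩
  · ext b
    constructor
    · rintro ⟨s, ⟨⟨_, q⟩, hp, rfl⟩, hs⟩
      rcases sync_cases (hψ.2.2.1 _ hp) with ⟨s', a, h1, h2⟩ | ⟨s', t, b', h1, h2, h3⟩ |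
        ⟨t, c, h1, h2⟩
      · cases h2; rw [h1] at hs; cases hs
      · cases h3
        rw [h1] at hs
        cases hs
        exact ⟨t, ⟨_, hp, rfl⟩, h2⟩
      · cases h2
    · rintro ⟨t, ⟨⟨q, _⟩, hp, rfl⟩, ht⟩
      rcases sync_cases (hψ.2.2.1 _ hp) with ⟨s', a, h1, h2⟩ | ⟨s', t, b', h1, h2, h3⟩ |
        ⟨t, c, h1, h2⟩
      · cases h2
      · cases h3
        rw [h2] at ht
        cases ht
        exact ⟨s', ⟨_, hp, rfl⟩, h1⟩
      · cases h2; rw [h1] at ht; cases ht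
  · ext p
    rw [mem_matchBij]
    constructor
    · intro hp
      rcases sync_cases (hψ.2.2.1 _ hp) with ⟨s, a, h1, rfl⟩ | ⟨s, t, b, h1, h2, rfl⟩ |
        ⟨t, c, h1, rfl⟩
      · exact Or.inl ⟨s, ⟨_, hp, rfl⟩, a, h1, rfl⟩
      · exact Or.inr (Or.inl ⟨s, ⟨_, hp, rfl⟩, t, ⟨_, hp, rfl⟩, b, h1, h2, rfl⟩)
      · exact Or.inr (Or.inr ⟨t, ⟨_, hp, rfl⟩, c, h1, rfl⟩)
    · rintro (⟨s, ⟨⟨_, q⟩, hp, rfl⟩, a, h1, rfl⟩ | ⟨s, ⟨⟨_, q⟩, hp, rfl⟩, t, ht, b, h1, h2, rfl⟩ |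
        ⟨t, ⟨⟨q, _⟩, hp, rfl⟩, c, h1, rfl⟩)
      · rcases sync_cases (hψ.2.2.1 _ hp) with ⟨s', a', h2, h3⟩ | ⟨s', t, b', h2, h3, h4⟩ |
          ⟨t, c, h2, h3⟩
        · cases h3; rw [h1] at h2; cases h2; exact hp
        · cases h4; rw [h1] at h2; cases h2
        · cases h3
      · rcases sync_cases (hψ.2.2.1 _ hp) with ⟨s', a', h3, h4⟩ | ⟨s', t', b', h3, h4, h5⟩ |
          ⟨t, c, h3, h4⟩
        · cases h4; rw [h1] at h3; cases h3
        · cases h5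
          rw [h1] at h3
          cases h3
          obtain rfl : t = t' := τ.map.locally_inj _ hy ht ⟨_, hp, rfl⟩ (h2.trans h4.symm)
          exact hp
        · cases h4
      · rcases sync_cases (hψ.2.2.1 _ hp) with ⟨s', a', h2, h3⟩ | ⟨s', t, b', h2, h3, h4⟩ |
          ⟨t, c', h2, h3⟩
        · cases h3
        · cases h4; rw [h1] at h3; cases h3
        · cases h3; rw [h1] at h2; cases h2; exact hp

end

/-- All maximal elements are visible and positive. -/
def PlusMaximal (σ : PreStrat.{u₁, u₂, u} A B) (τ : PreStrat.{u₂, u₃, v} B C)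
    (ψ : Set ((σ.S.Ev ⊕ C.Ev) × (A.Ev ⊕ τ.S.Ev))) : Prop :=
  ∀ q, MaximalIn ψ q →
    (∃ s a, σ.lbl s = Sum.inl a ∧ q = (Sum.inl s, Sum.inl a) ∧ σ.S.pol s = Pol.pos) ∨
    (∃ t c, τ.lbl t = Sum.inr c ∧ q = (Sum.inr c, Sum.inr t) ∧ τ.S.pol t = Pol.pos)

/-! ### Courtesy and the maximal elements of a matching bijection -/

/-- Courtesy speaks of immediate causality only; finiteness of causes provides the first step of a
strict inequality. -/
theorem EvStr.exists_covBy_le (E : EvStr.{u}) {e e' : E.Ev} (h : e < e') :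
    ∃ d, e ⋖ d ∧ d ≤ e' := by
  obtain ⟨d, hd⟩ := ((E.finite_causes e').subset (fun _ h => h.2 : {d | e < d ∧ d ≤ e'} ⊆ _)
    ).exists_minimal ⟨e', h, le_rfl⟩
  refine ⟨d, ⟨hd.1.1, fun c hc hcd => ?_⟩, hd.1.2⟩
  exact hcd.not_ge (hd.2 ⟨hc, hcd.le.trans hd.1.2⟩ hcd.le)

theorem not_lt_of_maximal {α : Type u} [PartialOrder α] {x : Set α} {s s' : α}
    (h : Maximal (· ∈ x) s) (hs' : s' ∈ x) : ¬ s < s' := fun hlt => hlt.not_ge (h.2 hs' hlt.le)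

theorem pol_eq_op (σ : PreStrat.{u₁, u₂, u} A B) (τ : PreStrat.{u₂, u₃, v} B C) {s : σ.S.Ev}
    {t : τ.S.Ev} {b : B.Ev} (hs : σ.lbl s = Sum.inr b) (ht : τ.lbl t = Sum.inl b) :
    τ.S.pol t = (σ.S.pol s).op := by
  rw [← σ.map_pol, ← τ.map_pol, show σ.map.toFun s = _ from hs, show τ.map.toFun t = _ from ht]
  rfl

/-- The components of a pair synchronized in `B` have opposite polarities, so they cannot both be
positive: this excludes hidden maximal pairs when `x` and `y` are `+`-covered. Conversely, a
negative maximal event displayed in `B` would belong to a maximal pair, by courtesy at its positive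
partner, and that pair would be hidden. -/
theorem plusMaximal_matchBij (σ : Strat.{u₁, u₂, u} A B) (τ : Strat.{u₂, u₃, v} B C)
    {x : Set σ.S.Ev} {y : Set τ.S.Ev} (hx : σ.S.IsConf x) (hy : τ.S.IsConf y)
    (h : σ.right x = τ.left y) :
    PlusMaximal σ.toPreStrategy τ.toPreStrategy (matchBij σ.toPreStrategy τ.toPreStrategy x y) ↔
      σ.S.PlusCovered x ∧ τ.S.PlusCovered y := by
  constructor
  · intro H
    constructor
    · intro s hs
      rcases hl : σ.lbl s with a | b
      · have hp : (Sum.inl s, Sum.inl a) ∈ matchBij σ.toPreStrategy τ.toPreStrategy x y :=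
          mem_matchBij.2 (Or.inl ⟨s, hs.1, a, hl, rfl⟩)
        suffices hM : MaximalIn (matchBij σ.toPreStrategy τ.toPreStrategy x y)
            (Sum.inl s, Sum.inl a) by
          rcases H _ hM with ⟨s', a', -, h2, h3⟩ | ⟨t, c, -, h2, -⟩
          · cases h2; exact h3
          · cases h2
        refine ⟨hp, ?_⟩
        intro q hq hlt
        rcases mem_matchBij.1 hq with ⟨s', hs', a', ha', rfl⟩ | ⟨s', hs', t, -, b, -, -, rfl⟩ |
          ⟨t, -, c, -, rfl⟩
        · rcases hlt with hlt | hlt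
          · exact not_lt_of_maximal hs hs' (Sum.inl_lt_inl_iff.1 hlt)
          · refine not_lt_of_maximal hs hs' (σ.map.lt_of_map_lt hx hs.1 hs' ?_)
            change σ.lbl s < σ.lbl s'
            rw [hl, ha']
            exact Sum.inl_lt_inl_iff.2 (Sum.inl_lt_inl_iff.1 hlt)
        · rcases hlt with hlt | hlt
          · exact not_lt_of_maximal hs hs' (Sum.inl_lt_inl_iff.1 hlt)
          · simp at hlt
        · simp at hlt
      · obtain ⟨t, ht, htb⟩ : b ∈ τ.left y := h ▸ ⟨s, hs.1, hl⟩
        by_contra hn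
        have hpt : τ.S.pol t = Pol.pos := by
          rw [pol_eq_op _ _ hl htb, Pol.op_eq_pos]
          cases hq : σ.S.pol s with
          | pos => exact absurd hq hn
          | neg => rfl
        have hp : (Sum.inl s, Sum.inr t) ∈ matchBij σ.toPreStrategy τ.toPreStrategy x y :=
          mem_matchBij.2 (Or.inr (Or.inl ⟨s, hs.1, t, ht, b, hl, htb, rfl⟩))
        suffices hM : MaximalIn (matchBij σ.toPreStrategy τ.toPreStrategy x y)
            (Sum.inl s, Sum.inr t) by
          rcases H _ hM with ⟨s', a', -, h2, h3⟩ | ⟨t, c, -, h2, -⟩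
          · cases h2
          · cases h2
        refine ⟨hp, ?_⟩
        have hs'' : ∀ s' ∈ x, ¬ s < s' := fun s' => not_lt_of_maximal hs
        -- As `t` is positive, courtesy puts the label of a first successor `d` above `b`. That
        -- label is then in `B`, hence also displayed by an event of `x`, which must lie above `s`:
        -- a contradiction.
        have ht'' : ∀ t' ∈ y, ¬ t < t' := by
          intro t' ht' hlt
          obtain ⟨d, hd, hdt⟩ := τ.S.exists_covBy_le hlt
          have hd' := (τ.courteous t d hd (Or.inl hpt)).lt
          change τ.lbl t < τ.lbl d at hd'
          rcases hdl : τ.lbl d with b' | c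
          · obtain ⟨s', hs', hsb'⟩ : b' ∈ σ.right x := h ▸ ⟨d, hy.mem ht' hdt, hdl⟩
            refine hs'' s' hs' (σ.map.lt_of_map_lt hx hs.1 hs' ?_)
            change σ.lbl s < σ.lbl s'
            rw [htb, hdl, Sum.inl_lt_inl_iff] at hd'
            rwa [hl, hsb', Sum.inr_lt_inr_iff]
          · rw [htb, hdl] at hd'
            simp at hd'
        intro q hq hlt
        rcases mem_matchBij.1 hq with ⟨s', hs', a', ha', rfl⟩ | ⟨s', hs', t, ht, b, -, -, rfl⟩ |
          ⟨t, ht, c, -, rfl⟩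
        · rcases hlt with hlt | hlt
          · exact hs'' _ hs' (Sum.inl_lt_inl_iff.1 hlt)
          · simp at hlt
        · rcases hlt with hlt | hlt
          · exact hs'' _ hs' (Sum.inl_lt_inl_iff.1 hlt)
          · exact ht'' _ ht (Sum.inr_lt_inr_iff.1 hlt)
        · rcases hlt with hlt | hlt
          · simp at hlt
          · exact ht'' _ ht (Sum.inr_lt_inr_iff.1 hlt)
    · intro t ht
      rcases hl : τ.lbl t with b | c
      · obtain ⟨s, hs, hsb⟩ : b ∈ σ.right x := h ▸ ⟨t, ht.1, hl⟩
        by_contra hn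
        have hps : σ.S.pol s = Pol.pos := by
          have := pol_eq_op _ _ hsb hl
          cases hq : σ.S.pol s with
          | pos => rfl
          | neg => rw [hq] at this; exact absurd this hn
        have hp : (Sum.inl s, Sum.inr t) ∈ matchBij σ.toPreStrategy τ.toPreStrategy x y :=
          mem_matchBij.2 (Or.inr (Or.inl ⟨s, hs, t, ht.1, b, hsb, hl, rfl⟩))
        suffices hM : MaximalIn (matchBij σ.toPreStrategy τ.toPreStrategy x y)
            (Sum.inl s, Sum.inr t) by
          rcases H _ hM with ⟨s', a', -, h2, h3⟩ | ⟨t, c, -, h2, -⟩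
          · cases h2
          · cases h2
        refine ⟨hp, ?_⟩
        have ht'' : ∀ t' ∈ y, ¬ t < t' := fun t' => not_lt_of_maximal ht
        -- The symmetric argument, with courtesy of `σ` at the positive event `s`.
        have hs'' : ∀ s' ∈ x, ¬ s < s' := by
          intro s' hs' hlt
          obtain ⟨d, hd, hds⟩ := σ.S.exists_covBy_le hlt
          have hd' := (σ.courteous s d hd (Or.inl hps)).lt
          change σ.lbl s < σ.lbl d at hd'
          rcases hdl : σ.lbl d with a | b'
          · rw [hsb, hdl] at hd'
            simp at hd'
          · obtain ⟨t', ht', htb'⟩ : b' ∈ τ.left y := h ▸ ⟨d, hx.mem hs' hds, hdl⟩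
            refine ht'' t' ht' (τ.map.lt_of_map_lt hy ht.1 ht' ?_)
            change τ.lbl t < τ.lbl t'
            rw [hsb, hdl, Sum.inr_lt_inr_iff] at hd'
            rwa [hl, htb', Sum.inl_lt_inl_iff]
        intro q hq hlt
        rcases mem_matchBij.1 hq with ⟨s', hs', a', ha', rfl⟩ | ⟨s', hs', t, ht, b, -, -, rfl⟩ |
          ⟨t, ht, c, -, rfl⟩
        · rcases hlt with hlt | hlt
          · exact hs'' _ hs' (Sum.inl_lt_inl_iff.1 hlt)
          · simp at hlt
        · rcases hlt with hlt | hlt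
          · exact hs'' _ hs' (Sum.inl_lt_inl_iff.1 hlt)
          · exact ht'' _ ht (Sum.inr_lt_inr_iff.1 hlt)
        · rcases hlt with hlt | hlt
          · simp at hlt
          · exact ht'' _ ht (Sum.inr_lt_inr_iff.1 hlt)
      · have hp : (Sum.inr c, Sum.inr t) ∈ matchBij σ.toPreStrategy τ.toPreStrategy x y :=
          mem_matchBij.2 (Or.inr (Or.inr ⟨t, ht.1, c, hl, rfl⟩))
        suffices hM : MaximalIn (matchBij σ.toPreStrategy τ.toPreStrategy x y)
            (Sum.inr c, Sum.inr t) by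
          rcases H _ hM with ⟨s', a', -, h2, h3⟩ | ⟨t, c, -, h2, h3⟩
          · cases h2
          · cases h2; exact h3
        refine ⟨hp, ?_⟩
        intro q hq hlt
        rcases mem_matchBij.1 hq with ⟨s', hs', a', ha', rfl⟩ | ⟨s', hs', t', ht', b, -, -, rfl⟩ |
          ⟨t', ht', c', hc', rfl⟩
        · simp at hlt
        · rcases hlt with hlt | hlt
          · simp at hlt
          · exact not_lt_of_maximal ht ht' (Sum.inr_lt_inr_iff.1 hlt)
        · rcases hlt with hlt | hlt
          · refine not_lt_of_maximal ht ht' (τ.map.lt_of_map_lt hy ht.1 ht' ?_)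
            change τ.lbl t < τ.lbl t'
            rw [hl, hc']
            exact Sum.inr_lt_inr_iff.2 (Sum.inr_lt_inr_iff.1 hlt)
          · exact not_lt_of_maximal ht ht' (Sum.inr_lt_inr_iff.1 hlt)
  · rintro ⟨hxp, hyp⟩ q ⟨hq, hmax⟩
    have hms : ∀ {s r}, s ∈ x → q = (Sum.inl s, r) → σ.S.pol s = Pol.pos := by
      rintro s r hs rfl
      refine hxp s ⟨hs, fun s' hs' hle => ?_⟩
      rcases hle.eq_or_lt with rfl | hlt
      · exact le_rfl
      · obtain ⟨r', hr'⟩ := exists_inl_mem_matchBij hx h hs'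
        exact absurd (Or.inl (Sum.inl_lt_inl_iff.2 hlt)) (hmax _ hr')
    have hmt : ∀ {t r}, t ∈ y → q = (r, Sum.inr t) → τ.S.pol t = Pol.pos := by
      rintro t r ht rfl
      refine hyp t ⟨ht, fun t' ht' hle => ?_⟩
      rcases hle.eq_or_lt with rfl | hlt
      · exact le_rfl
      · obtain ⟨r', hr'⟩ := exists_inr_mem_matchBij hx h ht'
        exact absurd (Or.inr (Sum.inr_lt_inr_iff.2 hlt)) (hmax _ hr')
    rcases mem_matchBij.1 hq with ⟨s, hs, a, ha, hqe⟩ | ⟨s, hs, t, ht, b, hb, hb', hqe⟩ |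
      ⟨t, ht, c, hc, hqe⟩
    · exact Or.inl ⟨s, a, ha, hqe, hms hs hqe⟩
    · have h1 := hmt ht hqe
      rw [pol_eq_op _ _ hb hb', hms hs hqe] at h1
      cases h1
    · exact Or.inr ⟨t, c, hc, hqe, hmt ht hqe⟩

/-! ### Displays and polarities in the composition -/

section

variable {σ : PreStrat.{u₁, u₂, u} A B} {τ : PreStrat.{u₂, u₃, v} B C}

theorem lbl_comp_inl {e : (τ.comp σ).S.Ev} {s : σ.S.Ev} {a : A.Ev} (ha : σ.lbl s = Sum.inl a)
    {r} (ht : PrimeBij.top e.1 = (Sum.inl s, r)) : (τ.comp σ).lbl e = Sum.inl a := by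
  apply outer_injective (B := B.toEvStr)
  refine (outer_compositeLbl (A := A.toEvStr) (B := B.toEvStr) (C := C.toEvStr) σ.map τ.map e).trans
    ?_
  rw [interactionLbl, ht]
  exact mapPar_inl_of_inl ha

theorem lbl_comp_inr {e : (τ.comp σ).S.Ev} {c : C.Ev}
    {r} (ht : PrimeBij.top e.1 = (Sum.inr c, r)) : (τ.comp σ).lbl e = Sum.inr c := by
  apply outer_injective (B := B.toEvStr)
  refine (outer_compositeLbl (A := A.toEvStr) (B := B.toEvStr) (C := C.toEvStr) σ.map τ.map e).trans
    ?_
  rw [interactionLbl, ht]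
  rfl

theorem pol_comp_inl {e : (τ.comp σ).S.Ev} {s : σ.S.Ev} {a : A.Ev} (ha : σ.lbl s = Sum.inl a)
    {r} (ht : PrimeBij.top e.1 = (Sum.inl s, r)) : (τ.comp σ).S.pol e = σ.S.pol s := by
  rw [← PreStrategy.map_pol, ← σ.map_pol, show (τ.comp σ).map.toFun e = _ from lbl_comp_inl ha ht,
    show σ.map.toFun s = _ from ha]
  rfl

theorem pol_comp_inr {e : (τ.comp σ).S.Ev} {t : τ.S.Ev} {c : C.Ev} (hc : τ.lbl t = Sum.inr c)
    {r} (ht : PrimeBij.top e.1 = (Sum.inr c, r)) : (τ.comp σ).S.pol e = τ.S.pol t := by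
  rw [← PreStrategy.map_pol, ← τ.map_pol, show (τ.comp σ).map.toFun e = _ from lbl_comp_inr ht,
    show τ.map.toFun t = _ from hc]
  rfl

/-- The top of a visible event is not synchronized in `B`. -/
theorem top_cases (e : (τ.comp σ).S.Ev) :
    (∃ s a, σ.lbl s = Sum.inl a ∧ PrimeBij.top e.1 = (Sum.inl s, Sum.inl a)) ∨
    (∃ t c, τ.lbl t = Sum.inr c ∧ PrimeBij.top e.1 = (Sum.inr c, Sum.inr t)) := by
  rcases sync_cases (e.1.2.1.2.2.1 _ (PrimeBij.top_mem e.1)) with h | ⟨s, t, b, h1, h2, h3⟩ | h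
  · exact Or.inl h
  · obtain ⟨z, hz⟩ := e.2
    rw [interactionLbl, h3, show (EvMap.parRight (A := A.toEvStr) (B := B.toEvStr) σ.map
      C.toEvStr).toFun _ = _ from mapPar_inl_of_inr h1] at hz
    rcases z with a | c <;> cases hz
  · exact Or.inr h

theorem gen_visible_inl {ψ : Set ((σ.S.Ev ⊕ C.Ev) × (A.Ev ⊕ τ.S.Ev))}
    (hψ : ψ ∈ SecBij (σ.mapPar C) (τ.parMap A)) {s : σ.S.Ev} {a : A.Ev}
    (ha : σ.lbl s = Sum.inl a) {q} {r} (hq : q ∈ ψ) (h : q = (Sum.inl s, r)) :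
    PrimeBij.gen hψ hq ∈ visible (A := A.toEvStr) (B := B.toEvStr) (C := C.toEvStr) σ.map τ.map :=
  ⟨Sum.inl a, by rw [interactionLbl, PrimeBij.top_gen, h]; exact (mapPar_inl_of_inl ha).symm⟩

theorem gen_visible_inr {ψ : Set ((σ.S.Ev ⊕ C.Ev) × (A.Ev ⊕ τ.S.Ev))}
    (hψ : ψ ∈ SecBij (σ.mapPar C) (τ.parMap A)) {c : C.Ev} {q} {r} (hq : q ∈ ψ)
    (h : q = (Sum.inr c, r)) :
    PrimeBij.gen hψ hq ∈ visible (A := A.toEvStr) (B := B.toEvStr) (C := C.toEvStr) σ.map τ.map :=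
  ⟨Sum.inr c, by rw [interactionLbl, PrimeBij.top_gen, h]; rfl⟩

theorem PlusMaximal.visible {ψ : Set ((σ.S.Ev ⊕ C.Ev) × (A.Ev ⊕ τ.S.Ev))}
    (h : PlusMaximal σ τ ψ) (hψ : ψ ∈ SecBij (σ.mapPar C) (τ.parMap A)) (q)
    (hq : MaximalIn ψ q) : PrimeBij.gen hψ hq.1 ∈
      visible (A := A.toEvStr) (B := B.toEvStr) (C := C.toEvStr) σ.map τ.map := by
  rcases h q hq with ⟨s, a, ha, he, -⟩ | ⟨t, c, -, he, -⟩
  · exact gen_visible_inl hψ ha hq.1 he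
  · exact gen_visible_inr hψ hq.1 he

/-- Tops relate maximal events of `x` to maximal elements of its support, and the polarity of a
visible event is read at its top. -/
theorem plusCovered_comp_iff {x : Set (τ.comp σ).S.Ev} (hx : (τ.comp σ).S.IsConf x) :
    (τ.comp σ).S.PlusCovered x ↔ PlusMaximal σ τ (support x) := by
  constructor
  · intro h q hq
    obtain ⟨e, he, rfl⟩ := exists_maximal_event hx hq
    have hp := h e he
    rcases top_cases e with ⟨s, a, ha, ht⟩ | ⟨t, c, hc, ht⟩
    · exact Or.inl ⟨s, a, ha, ht, (pol_comp_inl ha ht).symm.trans hp⟩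
    · exact Or.inr ⟨t, c, hc, ht, (pol_comp_inr hc ht).symm.trans hp⟩
  · intro h e he
    have hm := maximalIn_top hx (h.visible (support_mem hx)) he
    rcases h _ hm with ⟨s, a, ha, ht, hp⟩ | ⟨t, c, hc, ht, hp⟩
    · exact (pol_comp_inl ha ht).trans hp
    · exact (pol_comp_inr hc ht).trans hp

/-- Every element of the support displayed in `A`, maximal or not, generates a visible event, which
belongs to `x` by down-closure. -/
theorem left_comp {x : Set (τ.comp σ).S.Ev} (hx : (τ.comp σ).S.IsConf x) {y : Set σ.S.Ev}
    {z : Set τ.S.Ev} (h : support x = matchBij σ τ y z) : (τ.comp σ).left x = σ.left y := by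
  ext a
  constructor
  · rintro ⟨e, he, hl⟩
    have hm := h.subset (subset_support he (PrimeBij.top_mem e.1))
    rcases top_cases e with ⟨s, a', ha, ht⟩ | ⟨t, c, hc, ht⟩
    · rw [lbl_comp_inl ha ht] at hl
      cases hl
      rw [ht] at hm
      exact ⟨s, inl_mem_matchBij hm, ha⟩
    · rw [lbl_comp_inr ht] at hl
      cases hl
  · rintro ⟨s, hs, ha⟩
    have hm : (Sum.inl s, Sum.inl a) ∈ support x :=
      h.symm.subset (mem_matchBij.2 (Or.inl ⟨s, hs, a, ha, rfl⟩))
    exact ⟨_, gen_mem_of_mem_support hx hm (gen_visible_inl (support_mem hx) ha hm rfl),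
      lbl_comp_inl ha (PrimeBij.top_gen (support_mem hx) hm)⟩

theorem right_comp {x : Set (τ.comp σ).S.Ev} (hx : (τ.comp σ).S.IsConf x) {y : Set σ.S.Ev}
    {z : Set τ.S.Ev} (h : support x = matchBij σ τ y z) : (τ.comp σ).right x = τ.right z := by
  ext c
  constructor
  · rintro ⟨e, he, hl⟩
    have hm := h.subset (subset_support he (PrimeBij.top_mem e.1))
    rcases top_cases e with ⟨s, a', ha, ht⟩ | ⟨t, c, hc, ht⟩
    · rw [lbl_comp_inl ha ht] at hl
      cases hl
    · rw [lbl_comp_inr ht] at hl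
      cases hl
      rw [ht] at hm
      exact ⟨t, inr_mem_matchBij hm, hc⟩
  · rintro ⟨t, ht, hc⟩
    have hm : (Sum.inr c, Sum.inr t) ∈ support x :=
      h.symm.subset (mem_matchBij.2 (Or.inr (Or.inr ⟨t, ht, c, hc, rfl⟩)))
    exact ⟨_, gen_mem_of_mem_support hx hm (gen_visible_inr (support_mem hx) hm rfl),
      lbl_comp_inr (PrimeBij.top_gen (support_mem hx) hm)⟩

end

/-- The witnesses of a composition correspond to the matching pairs. -/
theorem coll_comp (σ : Strat.{u₁, u₂, u} A B) (τ : Strat.{u₂, u₃, v} B C)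
    (hdl : DoNotDeadlock σ.toPreStrategy τ.toPreStrategy) (rA : A.Reps) (rC : C.Reps)
    (X : A.SymClass) (Z : C.SymClass) :
    (τ.toPreStrategy.comp σ.toPreStrategy).coll rA rC X Z =
      (matching σ.toPreStrategy τ.toPreStrategy rA rC X Z).encard := by
  -- Configurations of the composition and matching pairs are both faithfully encoded by secured
  -- bijections, and on either side `+`-coverage becomes the same condition `PlusMaximal`.
  refine enat_card_eq_of_rel (fun x p => support x.1.1 =
    matchBij σ.toPreStrategy τ.toPreStrategy p.1.1.1 p.1.2.1) ?_ ?_ ?_ ?_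
  · rintro ⟨⟨x, hx⟩, hc, hA, hC⟩
    obtain ⟨y, z, hy, hz, hyz, hm⟩ := exists_eq_matchBij (support_mem hx)
    obtain ⟨hyc, hzc⟩ := (plusMaximal_matchBij σ τ hy hz hyz).1
      (hm ▸ (plusCovered_comp_iff hx).1 hc)
    exact ⟨⟨(⟨y, hy⟩, ⟨z, hz⟩), hyc, hzc, hyz, left_comp hx hm ▸ hA, right_comp hx hm ▸ hC⟩, hm⟩
  · rintro ⟨⟨⟨y, hy⟩, ⟨z, hz⟩⟩, hyc, hzc, hyz, hA, hC⟩
    have hψ := matchBij_mem_secBij hdl hy hz hyz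
    have hp := (plusMaximal_matchBij σ τ hy hz hyz).2 ⟨hyc, hzc⟩
    have hx := isConf_eventsBelow (V := visible (A := A.toEvStr) (B := B.toEvStr)
      (C := C.toEvStr) σ.map τ.map) hψ
    have hs := support_eventsBelow hψ (hp.visible hψ)
    exact ⟨⟨⟨_, hx⟩, (plusCovered_comp_iff hx).2 (hs.symm ▸ hp), (left_comp hx hs).symm ▸ hA,
      (right_comp hx hs).symm ▸ hC⟩, hs⟩
  · rintro ⟨⟨x, hx⟩, _⟩ ⟨⟨⟨y, hy⟩, ⟨z, hz⟩⟩, hm⟩ ⟨⟨⟨y', hy'⟩, ⟨z', hz'⟩⟩, hm'⟩ h h'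
    obtain ⟨rfl, rfl⟩ : y = y' ∧ z = z' :=
      matchBij_inj hy hy' hm.2.2.1 hm'.2.2.1 (h.symm.trans h')
    rfl
  · rintro ⟨⟨x, hx⟩, _⟩ ⟨⟨x', hx'⟩, _⟩ p h h'
    obtain rfl : x = x' := support_injOn hx hx' (h.trans h'.symm)
    rfl

end Composition

end ThinGames

theorem mainTheorem1
    (A : ThinGames.TCG.{u₁}) (B : ThinGames.TCG.{u₂}) (C : ThinGames.TCG.{u₃})
    (σ : ThinGames.Strat.{u₁, u₂, u} A B) (τ : ThinGames.Strat.{u₂, u₃, v} B C)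
    (hdeadlock : ThinGames.DoNotDeadlock σ.toPreStrategy τ.toPreStrategy)
    (hB : B.Representable)
    (rA : A.Reps) (rB : B.Reps) (rC : C.Reps)
    (hrB : ∀ Y, B.Canonical (rB.rep Y))
    (X : A.SymClass) (Z : C.SymClass) :
    Summable (fun Y : B.SymClass =>
      σ.toPreStrategy.coll rA rB X Y * τ.toPreStrategy.coll rB rC Y Z) ∧
    (τ.toPreStrategy.comp σ.toPreStrategy).coll rA rC X Z =
      ∑' Y : B.SymClass, σ.toPreStrategy.coll rA rB X Y * τ.toPreStrategy.coll rB rC Y Z := by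
  exact ⟨ThinGames.enat_summable _, (ThinGames.coll_comp σ τ hdeadlock rA rC X Z).trans
    (ThinGames.card_matching σ τ hdeadlock rA rB rC hrB X Z)⟩
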